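/- Let $0<p<1$, $q=1-p$, $N\ge 1$, and let $\boldsymbol x^0,\boldsymbol x^1,\boldsymbol x^2,\dots$ be the discrete-time TASEP of $N$ particles $x_1>x_2>\dots>x_N$ on $\mathbb Z$ with backward sequential update, i.e. the Markov chain on $\{x_1>\dots>x_N\}\subset\mathbb Z^N$ with one-step transition probability $$P_1(\boldsymbol x|\boldsymbol y)=\prod_{i=1}^N\Big[(q+p\,\delta_{x_{i-1}-y_i,1})\,\delta_{x_i-y_i,0}+p\,\delta_{x_i-y_i,1}\Big],\qquad x_0=\infty,$$ started at time $0$ from the step configuration $x_i^0=1-i$. Fix an integer $x\ge 1-N$ and labels $1\le n_1<\dots<n_m\le N$, and let $t_{n_i}$ be the time at which particle $n_i$ jumps off the site $x+N-n_i$, i.e. the $t\ge 0$ such that the particle is at this site at time $t$ and at the next site at time $t+1$. Let $$K(n_1,\tau_1;n_2,\tau_2)=p\oint_{\Gamma_1}\frac{dv}{2\pi i\,v}\oint_{\Gamma_{0,v}}\frac{dw}{2\pi i\,w}\,\frac{\big(1-p\frac{w-1}{w}\big)^{\tau_1}\big(\frac{w-1}{w}\big)^{n_1}(w/v)^{x+N}}{\big(1-p\frac{v-1}{v}\big)^{\tau_2+1}\big(\frac{v-1}{v}\big)^{n_2}(w-v)}-\mathbf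 1(n_2>n_1)\oint_{\Gamma_{0,1}}\frac{p\,dz}{2\pi i\,z^2}\Big(\frac{z-1}{z}\Big)^{n_1-n_2}\Big(1-p\frac{z-1}{z}\Big)^{\tau_1-\tau_2-1},$$ where $\Gamma_1$ is the circle $|v-1|=r$ and $\Gamma_{0,v}$, $\Gamma_{0,1}$ are the circle $|w-1|=R$ (all anticlockwise), with any $0<r<1<R<1/(1-p)$; thus $\Gamma_1$ encircles $1$ but not $0$ or $-p/q$, and the other contour encircles $0$, $1$ and $\Gamma_1$ but not $-p/q$. Then almost surely the times $t_{n_i}$ are finite and $t_{n_1}\le\dots\le t_{n_m}$, and for all real $a_1,\dots,a_m$ $$\mathbf P(t_{n_1}\le a_1,\dots,t_{n_m}\le a_m)=\det(\mathbf 1-\chi_aK\chi_a)_{\ell^2(\{n_1,\dots,n_m\}\times\mathbb Z_{\ge x})},\qquad \chi_a(n_i)(t)=\mathbf 1(t>a_i).$$ Here the Fredholm determinant is the absolutely convergent series $$\sum_{k\ge0}\frac{(-1)^k}{k!}\sum_{i_1,\dots,i_k=1}^m\ \sum_{\substack{\tau_1>a_{i_1},\dots,\tau_k>a_{i_k}\\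 \tau_1,\dots,\tau_k\ge x}}\det\{K(n_{i_l},\tau_l;n_{i_j},\tau_j)\}_{l,j=1}^k ,$$ and, after conjugation by a suitable positive diagonal matrix (which changes no term of this series), $\chi_aK\chi_a$ is the matrix of a trace class operator on $\ell^2(\{n_1,\dots,n_m\}\times\mathbb Z_{\ge x})$. -/

import Mathlib

open MeasureTheory
open scoped ENNReal Real

noncomputable section

/-! ### TASEP with backward sequential update -/

/-- Configurations `x₁ > x₂ > ⋯ > x_N` of `N` particles on `ℤ`. The index `i : Fin N` stands for the
particle with label `i + 1`, so that `i = 0` is the rightmost particle. -/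
abbrev Config (N : ℕ) : Type := {c : Fin N → ℤ // StrictAnti c}

/-- The step initial configuration: particle `k = i + 1` sits at `1 - k = -i`. -/
def stepConfig (N : ℕ) : Config N :=
  ⟨fun i => -(i : ℤ), fun i j h => by simpa using h⟩

/-- The one-step transition probability from `y` to `x`: the product over the particles `i` of
`(q + p δ_{l,1}) δ_{k,0} + p δ_{k,1}` with `k = x_i - y_i`, `l = x_{i-1} - y_i`, `q = 1 - p`.
The rightmost particle is never blocked (`x_0 = ∞`). -/
def stepProb {N : ℕ} (p : ℝ) (x y : Config N) : ℝ :=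
  ∏ i : Fin N,
    (((1 - p) + if ∃ j : Fin N, (j : ℕ) + 1 = i ∧ x.1 j - y.1 i = 1 then p else 0) *
        (if x.1 i - y.1 i = 0 then 1 else 0) +
      p * (if x.1 i - y.1 i = 1 then 1 else 0))

/-- `X` is a TASEP of `N` particles with hopping probability `p`, started at time `0` from the step
configuration: every finite trajectory has the product of the one-step transition probabilities as
its probability. -/
structure IsStepTASEP {Ω : Type*} [MeasurableSpace Ω] (μ : Measure Ω) (N : ℕ) (p : ℝ)
    (X : ℕ → Ω → Config N) : Prop where
  measurable : ∀ t, Measurable (X t)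
  trajectory : ∀ (t : ℕ) (c : ℕ → Config N),
    μ.real {ω | ∀ s ≤ t, X s ω = c s} =
      (if c 0 = stepConfig N then 1 else 0) * ∏ s ∈ Finset.range t, stepProb p (c (s + 1)) (c s)

/-- The site `x + N - k` that the particle `k = i + 1` has to leave. -/
def exitSite (N : ℕ) (x : ℤ) (i : Fin N) : ℤ := x + N - ((i : ℤ) + 1)

/-- The time at which particle `i` jumps off the site `y`: the `t` with `x_i(t) = y` and
`x_i(t+1) = y + 1` (and `⊤` if there is none). -/
def jumpOffTime {Ω : Type*} {N : ℕ} (X : ℕ → Ω → Config N) (i : Fin N) (y : ℤ) (ω : Ω) : ℕ∞ :=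
  sInf {τ : ℕ∞ | ∃ t : ℕ, τ = t ∧ (X t ω).1 i = y ∧ (X (t + 1) ω).1 i = y + 1}

/-! ### The correlation kernel -/

/-- The kernel `K(n₁,τ₁;n₂,τ₂)`. The contour of `v` is the circle `|v - 1| = r` and the
contour of `w` and of `z` is the circle `|w - 1| = R`. For `0 < r < 1 < R < 1 / (1 - p)` the first one
encircles `1` but neither `0` nor `-p/(1-p)`, and the second one encircles `0`, `1` and the first
contour but not `-p/(1-p)`. -/
def corrKernel (p : ℝ) (N : ℕ) (x : ℤ) (r R : ℝ) (n₁ : ℕ) (τ₁ : ℤ) (n₂ : ℕ) (τ₂ : ℤ) : ℂ :=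
  (p : ℂ) * ((2 * π * Complex.I)⁻¹ * ∮ v in C(1, r), v⁻¹ *
      ((2 * π * Complex.I)⁻¹ * ∮ w in C(1, R), w⁻¹ *
        (((1 - p * ((w - 1) / w)) ^ τ₁ * ((w - 1) / w) ^ n₁ * (w / v) ^ (x + N)) /
          ((1 - p * ((v - 1) / v)) ^ (τ₂ + 1) * ((v - 1) / v) ^ n₂ * (w - v))))) -
  if n₁ < n₂ then
    (2 * π * Complex.I)⁻¹ * ∮ z in C(1, R), (p / z ^ 2) *
      (((z - 1) / z) ^ ((n₁ : ℤ) - n₂) * (1 - p * ((z - 1) / z)) ^ (τ₁ - τ₂ - 1))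
  else 0

/-- The set `{n₁, …, n_m} × ℤ_{≥ x}`, with `n_i` recorded by its position `i`. -/
abbrev LevelTime (m : ℕ) (x : ℤ) : Type := Fin m × {t : ℤ // x ≤ t}

/-- The indicator `χ_a(n_i)(t) = 1(t > a_i)`. -/
def cutoff {m : ℕ} {x : ℤ} (a : Fin m → ℝ) (s : LevelTime m x) : ℂ :=
  open Classical in if a s.1 < (s.2.1 : ℝ) then 1 else 0

/-- The matrix of `χ_a K χ_a` on `{n₁, …, n_m} × ℤ_{≥ x}`. -/
def cutKernel (p : ℝ) (N : ℕ) (x : ℤ) (r R : ℝ) {m : ℕ} (n : Fin m → Fin N) (a : Fin m → ℝ)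
    (s s' : LevelTime m x) : ℂ :=
  cutoff a s * corrKernel p N x r R ((n s.1 : ℕ) + 1) s.2.1 ((n s'.1 : ℕ) + 1) s'.2.1 * cutoff a s'

/-! ### Fredholm determinants on `ℓ²(S)` -/

/-- Absolute convergence of the Fredholm expansion of `det(1 - A)`. -/
def FredholmSummable {S : Type*} (A : S → S → ℂ) : Prop :=
  Summable fun q : Σ k : ℕ, (Fin k → S) =>
    ‖((-1 : ℂ) ^ q.1 / (q.1.factorial : ℂ)) *
      (Matrix.of fun i j : Fin q.1 => A (q.2 i) (q.2 j)).det‖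

/-- The Fredholm determinant `det(1 - A)` of a matrix indexed by a set `S`, through its Fredholm
expansion. -/
def fredholmDet {S : Type*} (A : S → S → ℂ) : ℂ :=
  ∑' k : ℕ, ((-1 : ℂ) ^ k / (k.factorial : ℂ)) *
    ∑' s : Fin k → S, (Matrix.of fun i j : Fin k => A (s i) (s j)).det

/-- Trace class operators on a Hilbert space: those which are a sum of rank one operators whose
trace norms are summable. -/
def IsTraceClass {H : Type*} [NormedAddCommGroup H] [InnerProductSpace ℂ H] (T : H →L[ℂ] H) : Prop :=
  ∃ (ι : Type) (u v : ι → H), (Summable fun i => ‖u i‖ * ‖v i‖) ∧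
    ∀ f : H, HasSum (fun i => inner ℂ (v i) f • u i) (T f)

/-- The matrix `A`, conjugated by some positive diagonal matrix (which changes no term of the
Fredholm expansion), is the matrix of a trace class operator on `ℓ²(S)`. -/
def TraceClassUpToConjugation {S : Type} (A : S → S → ℂ) : Prop :=
  ∃ ρ : S → ℝ, (∀ s, 0 < ρ s) ∧
    ∃ T : lp (fun _ : S => ℂ) 2 →L[ℂ] lp (fun _ : S => ℂ) 2, IsTraceClass T ∧
      ∀ s s', open Classical in
        T (lp.single 2 s' (1 : ℂ)) s = (ρ s : ℂ) * A s s' * (ρ s' : ℂ)⁻¹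

end

/-! Both sides are shown to equal the same finite determinant. Index particles from 0, let h be the
largest chosen index, and let b_l be the minimum of ⌊a_i⌋ over the chosen particles of index at
least l. The common value is the determinant over 0 ≤ i, l ≤ h of `-wtInt p 0 (p / 2) (x + N) (l - 1
- i) (b_l + 1)`, a residue at 0. With u = (w - 1)/w, every integrand is a product of powers of 1 -
pu, u and w, and du = dw/w². The identities 1 - (1 - pu) = pu, 1 - pu = (1 - p) + p/w and 1/w = 1 -
u turn into difference equations for the integrals (`wtInt_diff`, `wtInt_time`, `wtInt_space`),
which drive the whole argument.

Probability. Exit times increase with the index, so the event says that each particle l ≤ h has left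
its site by time b_l. The probability that all targets are met is a determinant in the remaining
jumps and remaining times, because that determinant solves the backward equation
(`det_exitMat_step`). Expanding it by multilinearity in the rows gives independent Bernoulli jumps.
A jump of a blocked particle only adds a multiple of its neighbour's row, so independent jumps may
be replaced by exclusion moves. The determinant is 1 when all targets are reached and 0 when a
deadline is missed, and backward induction in time concludes (`real_prefix_inter_future`).

Fredholm determinant. A finite geometric expansion in u_v/u_w writes the kernel as Σ_j ψ_{n₁-j}(τ₁)
φ_{n₂-j}(τ₂) minus a transition function ω (`corrKernel_eq`). Here ψ decays geometrically in time, φ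
grows slower than every κ^t with κ > 1, ω is iterated summation over the past, and Σ_t φ_k ψ_l =
δ_{kl} for l < N (`tendsto_gram`). For finitely many times, splitting off the unipotent factor
coming from ω and applying det(1 - CR) = det(1 - RC) leaves a matrix of size h + 1
(`det_section_eq`). Summation by parts carries the lower-level sums to level h, where
biorthogonality trades the infinite tail for a finite sum below the cut-off
(`tendsto_section_entry`). Iterated summation by parts then factors the limit into a unit triangular
matrix and the common determinant (`det_limit_eq`).

Analysis. Diagonal weights make the entries absolutely summable (`exists_summable_conj`). This gives
the trace class property, convergence of the expansion and the limit of finite sections. Finiteness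
of the exit times follows because the Fredholm determinant tends to 1 as the bounds grow. -/

noncomputable section

/-! ### Normalised circle integrals. -/

section ContourIntegrals

open Metric Set

/-- The normalised contour integral `(2πi)⁻¹ ∮ f` over the circle of centre `c` and radius `ρ`. -/
def nint (c : ℂ) (ρ : ℝ) (f : ℂ → ℂ) : ℂ := (2 * π * Complex.I)⁻¹ * ∮ w in C(c, ρ), f w

theorem nint_congr {c : ℂ} {ρ : ℝ} (hρ : 0 ≤ ρ) {f g : ℂ → ℂ} (h : EqOn f g (sphere c ρ)) :
    nint c ρ f = nint c ρ g := by
  unfold nint; rw [circleIntegral.integral_congr hρ h]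

theorem nint_add {c : ℂ} {ρ : ℝ} {f g : ℂ → ℂ} (hρ : 0 ≤ ρ) (hf : ContinuousOn f (sphere c ρ))
    (hg : ContinuousOn g (sphere c ρ)) :
    nint c ρ (fun w => f w + g w) = nint c ρ f + nint c ρ g := by
  unfold nint
  rw [← mul_add, circleIntegral.integral_add (hf.circleIntegrable hρ) (hg.circleIntegrable hρ)]

theorem nint_sub {c : ℂ} {ρ : ℝ} {f g : ℂ → ℂ} (hρ : 0 ≤ ρ) (hf : ContinuousOn f (sphere c ρ))
    (hg : ContinuousOn g (sphere c ρ)) :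
    nint c ρ (fun w => f w - g w) = nint c ρ f - nint c ρ g := by
  unfold nint
  rw [← mul_sub, circleIntegral.integral_sub (hf.circleIntegrable hρ) (hg.circleIntegrable hρ)]

theorem nint_const_mul (c : ℂ) (ρ : ℝ) (a : ℂ) (f : ℂ → ℂ) :
    nint c ρ (fun w => a * f w) = a * nint c ρ f := by
  unfold nint
  rw [circleIntegral.integral_const_mul]; ring

theorem nint_mul_const (c : ℂ) (ρ : ℝ) (a : ℂ) (f : ℂ → ℂ) :
    nint c ρ (fun w => f w * a) = nint c ρ f * a := by
  simp_rw [mul_comm _ a]; exact nint_const_mul c ρ a f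

theorem nint_eq_zero {c : ℂ} {ρ : ℝ} (hρ : 0 ≤ ρ) {f : ℂ → ℂ}
    (h : ∀ z ∈ closedBall c ρ, DifferentiableAt ℂ f z) : nint c ρ f = 0 := by
  unfold nint
  rw [Complex.circleIntegral_eq_zero_of_differentiable_on_off_countable hρ countable_empty
    (fun z hz => (h z hz).continuousAt.continuousWithinAt)
    (fun z hz => h z (ball_subset_closedBall hz.1)), mul_zero]

theorem nint_deriv {c : ℂ} {ρ : ℝ} (hρ : 0 ≤ ρ) {f f' : ℂ → ℂ}
    (h : ∀ z ∈ sphere c ρ, HasDerivAt f (f' z) z) : nint c ρ f' = 0 := by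
  unfold nint
  rw [circleIntegral.integral_eq_zero_of_hasDerivWithinAt hρ
    (fun z hz => (h z hz).hasDerivWithinAt), mul_zero]

theorem nint_cauchy {c v : ℂ} {ρ : ℝ} {f : ℂ → ℂ} (hv : v ∈ ball c ρ)
    (h : ∀ z ∈ closedBall c ρ, DifferentiableAt ℂ f z) :
    nint c ρ (fun w => f w / (w - v)) = f v := by
  have := Complex.two_pi_I_inv_smul_circleIntegral_sub_inv_smul_of_differentiable_on_off_countable
    countable_empty hv (fun z hz => (h z hz).continuousAt.continuousWithinAt)
    (fun z hz => h z (ball_subset_closedBall hz.1))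
  simp only [smul_eq_mul] at this
  rw [← this]; unfold nint
  congr 2; ext w; exact div_eq_inv_mul _ _

theorem nint_inv_sub {c v : ℂ} {ρ : ℝ} (hv : v ∈ ball c ρ) :
    nint c ρ (fun w => (w - v)⁻¹) = 1 := by
  simpa using nint_cauchy (f := fun _ => 1) hv (fun z _ => by fun_prop)

/-- The integral of `w ^ e H(w)` over a circle around `0` does not depend on the circle. -/
theorem nint_zpow_mul_indep {U : Set ℂ} (hU : IsOpen U) {c c' : ℂ} {ρ ρ' : ℝ}
    (h0 : (0 : ℂ) ∈ ball c ρ) (h0' : (0 : ℂ) ∈ ball c' ρ') (hU1 : closedBall c ρ ⊆ U)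
    (hU2 : closedBall c' ρ' ⊆ U) (e : ℤ) :
    ∀ H : ℂ → ℂ, DifferentiableOn ℂ H U →
      nint c ρ (fun w => w ^ e * H w) = nint c' ρ' (fun w => w ^ e * H w) := by
  -- Induction on a bound M for the order of the pole at 0. Only the two discs need to lie in U, so
  -- no deformation of one circle into the other is used.
  have key : ∀ M : ℕ, ∀ e : ℤ, -(M : ℤ) ≤ e → ∀ H : ℂ → ℂ, DifferentiableOn ℂ H U →
      nint c ρ (fun w => w ^ e * H w) = nint c' ρ' (fun w => w ^ e * H w) := by
    intro M
    have zero_case : ∀ e : ℤ, 0 ≤ e → ∀ H : ℂ → ℂ, DifferentiableOn ℂ H U →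
        nint c ρ (fun w => w ^ e * H w) = nint c' ρ' (fun w => w ^ e * H w) := by
      intro e he H hH
      lift e to ℕ using he
      have hd : ∀ z ∈ U, DifferentiableAt ℂ (fun w => w ^ (e : ℤ) * H w) z := fun z hz => by
        simp only [zpow_natCast]
        exact (differentiableAt_id.pow e).mul ((hH z hz).differentiableAt (hU.mem_nhds hz))
      rw [nint_eq_zero (pos_of_mem_ball h0).le fun z hz => hd z (hU1 hz),
        nint_eq_zero (pos_of_mem_ball h0').le fun z hz => hd z (hU2 hz)]
    induction M with
    | zero => intro e he; exact zero_case e (by simpa using he)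
    | succ M ih =>
      intro e he H hH
      have h0U : (0 : ℂ) ∈ U := hU1 (ball_subset_closedBall h0)
      have ne0 : ∀ {c : ℂ} {ρ : ℝ}, (0 : ℂ) ∈ ball c ρ → ∀ w ∈ sphere c ρ, w ≠ 0 := by
        rintro c ρ h w hw rfl
        simp only [mem_ball, mem_sphere] at h hw
        linarith
      have hG : DifferentiableOn ℂ (dslope H 0) U :=
        (Complex.differentiableOn_dslope (hU.mem_nhds h0U)).2 hH
      -- Split H into H(0) plus w times its difference quotient. The monomial has the same integral
      -- over both circles, and the remainder has a pole of lower order.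
      have split : ∀ {c : ℂ} {ρ : ℝ}, (0 : ℂ) ∈ ball c ρ → closedBall c ρ ⊆ U →
          nint c ρ (fun w => w ^ e * H w) =
            nint c ρ (fun w => w ^ e) * H 0 + nint c ρ (fun w => w ^ (e + 1) * dslope H 0 w) := by
        intro c ρ h hc
        have hρ := (pos_of_mem_ball h).le
        have cz : ∀ e : ℤ, ContinuousOn (fun w : ℂ => w ^ e) (sphere c ρ) := fun e =>
          continuousOn_id.zpow₀ e fun w hw => Or.inl (ne0 h w hw)
        have hadd := nint_add (f := fun w => w ^ e * H 0) (g := fun w => w ^ (e + 1) * dslope H 0 w)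
          hρ ((cz e).mul continuousOn_const)
          ((cz _).mul (hG.continuousOn.mono (sphere_subset_closedBall.trans hc)))
        rw [← nint_mul_const, ← hadd]
        refine nint_congr hρ fun w hw => ?_
        have hw0 := ne0 h w hw
        rw [dslope_of_ne _ hw0, slope_def_field, zpow_add_one₀ hw0]
        field_simp
        ring
      have mono : ∀ {c : ℂ} {ρ : ℝ}, (0 : ℂ) ∈ ball c ρ →
          nint c ρ (fun w => w ^ e) = if e = -1 then 1 else 0 := by
        intro c ρ h
        split_ifs with he1
        · subst he1
          simpa using nint_inv_sub h
        · have := circleIntegral.integral_sub_zpow_of_ne he1 c 0 ρ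
          simp only [sub_zero] at this
          unfold nint; rw [this, mul_zero]
      rw [split h0 hU1, split h0' hU2, mono h0, mono h0', ih (e + 1) (by push_cast at he; linarith) _ hG]
  exact fun H hH => key e.natAbs e (by omega) H hH

/-! ### The basic integrals, their difference equations, and the circles used. -/

section Kernel

variable (p : ℝ)

/-- The integrand `(1 - p u) ^ τ u ^ k w ^ (L - 2)` with `u = (w - 1) / w`. -/
def wtFun (L k τ : ℤ) (w : ℂ) : ℂ :=
  (1 - p * ((w - 1) / w)) ^ τ * ((w - 1) / w) ^ k * w ^ (L - 2)

/-- The contour integral of `wtFun`. -/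
def wtInt (c : ℂ) (ρ : ℝ) (L k τ : ℤ) : ℂ := nint c ρ (wtFun p L k τ)

/-- The points at which all factors of the integrands are invertible. -/
def RegPt (w : ℂ) : Prop := w ≠ 0 ∧ w ≠ 1 ∧ 1 - p * ((w - 1) / w) ≠ 0

variable {p}

theorem RegPt.div_ne {w : ℂ} (h : RegPt p w) : (w - 1) / w ≠ 0 :=
  div_ne_zero (sub_ne_zero.2 h.2.1) h.1

theorem RegPt.differentiableAt {w : ℂ} (h : RegPt p w) (L k τ : ℤ) :
    DifferentiableAt ℂ (wtFun p L k τ) w := by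
  have hu : DifferentiableAt ℂ (fun w : ℂ => (w - 1) / w) w :=
    (differentiableAt_id.sub_const 1).div differentiableAt_id h.1
  exact (((((differentiableAt_const _).mul hu).const_sub 1).zpow (Or.inl h.2.2)).mul
    (hu.zpow (Or.inl h.div_ne))).mul (differentiableAt_id.zpow (Or.inl h.1))

theorem continuousOn_wtFun {s : Set ℂ} (h : ∀ w ∈ s, RegPt p w) (L k τ : ℤ) :
    ContinuousOn (wtFun p L k τ) s :=
  fun w hw => ((h w hw).differentiableAt L k τ).continuousAt.continuousWithinAt

theorem one_sub_mul_div_eq {w : ℂ} (hw : w ≠ 0) :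
    1 - (p : ℂ) * ((w - 1) / w) = ((1 - p) * w + p) / w := by
  field_simp; ring

theorem one_sub_mul_div_ne_zero {w : ℂ} (hw : w ≠ 0) (h : (1 - p) * w + p ≠ 0) :
    1 - (p : ℂ) * ((w - 1) / w) ≠ 0 := by
  rw [one_sub_mul_div_eq hw]; exact div_ne_zero h hw

/-- Clearing denominators separates the possible singularities: 0 through the exponent L - 2 - k -
τ, 1 through k < 0, and -p/(1-p) through τ < 0. -/
theorem wtFun_eq {w : ℂ} (h : RegPt p w) (L k τ : ℤ) :
    wtFun p L k τ w = w ^ (L - 2 - k - τ) * (((1 - p) * w + p) ^ τ * (w - 1) ^ k) := by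
  unfold wtFun
  rw [one_sub_mul_div_eq h.1, div_zpow, div_zpow, zpow_sub₀ h.1 (L - 2 - k) τ,
    zpow_sub₀ h.1 (L - 2) k]
  have := zpow_ne_zero k h.1
  have := zpow_ne_zero τ h.1
  generalize w ^ (L - 2) = A
  field_simp

/-- From 1 - (1 - pu) = pu: a time difference raises the level exponent. All later summations by
parts rest on this. -/
theorem wtInt_diff {c : ℂ} {ρ : ℝ} (hρ : 0 ≤ ρ) (h : ∀ w ∈ sphere c ρ, RegPt p w) (L k τ : ℤ) :
    wtInt p c ρ L k τ - wtInt p c ρ L k (τ + 1) = p * wtInt p c ρ L (k + 1) τ := by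
  unfold wtInt
  rw [← nint_const_mul, ← nint_sub hρ (continuousOn_wtFun h _ _ _) (continuousOn_wtFun h _ _ _)]
  refine nint_congr hρ fun w hw => ?_
  have hw := h w hw
  simp only [wtFun, zpow_add_one₀ hw.2.2, zpow_add_one₀ hw.div_ne]
  ring

/-- From 1 - pu = (1 - p) + p/w: one time step of a free particle, which jumps with probability p
and so has one jump fewer to make. -/
theorem wtInt_time {c : ℂ} {ρ : ℝ} (hρ : 0 ≤ ρ) (h : ∀ w ∈ sphere c ρ, RegPt p w) (L k τ : ℤ) :
    wtInt p c ρ L k (τ + 1) = (1 - p) * wtInt p c ρ L k τ + p * wtInt p c ρ (L - 1) k τ := by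
  unfold wtInt
  rw [← nint_const_mul, ← nint_const_mul, ← nint_add hρ
    ((continuousOn_wtFun h _ _ _).const_mul _) ((continuousOn_wtFun h _ _ _).const_mul _)]
  refine nint_congr hρ fun w hw => ?_
  have hw := h w hw
  simp only [wtFun, zpow_add_one₀ hw.2.2]
  rw [show L - 1 - 2 = L - 2 - 1 by ring, zpow_sub_one₀ hw.1, one_sub_mul_div_eq hw.1]
  have := hw.1
  field_simp

/-- From 1/w = 1 - u. In the exit determinant this relation encodes the exclusion rule. -/
theorem wtInt_space {c : ℂ} {ρ : ℝ} (hρ : 0 ≤ ρ) (h : ∀ w ∈ sphere c ρ, RegPt p w) (L k τ : ℤ) :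
    wtInt p c ρ (L - 1) k τ = wtInt p c ρ L k τ - wtInt p c ρ L (k + 1) τ := by
  unfold wtInt
  rw [← nint_sub hρ (continuousOn_wtFun h _ _ _) (continuousOn_wtFun h _ _ _)]
  refine nint_congr hρ fun w hw => ?_
  have hw := h w hw
  simp only [wtFun, zpow_add_one₀ hw.div_ne]
  rw [show L - 1 - 2 = L - 2 - 1 by ring, zpow_sub_one₀ hw.1]
  have := hw.1
  field_simp
  ring

/-- The root -p/(1-p) lies at distance exactly 1/(1-p) from 1, hence outside the disc. -/
theorem lin_ne_zero_of_mem {R : ℝ} (hp1 : p < 1) (hR : R < 1 / (1 - p)) {w : ℂ}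
    (hw : w ∈ closedBall (1 : ℂ) R) : (1 - p) * w + (p : ℂ) ≠ 0 := by
  intro h
  have hq : (0 : ℝ) < 1 - p := by linarith
  have hqc : ((1 - p : ℝ) : ℂ) ≠ 0 := by exact_mod_cast hq.ne'
  have h1 : w - 1 = -((1 / (1 - p) : ℝ) : ℂ) := by
    push_cast at hqc ⊢
    field_simp
    linear_combination h
  rw [mem_closedBall, dist_eq_norm, h1, norm_neg, Complex.norm_real, Real.norm_of_nonneg
    (by positivity)] at hw
  linarith

/-- The radius p/2 is smaller than p/(1-p), the modulus of the root. -/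
theorem lin_ne_zero_of_mem_small (hp0 : 0 < p) (hp1 : p < 1) {w : ℂ}
    (hw : w ∈ closedBall (0 : ℂ) (p / 2)) : (1 - p) * w + (p : ℂ) ≠ 0 := by
  intro h
  have hq : (0 : ℝ) < 1 - p := by linarith
  have h1 : ((1 - p : ℝ) : ℂ) * w = -(p : ℂ) := by push_cast; linear_combination h
  have h2 : (1 - p) * ‖w‖ = p := by
    have := congrArg norm h1
    rwa [norm_mul, norm_neg, Complex.norm_real, Complex.norm_real, Real.norm_of_nonneg hq.le,
      Real.norm_of_nonneg hp0.le] at this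
  have h3 : ‖w‖ ≤ p / 2 := by simpa using hw
  nlinarith [norm_nonneg w]

theorem regPt_big {R : ℝ} (hp1 : p < 1) (hR1 : 1 < R) (hR : R < 1 / (1 - p)) :
    ∀ w ∈ sphere (1 : ℂ) R, RegPt p w := by
  intro w hw
  have h0 : w ≠ 0 := by rintro rfl; simp at hw; linarith
  refine ⟨h0, ?_, one_sub_mul_div_ne_zero h0 (lin_ne_zero_of_mem hp1 hR (sphere_subset_closedBall hw))⟩
  rintro rfl; simp at hw; linarith

theorem ne_zero_of_mem_closedBall {r : ℝ} (hr1 : r < 1) {w : ℂ} (hw : w ∈ closedBall (1 : ℂ) r) :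
    w ≠ 0 := by
  rintro rfl
  simp at hw; linarith

theorem regPt_unit {r : ℝ} (hp0 : 0 < p) (hp1 : p < 1) (hr0 : 0 < r) (hr1 : r < 1) :
    ∀ w ∈ sphere (1 : ℂ) r, RegPt p w := by
  intro w hw
  have h0 : w ≠ 0 := ne_zero_of_mem_closedBall hr1 (sphere_subset_closedBall hw)
  refine ⟨h0, ?_, one_sub_mul_div_ne_zero h0 (lin_ne_zero_of_mem hp1 ?_ (sphere_subset_closedBall hw))⟩
  · rintro rfl; simp at hw; linarith
  · rw [lt_div_iff₀ (by linarith)]; nlinarith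

theorem regPt_small (hp0 : 0 < p) (hp1 : p < 1) :
    ∀ w ∈ sphere (0 : ℂ) (p / 2), RegPt p w := by
  intro w hw
  have h0 : w ≠ 0 := by rintro rfl; simp at hw; linarith
  refine ⟨h0, ?_, one_sub_mul_div_ne_zero h0 (lin_ne_zero_of_mem_small hp0 hp1 (sphere_subset_closedBall hw))⟩
  rintro rfl; simp at hw; linarith

/-- For `k ≥ 0` the large circle and the small one give the same integral. -/
theorem wtInt_big_eq_small {R : ℝ} (hp0 : 0 < p) (hp1 : p < 1) (hR1 : 1 < R) (hR : R < 1 / (1 - p))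
    (L : ℤ) {k : ℤ} (hk : 0 ≤ k) (τ : ℤ) :
    wtInt p 1 R L k τ = wtInt p 0 (p / 2) L k τ := by
  unfold wtInt
  rw [nint_congr (by linarith) fun w hw => wtFun_eq (regPt_big hp1 hR1 hR w hw) L k τ,
    nint_congr (by linarith) fun w hw => wtFun_eq (regPt_small hp0 hp1 w hw) L k τ]
  have hU : IsOpen {w : ℂ | (1 - p) * w + (p : ℂ) ≠ 0} := by
    have : Continuous fun w : ℂ => (1 - p) * w + (p : ℂ) := by fun_prop
    exact isOpen_ne_fun this continuous_const
  -- Since k ≥ 0 there is no pole at 1, so 0 is the only singularity inside either circle.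
  refine nint_zpow_mul_indep hU (by simpa using hR1) (by simpa using hp0)
    (fun w hw => lin_ne_zero_of_mem hp1 hR hw) (fun w hw => lin_ne_zero_of_mem_small hp0 hp1 hw) _ _
    fun w hw => DifferentiableAt.differentiableWithinAt ?_
  refine DifferentiableAt.mul (DifferentiableAt.zpow (by fun_prop) (Or.inl hw)) ?_
  exact DifferentiableAt.zpow (by fun_prop) (Or.inr hk)

/-- The condition removes the pole at 0, the only possible singularity in the small disc. This is
the source of all vanishing at early times. -/
theorem wtInt_small_eq_zero (hp0 : 0 < p) (hp1 : p < 1) {L k τ : ℤ} (h : 0 ≤ L - 2 - k - τ) :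
    wtInt p 0 (p / 2) L k τ = 0 := by
  unfold wtInt
  rw [nint_congr (by linarith) fun w hw => wtFun_eq (regPt_small hp0 hp1 w hw) L k τ]
  refine nint_eq_zero (by linarith) fun w hw => ?_
  refine DifferentiableAt.mul (DifferentiableAt.zpow (by fun_prop) (Or.inr h))
    (DifferentiableAt.mul (DifferentiableAt.zpow (by fun_prop)
      (Or.inl (lin_ne_zero_of_mem_small hp0 hp1 hw))) (DifferentiableAt.zpow (by fun_prop) (Or.inl ?_)))
  intro h1
  have : w = 1 := by linear_combination h1
  subst this
  simp at hw; linarith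

theorem wtInt_small_zero_neg_one_zero (hp0 : 0 < p) (hp1 : p < 1) :
    wtInt p 0 (p / 2) 0 (-1) 0 = -1 := by
  unfold wtInt
  have h : nint 0 (p / 2) (fun w => (w - 1)⁻¹ / (w - 0)) = (0 - 1)⁻¹ := by
    refine nint_cauchy (f := fun w => (w - 1)⁻¹) (by simpa using hp0) fun w hw => ?_
    refine DifferentiableAt.inv (by fun_prop) fun h1 => ?_
    have : w = 1 := by linear_combination h1
    subst this
    simp at hw; linarith
  rw [nint_congr (by linarith) (g := fun w => (w - 1)⁻¹ / (w - 0)), h]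
  · norm_num
  · intro w hw
    rw [wtFun_eq (regPt_small hp0 hp1 w hw)]
    norm_num
    rw [mul_comm]; rfl

/-- For L = 0 the weight w⁻² is du/dw, so the integrand has the primitive -(1 - pu)^(τ+1) /
(p(τ+1)). -/
theorem wtInt_zero_zero {c : ℂ} {ρ : ℝ} (hp : p ≠ 0) (hρ : 0 ≤ ρ) (h : ∀ w ∈ sphere c ρ, RegPt p w)
    {τ : ℤ} (hτ : τ ≠ -1) : wtInt p c ρ 0 0 τ = 0 := by
  have hτ' : ((τ : ℂ) + 1) ≠ 0 := by
    have : τ + 1 ≠ 0 := by omega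
    exact_mod_cast this
  have hpc : (p : ℂ) ≠ 0 := by exact_mod_cast hp
  unfold wtInt
  refine nint_deriv hρ (f := fun w => -(1 / (p * (τ + 1))) * (1 - p * ((w - 1) / w)) ^ (τ + 1))
    fun w hw => ?_
  have hw := h w hw
  have hu : HasDerivAt (fun w : ℂ => (w - 1) / w) ((1 * w - (w - 1) * 1) / w ^ 2) w :=
    ((hasDerivAt_id w).sub_const 1).div (hasDerivAt_id w) hw.1
  have h2 := ((hasDerivAt_zpow (τ + 1) _ (Or.inl hw.2.2)).comp w
    ((hu.const_mul (p : ℂ)).const_sub 1)).const_mul (-(1 / ((p : ℂ) * (τ + 1))))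
  refine h2.congr_deriv ?_
  simp only [wtFun, add_sub_cancel_right, zpow_zero, mul_one]
  rw [show (0 : ℤ) - 2 = -((2 : ℕ) : ℤ) by norm_num, zpow_neg, zpow_natCast]
  push_cast
  have := hw.1
  field_simp
  ring

theorem wtInt_small_zero_of_nonneg (hp0 : 0 < p) (hp1 : p < 1) (k τ : ℕ) :
    wtInt p 0 (p / 2) 0 k τ = 0 := by
  have hpc : (p : ℂ) ≠ 0 := by exact_mod_cast hp0.ne'
  induction k generalizing τ with
  | zero => exact wtInt_zero_zero hp0.ne' (by linarith) (regPt_small hp0 hp1) (by omega)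
  | succ k ih =>
    have := wtInt_diff (by linarith) (regPt_small hp0 hp1) 0 k τ
    have h2 := ih (τ + 1)
    push_cast at h2 ⊢
    rw [ih, h2] at this
    simpa [hpc] using this.symm

theorem wtInt_small_zero_neg_one (hp0 : 0 < p) (hp1 : p < 1) (τ : ℕ) :
    wtInt p 0 (p / 2) 0 (-1) τ = -1 := by
  induction τ with
  | zero => exact wtInt_small_zero_neg_one_zero hp0 hp1
  | succ τ ih =>
    have := wtInt_diff (by linarith) (regPt_small hp0 hp1) 0 (-1) τ
    have h2 := wtInt_small_zero_of_nonneg hp0 hp1 0 τ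
    push_cast at h2 ⊢
    rw [ih, neg_add_cancel, h2] at this
    linear_combination -this

/-- The contour integrals over the large circle decay geometrically in time. -/
theorem exists_norm_wtInt_big_le {R : ℝ} (hp0 : 0 < p) (hp1 : p < 1) (hR1 : 1 < R)
    (L k : ℤ) :
    ∃ C : ℝ, ∀ τ : ℕ, ‖wtInt p 1 R L k τ‖ ≤ C * (1 - p / 2) ^ τ := by
  -- For τ ≥ 0 the point -p/(1-p) is no longer a singularity, so the contour can be moved outwards.
  -- On the new circle |w| ≥ 2, hence |1 - pu| ≤ (1 - p) + p/|w| ≤ 1 - p/2.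
  set R' : ℝ := R + 2
  have hqc : ‖(1 - p : ℂ)‖ = 1 - p := by
    rw [show (1 - p : ℂ) = ((1 - p : ℝ) : ℂ) by push_cast; ring, Complex.norm_real,
      Real.norm_of_nonneg (by linarith)]
  have hne : ∀ w : ℂ, w ∉ ball (1 : ℂ) R → w ≠ 0 ∧ w ≠ 1 := by
    intro w hw
    constructor <;> rintro rfl <;> exact hw (by simp; linarith)
  have hcont : ContinuousOn (wtFun p L k 0) (sphere 1 R') := by
    intro w hw
    have h := hne w (by simp at hw ⊢; rw [dist_eq_norm, hw]; simp [R'])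
    refine ContinuousAt.continuousWithinAt ?_
    unfold wtFun
    simp only [zpow_zero, one_mul]
    have hu : ContinuousAt (fun w : ℂ => (w - 1) / w) w :=
      ContinuousAt.div (by fun_prop) continuousAt_id h.1
    exact (hu.zpow₀ k (Or.inl (div_ne_zero (sub_ne_zero.2 h.2) h.1))).mul
      (continuousAt_id.zpow₀ _ (Or.inl h.1))
  obtain ⟨C, hC⟩ := (isCompact_sphere (1 : ℂ) R').exists_bound_of_continuousOn hcont
  refine ⟨R' * C, fun τ => ?_⟩
  have hmove : wtInt p 1 R L k τ = wtInt p 1 R' L k τ := by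
    have hd : ∀ z ∈ (ball (1 : ℂ) R)ᶜ, DifferentiableAt ℂ (wtFun p L k τ) z := by
      intro z hz
      have h := hne z hz
      unfold wtFun
      have hu : DifferentiableAt ℂ (fun w : ℂ => (w - 1) / w) z :=
        (differentiableAt_id.sub_const 1).div differentiableAt_id h.1
      exact (((((differentiableAt_const _).mul hu).const_sub 1).zpow (Or.inr (by positivity))).mul
        (hu.zpow (Or.inl (div_ne_zero (sub_ne_zero.2 h.2) h.1)))).mul
          (differentiableAt_id.zpow (Or.inl h.1))
    unfold wtInt nint
    rw [Complex.circleIntegral_eq_of_differentiable_on_annulus_off_countable (by linarith)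
      (show R ≤ R' by simp [R']) countable_empty
      (fun z hz => (hd z hz.2).continuousAt.continuousWithinAt)
      (fun z hz => hd z fun h => hz.1.2 (ball_subset_closedBall h))]
  rw [hmove]
  unfold wtInt nint
  have hb : ∀ w ∈ sphere (1 : ℂ) R', ‖wtFun p L k τ w‖ ≤ C * (1 - p / 2) ^ τ := by
    intro w hw
    have hw1 : ‖w - 1‖ = R' := by simpa [dist_eq_norm] using hw
    have h := hne w (by rw [mem_ball, dist_eq_norm, hw1]; simp [R'])
    have hw2 : 2 ≤ ‖w‖ := by
      have := norm_sub_norm_le (w - 1) (-1)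
      simp only [norm_neg, norm_one, sub_neg_eq_add, sub_add_cancel] at this
      simp only [R'] at hw1
      linarith
    have h1 : ‖1 - (p : ℂ) * ((w - 1) / w)‖ ≤ 1 - p / 2 := by
      rw [one_sub_mul_div_eq h.1, norm_div, div_le_iff₀ (by linarith)]
      refine (norm_add_le _ _).trans ?_
      rw [norm_mul, hqc, Complex.norm_real, Real.norm_of_nonneg hp0.le]
      nlinarith
    have h2 : wtFun p L k τ w = (1 - p * ((w - 1) / w)) ^ τ * wtFun p L k 0 w := by
      simp [wtFun, mul_assoc]
    rw [h2, norm_mul, norm_pow, mul_comm]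
    exact mul_le_mul (hC w hw) (pow_le_pow_left₀ (norm_nonneg _) h1 _) (by positivity)
      ((norm_nonneg _).trans (hC w hw))
  have := circleIntegral.norm_two_pi_i_inv_smul_integral_le_of_norm_le_const
    (by simp [R']; linarith) hb
  rw [smul_eq_mul] at this
  rw [mul_assoc R']; exact this

end Kernel

end ContourIntegrals

/-! ### Expansion of the kernel and the biorthogonality relations. -/

section KernelDecomposition

open Metric Set

section DoubleIntegral

theorem inv_sub_div_eq {w v : ℂ} (hw : w ≠ 0) (hv : v ≠ 0) :
    ((w - 1) / w - (v - 1) / v)⁻¹ = w * v / (w - v) := by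
  have : (w - 1) / w - (v - 1) / v = (w - v) / (w * v) := by field_simp; ring
  rw [this, inv_div]

theorem ne_zero_of_mem_sphere_big {R : ℝ} (hR1 : 1 < R) {w : ℂ} (hw : w ∈ sphere (1 : ℂ) R) :
    w ≠ 0 := by
  rintro rfl; simp at hw; linarith

/-- The inner integral `∮ β(w) / (u_w - u_v) dw` is holomorphic in `v` near the inner circle. -/
theorem differentiableAt_inner {r R : ℝ} (hr1 : r < 1) (hR1 : 1 < R) {β : ℂ → ℂ}
    (hβ : ContinuousOn β (sphere 1 R)) {v : ℂ} (hv : v ∈ closedBall (1 : ℂ) r) :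
    DifferentiableAt ℂ
      (fun v => nint 1 R fun w => β w * ((w - 1) / w - (v - 1) / v)⁻¹) v := by
  have hv1 : v ∈ ball (1 : ℂ) 1 := by
    simp only [mem_ball, mem_closedBall] at hv ⊢; linarith
  have hR0 : 0 ≤ R := by linarith
  have hcont : ContinuousOn (fun w => β w * w) (sphere 1 R) := hβ.mul continuousOn_id
  have hcoe : ((Real.toNNReal R : NNReal) : ℝ) = R := Real.coe_toNNReal R hR0
  have hps := hasFPowerSeriesOn_cauchy_integral (f := fun w => β w * w) (c := 1)
    (R := Real.toNNReal R) (by rw [hcoe]; exact hcont.circleIntegrable hR0)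
    (Real.toNNReal_pos.2 (by linarith))
  rw [hcoe] at hps
  have hd : DifferentiableAt ℂ
      (fun v => (2 * π * Complex.I)⁻¹ • ∮ z in C(1, R), (z - v)⁻¹ • (β z * z)) v := by
    refine (hps.analyticAt_of_mem ?_).differentiableAt
    rw [Metric.mem_eball, edist_dist]
    have : dist v 1 < R := by simp at hv1; linarith
    exact (ENNReal.ofReal_lt_ofReal_iff (by linarith)).2 this
  refine (differentiableAt_id.mul hd).congr_of_eventuallyEq ?_
  filter_upwards [isOpen_ball.mem_nhds hv1] with v' hv'
  have hv0 : v' ≠ 0 := by rintro rfl; simp at hv'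
  simp only [Pi.mul_apply, id, smul_eq_mul]
  change _ = v' * nint 1 R fun z => (z - v')⁻¹ * (β z * z)
  rw [← nint_const_mul]
  refine nint_congr hR0 fun w hw => ?_
  have := ne_zero_of_mem_sphere_big hR1 hw
  simp only [inv_sub_div_eq this hv0]
  ring

/-- Iterate 1/(a - b) = 1/a + b/(a(a - b)) with a = u_w and b = u_v. Every step cancels one order of
the pole at v = 1; after K steps the v-integrand is holomorphic in the disc and the remainder
vanishes. The sum is therefore exact and finite, with no comparison of |u_v| and |u_w|. -/
theorem nint_double {r R : ℝ} (hr0 : 0 < r) (hr1 : r < 1) (hR1 : 1 < R) {α : ℂ → ℂ}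
    (hα : ∀ z ∈ closedBall (1 : ℂ) r, DifferentiableAt ℂ α z) (K : ℕ) :
    ∀ β : ℂ → ℂ, ContinuousOn β (sphere 1 R) →
    nint 1 r (fun v => α v * ((v - 1) / v) ^ (-(K : ℤ)) *
        nint 1 R (fun w => β w * ((w - 1) / w - (v - 1) / v)⁻¹)) =
      ∑ j ∈ Finset.range K, nint 1 r (fun v => α v * ((v - 1) / v) ^ ((j : ℤ) - K)) *
        nint 1 R (fun w => β w * ((w - 1) / w) ^ (-(j : ℤ) - 1)) := by
  have hR0 : 0 ≤ R := by linarith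
  induction K with
  | zero =>
    intro β hβ
    simp only [Nat.cast_zero, neg_zero, zpow_zero, mul_one, Finset.range_zero, Finset.sum_empty]
    exact nint_eq_zero hr0.le fun v hv => (hα v hv).mul (differentiableAt_inner hr1 hR1 hβ hv)
  | succ K ih =>
    intro β hβ
    have hu : ∀ w ∈ sphere (1 : ℂ) R, (w - 1) / w ≠ 0 := fun w hw =>
      div_ne_zero (by intro h; rw [sub_eq_zero] at h; subst h; simp at hw; linarith)
        (ne_zero_of_mem_sphere_big hR1 hw)
    have hv0 : ∀ v ∈ sphere (1 : ℂ) r, v ≠ 0 := fun v hv =>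
      ne_zero_of_mem_closedBall hr1 (sphere_subset_closedBall hv)
    have hvu : ∀ v ∈ sphere (1 : ℂ) r, (v - 1) / v ≠ 0 := fun v hv =>
      div_ne_zero (by intro h; rw [sub_eq_zero] at h; subst h; simp at hv; linarith) (hv0 v hv)
    have hucont : ContinuousOn (fun w : ℂ => (w - 1) / w) (sphere 1 R) :=
      (continuousOn_id.sub continuousOn_const).div continuousOn_id
        fun w hw => ne_zero_of_mem_sphere_big hR1 hw
    have hvcont : ContinuousOn (fun w : ℂ => (w - 1) / w) (sphere 1 r) :=
      (continuousOn_id.sub continuousOn_const).div continuousOn_id hv0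
    have hαc : ContinuousOn α (sphere 1 r) := fun v hv =>
      (hα v (sphere_subset_closedBall hv)).continuousAt.continuousWithinAt
    have hβ' : ContinuousOn (fun w => β w * ((w - 1) / w)⁻¹) (sphere 1 R) :=
      hβ.mul (hucont.inv₀ hu)
    have hne : ∀ v ∈ sphere (1 : ℂ) r, ∀ w ∈ sphere (1 : ℂ) R,
        (w - 1) / w - (v - 1) / v ≠ 0 := by
      intro v hv w hw
      refine inv_eq_zero.not.1 ?_
      rw [inv_sub_div_eq (ne_zero_of_mem_sphere_big hR1 hw) (hv0 v hv)]
      refine div_ne_zero (mul_ne_zero (ne_zero_of_mem_sphere_big hR1 hw) (hv0 v hv)) ?_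
      intro h
      rw [sub_eq_zero] at h; subst h
      simp only [mem_sphere] at hv hw; linarith
    -- One step of the expansion. The induction hypothesis is then applied with β divided by u_w,
    -- which is why β is quantified inside the statement.
    have inner : ∀ v ∈ sphere (1 : ℂ) r,
        nint 1 R (fun w => β w * ((w - 1) / w - (v - 1) / v)⁻¹) =
        nint 1 R (fun w => β w * ((w - 1) / w)⁻¹) + (v - 1) / v *
          nint 1 R (fun w => β w * ((w - 1) / w)⁻¹ * ((w - 1) / w - (v - 1) / v)⁻¹) := by
      intro v hv
      have h2 : ContinuousOn (fun w => (v - 1) / v *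
          (β w * ((w - 1) / w)⁻¹ * ((w - 1) / w - (v - 1) / v)⁻¹)) (sphere 1 R) :=
        continuousOn_const.mul (hβ'.mul ((hucont.sub continuousOn_const).inv₀ (hne v hv)))
      rw [← nint_const_mul, ← nint_add hR0 hβ' h2]
      refine nint_congr hR0 fun w hw => ?_
      have h3 := hu w hw
      have h4 := hne v hv w hw
      generalize (w - 1) / w = a at *
      generalize (v - 1) / v = b at *
      field_simp
      ring
    rw [Finset.sum_range_succ', nint_congr hr0.le (g := fun v =>
      α v * ((v - 1) / v) ^ (-((K + 1 : ℕ) : ℤ)) * nint 1 R (fun w => β w * ((w - 1) / w)⁻¹) +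
      α v * ((v - 1) / v) ^ (-(K : ℤ)) *
        nint 1 R (fun w => β w * ((w - 1) / w)⁻¹ * ((w - 1) / w - (v - 1) / v)⁻¹)),
      nint_add hr0.le, ih _ hβ', nint_mul_const, add_comm]
    · congr 1
      · refine Finset.sum_congr rfl fun j _ => ?_
        congr 1
        · refine nint_congr hr0.le fun v hv => ?_
          congr 2; push_cast; ring
        · refine nint_congr hR0 fun w hw => ?_
          rw [show (-((j + 1 : ℕ) : ℤ) - 1) = -(j : ℤ) - 1 + -1 by push_cast; ring,
            zpow_add₀ (hu w hw), zpow_neg_one]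
          ring
      · simp
    · exact (hαc.mul (hvcont.zpow₀ _ fun v hv => Or.inl (hvu v hv))).mul continuousOn_const
    · refine (hαc.mul (hvcont.zpow₀ _ fun v hv => Or.inl (hvu v hv))).mul fun v hv => ?_
      exact (differentiableAt_inner hr1 hR1 hβ' (sphere_subset_closedBall hv)).continuousAt.continuousWithinAt
    · intro v hv
      simp only
      rw [inner v hv, mul_add]
      congr 1
      rw [show (-(K : ℤ)) = -((K + 1 : ℕ) : ℤ) + 1 by push_cast; ring, zpow_add₀ (hvu v hv), zpow_one]
      ring

end DoubleIntegral

section KernelParts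

variable {p : ℝ}

/-- Exactness again: the integrand is u^k du, with a primitive unless k = -1. -/
theorem wtInt_zero_of_ne {c : ℂ} {ρ : ℝ} (hρ : 0 ≤ ρ) (h : ∀ w ∈ sphere c ρ, RegPt p w)
    {k : ℤ} (hk : k ≠ -1) : wtInt p c ρ 0 k 0 = 0 := by
  have hk' : ((k : ℂ) + 1) ≠ 0 := by
    have : k + 1 ≠ 0 := by omega
    exact_mod_cast this
  unfold wtInt
  refine nint_deriv hρ (f := fun w => (1 / (k + 1)) * ((w - 1) / w) ^ (k + 1)) fun w hw => ?_
  have hw := h w hw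
  have hu : HasDerivAt (fun w : ℂ => (w - 1) / w) ((1 * w - (w - 1) * 1) / w ^ 2) w :=
    ((hasDerivAt_id w).sub_const 1).div (hasDerivAt_id w) hw.1
  have h2 := (HasDerivAt.comp (h := fun w : ℂ => (w - 1) / w) (h₂ := fun z : ℂ => z ^ (k + 1)) w
    (hasDerivAt_zpow (k + 1) ((w - 1) / w) (Or.inl hw.div_ne)) hu).const_mul (1 / ((k : ℂ) + 1))
  refine h2.congr_deriv ?_
  simp only [wtFun, add_sub_cancel_right, zpow_zero, one_mul]
  rw [show (0 : ℤ) - 2 = -((2 : ℕ) : ℤ) by norm_num, zpow_neg, zpow_natCast]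
  push_cast
  have := hw.1
  field_simp
  ring

variable (p)

/-- The polynomial functions of the biorthogonal expansion. -/
def phiFun (r : ℝ) (L k τ : ℤ) : ℂ := p * wtInt p 1 r (-L) (-k - 1) (-τ - 1)

/-- The transition function between levels at distance `d`. -/
def stepKer (R : ℝ) (d s t : ℤ) : ℂ := p * wtInt p 1 R 0 (-d) (s - t - 1)

variable {p}

theorem phiFun_diff {r : ℝ} (hp0 : 0 < p) (hp1 : p < 1) (hr0 : 0 < r) (hr1 : r < 1) (L k τ : ℤ) :
    phiFun p r L k (τ + 1) - phiFun p r L k τ = p * phiFun p r L (k - 1) (τ + 1) := by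
  have := wtInt_diff hr0.le (regPt_unit hp0 hp1 hr0 hr1) (-L) (-k - 1) (-(τ + 1) - 1)
  unfold phiFun
  rw [← mul_sub]
  rw [show -(τ + 1) - 1 + 1 = -τ - 1 by ring] at this
  rw [this, show -(k - 1) - 1 = -k - 1 + 1 by ring]

theorem unit_lt_inv {r : ℝ} (hp0 : 0 < p) (hp1 : p < 1) (hr1 : r < 1) : r < 1 / (1 - p) := by
  rw [lt_div_iff₀ (by linarith)]; nlinarith

/-- The circle encloses only the singularity 1, which is absent for k ≥ 0. -/
theorem wtInt_unit_eq_zero {r : ℝ} (hp0 : 0 < p) (hp1 : p < 1) (hr0 : 0 < r) (hr1 : r < 1)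
    {k : ℤ} (hk : 0 ≤ k) (L τ : ℤ) : wtInt p 1 r L k τ = 0 := by
  refine nint_eq_zero hr0.le fun w hw => ?_
  have h0 := ne_zero_of_mem_closedBall hr1 hw
  have hu : DifferentiableAt ℂ (fun w : ℂ => (w - 1) / w) w :=
    (differentiableAt_id.sub_const 1).div differentiableAt_id h0
  exact (((((differentiableAt_const _).mul hu).const_sub 1).zpow (Or.inl
    (one_sub_mul_div_ne_zero h0 (lin_ne_zero_of_mem hp1 (unit_lt_inv hp0 hp1 hr1) hw)))).mul
      (hu.zpow (Or.inr hk))).mul (differentiableAt_id.zpow (Or.inl h0))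

theorem wtInt_unit_neg_one {r : ℝ} (hp0 : 0 < p) (hp1 : p < 1) (hr0 : 0 < r) (hr1 : r < 1)
    (L τ : ℤ) : wtInt p 1 r L (-1) τ = 1 := by
  have h := nint_cauchy (v := 1) (c := 1) (ρ := r)
    (f := fun w : ℂ => (1 - p * ((w - 1) / w)) ^ τ * w ^ (L - 1)) (by simpa using hr0) ?_
  · rw [show wtInt p 1 r L (-1) τ = _ from nint_congr hr0.le fun w hw => ?_, h]
    · simp
    · have hw := regPt_unit hp0 hp1 hr0 hr1 w hw
      have h1 : w - 1 ≠ 0 := sub_ne_zero.2 hw.2.1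
      have h2 := hw.1
      simp only [wtFun, zpow_neg_one, inv_div]
      rw [show L - 1 = L - 2 + 1 by ring, zpow_add_one₀ hw.1]
      ring
  · intro w hw
    have h0 := ne_zero_of_mem_closedBall hr1 hw
    have hu : DifferentiableAt ℂ (fun w : ℂ => (w - 1) / w) w :=
      (differentiableAt_id.sub_const 1).div differentiableAt_id h0
    exact ((((differentiableAt_const _).mul hu).const_sub 1).zpow (Or.inl
      (one_sub_mul_div_ne_zero h0 (lin_ne_zero_of_mem hp1 (unit_lt_inv hp0 hp1 hr1) hw)))).mul
        (differentiableAt_id.zpow (Or.inl h0))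

theorem phiFun_neg {r : ℝ} (hp0 : 0 < p) (hp1 : p < 1) (hr0 : 0 < r) (hr1 : r < 1)
    {k : ℤ} (hk : k < 0) (L τ : ℤ) : phiFun p r L k τ = 0 := by
  rw [phiFun, wtInt_unit_eq_zero hp0 hp1 hr0 hr1 (by omega), mul_zero]

theorem phiFun_zero {r : ℝ} (hp0 : 0 < p) (hp1 : p < 1) (hr0 : 0 < r) (hr1 : r < 1)
    (L τ : ℤ) : phiFun p r L 0 τ = p := by
  rw [phiFun, show -(0 : ℤ) - 1 = -1 by norm_num, wtInt_unit_neg_one hp0 hp1 hr0 hr1, mul_one]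

theorem stepKer_diff {R : ℝ} (hp1 : p < 1) (hR1 : 1 < R) (hR : R < 1 / (1 - p)) (d s t : ℤ) :
    stepKer p R d s (t + 1) - stepKer p R d s t = p * stepKer p R (d - 1) s (t + 1) := by
  have := wtInt_diff (by linarith) (regPt_big hp1 hR1 hR) 0 (-d) (s - (t + 1) - 1)
  unfold stepKer
  rw [show s - (t + 1) - 1 + 1 = s - t - 1 by ring] at this
  rw [← mul_sub, this, show -(d - 1) = -d + 1 by ring]

theorem stepKer_zero_self {R : ℝ} (hp0 : 0 < p) (hp1 : p < 1) (hR1 : 1 < R) (hR : R < 1 / (1 - p))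
    (s : ℤ) : stepKer p R 0 s s = 1 := by
  have hpc : (p : ℂ) ≠ 0 := by exact_mod_cast hp0.ne'
  rw [stepKer, neg_zero, sub_self, zero_sub, wtInt_big_eq_small hp0 hp1 hR1 hR _ le_rfl]
  have h := nint_cauchy (v := 0) (c := 0) (ρ := p / 2)
    (f := fun w : ℂ => ((1 - p) * w + p)⁻¹) (by simpa using hp0) fun w hw =>
      DifferentiableAt.inv (by fun_prop) (lin_ne_zero_of_mem_small hp0 hp1 hw)
  rw [show wtInt p 0 (p / 2) 0 0 (-1) = _ from nint_congr (by linarith) fun w hw => ?_, h]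
  · simp [hpc]
  · rw [wtFun_eq (regPt_small hp0 hp1 w hw)]
    norm_num
    rw [mul_comm]; rfl

theorem stepKer_zero_of_ne {R : ℝ} (hp0 : 0 < p) (hp1 : p < 1) (hR1 : 1 < R)
    (hR : R < 1 / (1 - p)) {s t : ℤ} (h : s ≠ t) : stepKer p R 0 s t = 0 := by
  rw [stepKer, neg_zero, wtInt_zero_zero hp0.ne' (by linarith) (regPt_big hp1 hR1 hR) (by omega),
    mul_zero]

/-- The residues at 1 and at 0 cancel: the integrand is 1/(w - 1) - 1/w. -/
theorem wtInt_big_zero_neg_one {R : ℝ} (hp1 : p < 1) (hR1 : 1 < R) (hR : R < 1 / (1 - p)) :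
    wtInt p 1 R 0 (-1) 0 = 0 := by
  have hreg := regPt_big hp1 hR1 hR
  have h1 : nint 1 R (fun w : ℂ => (w - 1)⁻¹) = 1 := nint_inv_sub (by simp; linarith)
  have h0 : nint 1 R (fun w : ℂ => (w - 0)⁻¹) = 1 := nint_inv_sub (by simp; linarith)
  have : wtInt p 1 R 0 (-1) 0 = nint 1 R (fun w : ℂ => (w - 1)⁻¹ - (w - 0)⁻¹) := by
    refine nint_congr (by linarith) fun w hw => ?_
    have h := hreg w hw
    have h2 := h.1
    have h3 := sub_ne_zero.2 h.2.1
    simp only [wtFun, zpow_zero, zpow_neg_one, inv_div, sub_zero, one_mul]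
    rw [show (0 : ℤ) - 2 = -((2 : ℕ) : ℤ) by norm_num, zpow_neg, zpow_natCast]
    field_simp
    ring
  rw [this, nint_sub (by linarith), h1, h0, sub_self]
  · exact (continuousOn_id.sub continuousOn_const).inv₀ fun w hw => sub_ne_zero.2 (hreg w hw).2.1
  · exact (continuousOn_id.sub continuousOn_const).inv₀ fun w hw => by
      simpa using (hreg w hw).1

/-- Double induction, on the level distance and on s - t. At t = s - 1 the time exponent is 0 and
the integral vanishes outright; each further step back changes the value by p times the function at
distance d - 1, already known to vanish there. -/
theorem stepKer_of_lt {R : ℝ} (hp0 : 0 < p) (hp1 : p < 1) (hR1 : 1 < R) (hR : R < 1 / (1 - p))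
    (d : ℕ) {s t : ℤ} (h : t < s) : stepKer p R d s t = 0 := by
  have key : ∀ d e : ℕ, stepKer p R d s (s - 1 - e) = 0 := by
    intro d
    induction d with
    | zero => exact fun e => stepKer_zero_of_ne hp0 hp1 hR1 hR (by omega)
    | succ d ihd =>
      intro e
      induction e with
      | zero =>
        rw [stepKer, show s - (s - 1 - ((0 : ℕ) : ℤ)) - 1 = 0 by push_cast; ring]
        -- At level distance 1 the exponent of u is -1, the one case without a primitive.
        rcases Nat.eq_zero_or_pos d with rfl | hd
        · simpa using Or.inr (wtInt_big_zero_neg_one hp1 hR1 hR)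
        · rw [wtInt_zero_of_ne (by linarith) (regPt_big hp1 hR1 hR) (by push_cast; omega), mul_zero]
      | succ e ihe =>
        have := stepKer_diff hp1 hR1 hR ((d + 1 : ℕ) : ℤ) s (s - 1 - ((e + 1 : ℕ) : ℤ))
        rw [show s - 1 - ((e + 1 : ℕ) : ℤ) + 1 = s - 1 - e by push_cast; ring, ihe,
          show ((d + 1 : ℕ) : ℤ) - 1 = d by push_cast; ring, ihd, mul_zero, zero_sub, neg_eq_zero] at this
        exact this
  have := key d (s - 1 - t).toNat
  rwa [show s - 1 - ((s - 1 - t).toNat : ℤ) = t by omega] at this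

/-- The kernel as a finite sum of products minus the transition function. -/
theorem corrKernel_eq {r R : ℝ} (hp0 : 0 < p) (hp1 : p < 1) (hr0 : 0 < r) (hr1 : r < 1)
    (hR1 : 1 < R) (hR : R < 1 / (1 - p)) (N : ℕ) (x : ℤ) (n₁ n₂ : ℕ) (τ₁ τ₂ : ℤ) :
    corrKernel p N x r R (n₁ + 1) τ₁ (n₂ + 1) τ₂ =
      (∑ j ∈ Finset.range (n₂ + 1), wtInt p 1 R (x + N) (n₁ - j) τ₁ *
        phiFun p r (x + N) (n₂ - j) τ₂) -
      if n₁ < n₂ then stepKer p R (n₂ - n₁) τ₁ τ₂ else 0 := by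
  have hregR := regPt_big hp1 hR1 hR
  have hregr := regPt_unit hp0 hp1 hr0 hr1
  unfold corrKernel
  congr 1
  · have hα : ∀ z ∈ closedBall (1 : ℂ) r, DifferentiableAt ℂ
        (fun v : ℂ => (1 - p * ((v - 1) / v)) ^ (-τ₂ - 1) * v ^ (-(x + N) - 2)) z := by
      intro w hw
      have h0 := ne_zero_of_mem_closedBall hr1 hw
      have hu : DifferentiableAt ℂ (fun w : ℂ => (w - 1) / w) w :=
        (differentiableAt_id.sub_const 1).div differentiableAt_id h0
      exact ((((differentiableAt_const _).mul hu).const_sub 1).zpow (Or.inl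
        (one_sub_mul_div_ne_zero h0 (lin_ne_zero_of_mem hp1 (unit_lt_inv hp0 hp1 hr1) hw)))).mul
          (differentiableAt_id.zpow (Or.inl h0))
    have hβ := continuousOn_wtFun hregR (x + N) (n₁ + 1) τ₁
    have key := nint_double hr0 hr1 hR1 hα (n₂ + 1) _ hβ
    have hL : nint 1 r (fun v => v⁻¹ * nint 1 R (fun w => w⁻¹ *
        (((1 - p * ((w - 1) / w)) ^ τ₁ * ((w - 1) / w) ^ (n₁ + 1) * (w / v) ^ (x + N)) /
          ((1 - p * ((v - 1) / v)) ^ (τ₂ + 1) * ((v - 1) / v) ^ (n₂ + 1) * (w - v))))) =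
        nint 1 r (fun v => (1 - p * ((v - 1) / v)) ^ (-τ₂ - 1) * v ^ (-(x + N) - 2) *
          ((v - 1) / v) ^ (-((n₂ + 1 : ℕ) : ℤ)) *
          nint 1 R (fun w => wtFun p (x + N) (n₁ + 1) τ₁ w * ((w - 1) / w - (v - 1) / v)⁻¹)) := by
      refine nint_congr hr0.le fun v hv => ?_
      have hv := hregr v hv
      rw [← nint_const_mul, ← nint_const_mul]
      refine nint_congr (by linarith) fun w hw => ?_
      have hw := hregR w hw
      rw [inv_sub_div_eq hw.1 hv.1, wtFun, div_zpow, show -τ₂ - 1 = -(τ₂ + 1) by ring, zpow_neg,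
        zpow_neg, zpow_natCast, zpow_sub₀ hv.1, zpow_sub₀ hw.1, zpow_neg,
        show ((n₁ : ℤ) + 1) = ((n₁ + 1 : ℕ) : ℤ) by push_cast; ring, zpow_natCast]
      have h1 := hw.1
      have h2 := hv.1
      have h3 := zpow_ne_zero (x + N) hv.1
      have h4 := zpow_ne_zero (τ₂ + 1) hv.2.2
      have h5 := pow_ne_zero (n₂ + 1) hv.div_ne
      generalize (1 - (p : ℂ) * ((v - 1) / v)) ^ (τ₂ + 1) = A at *
      generalize ((v - 1) / v) ^ (n₂ + 1) = B at *
      generalize v ^ (x + (N : ℤ)) = D at *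
      generalize w ^ (x + (N : ℤ)) = D' at *
      generalize (1 - (p : ℂ) * ((w - 1) / w)) ^ τ₁ = A' at *
      generalize ((w - 1) / w) ^ (n₁ + 1) = B' at *
      rw [show ((2 : ℤ)) = ((2 : ℕ) : ℤ) by norm_num, zpow_natCast, zpow_natCast]
      generalize w - v = F
      -- Division by zero makes both sides vanish when w = v, so disjointness of the contours is not
      -- needed for this identity.
      rcases eq_or_ne F 0 with rfl | hF
      · simp
      field_simp
    change (p : ℂ) * nint 1 r (fun v => v⁻¹ * nint 1 R (fun w => w⁻¹ *
        (((1 - p * ((w - 1) / w)) ^ τ₁ * ((w - 1) / w) ^ (n₁ + 1) * (w / v) ^ (x + N)) /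
          ((1 - p * ((v - 1) / v)) ^ (τ₂ + 1) * ((v - 1) / v) ^ (n₂ + 1) * (w - v))))) = _
    rw [hL, key, Finset.mul_sum]
    refine Finset.sum_congr rfl fun j _ => ?_
    unfold phiFun wtInt
    rw [← mul_assoc, mul_comm (nint 1 R _) _]
    congr 1
    · congr 1
      refine nint_congr hr0.le fun v hv => ?_
      simp only [wtFun]
      rw [show (j : ℤ) - ((n₂ + 1 : ℕ) : ℤ) = -((n₂ : ℤ) - j) - 1 by push_cast; ring]
      ring
    · refine nint_congr (by linarith) fun w hw => ?_
      simp only [wtFun]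
      rw [show (n₁ : ℤ) - j = (n₁ + 1) + (-(j : ℤ) - 1) by ring,
        zpow_add₀ (hregR w hw).div_ne (n₁ + 1)]
      generalize ((w - 1) / w) ^ ((n₁ : ℤ) + 1) = A
      ring
  · simp only [add_lt_add_iff_right]
    split_ifs
    · unfold stepKer wtInt
      rw [← nint_const_mul]
      refine nint_congr (by linarith) fun z hz => ?_
      simp only [wtFun]
      rw [show (0 : ℤ) - 2 = -((2 : ℕ) : ℤ) by norm_num, zpow_neg z, zpow_natCast,
        show ((n₁ + 1 : ℕ) : ℤ) - ((n₂ + 1 : ℕ) : ℤ) = -(n₂ - n₁) by push_cast; ring, div_eq_mul_inv]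
      ring
    · rfl

/-- The boundary term of the summation by parts for the biorthogonality relation. -/
def gramBdry (p r R : ℝ) (L : ℤ) (k : ℕ) (l τ : ℤ) : ℂ :=
  ∑ j ∈ Finset.range (k + 1), wtInt p 1 r (-L) (j - k - 1) (-τ) * wtInt p 1 R L (l - j - 1) τ

/-- The discrete product rule in time makes the sum over j telescope. The end j = 0 gives φψ; at the
other end the inner integral has exponent 0 and vanishes. -/
theorem gramBdry_sub {r R : ℝ} (hp0 : 0 < p) (hp1 : p < 1) (hr0 : 0 < r) (hr1 : r < 1)
    (hR1 : 1 < R) (hR : R < 1 / (1 - p)) (L : ℤ) (k : ℕ) (l τ : ℤ) :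
    gramBdry p r R L k l τ - gramBdry p r R L k l (τ + 1) =
      phiFun p r L k τ * wtInt p 1 R L l τ := by
  unfold gramBdry phiFun
  rw [← Finset.sum_sub_distrib]
  have hpc : (p : ℂ) ≠ 0 := by exact_mod_cast hp0.ne'
  have hterm : ∀ j ∈ Finset.range (k + 1),
      wtInt p 1 r (-L) (j - k - 1) (-τ) * wtInt p 1 R L (l - j - 1) τ -
      wtInt p 1 r (-L) (j - k - 1) (-(τ + 1)) * wtInt p 1 R L (l - j - 1) (τ + 1) =
      (fun j : ℕ => p * wtInt p 1 r (-L) (j - k - 1) (-τ - 1) * wtInt p 1 R L (l - j) τ) j -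
      (fun j : ℕ => p * wtInt p 1 r (-L) (j - k - 1) (-τ - 1) * wtInt p 1 R L (l - j) τ) (j + 1) := by
    intro j _
    have h1 := wtInt_diff hr0.le (regPt_unit hp0 hp1 hr0 hr1) (-L) (j - k - 1) (-τ - 1)
    have h2 := wtInt_diff (by linarith) (regPt_big hp1 hR1 hR) L (l - j - 1) τ
    simp only
    rw [show -τ - 1 + 1 = -τ by ring] at h1
    rw [show l - (j : ℤ) - 1 + 1 = l - j by ring] at h2
    rw [show -(τ + 1) = -τ - 1 by ring, show ((j + 1 : ℕ) : ℤ) - k - 1 = j - k - 1 + 1 by push_cast; ring,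
      show l - ((j + 1 : ℕ) : ℤ) = l - j - 1 by push_cast; ring]
    linear_combination -(wtInt p 1 R L (l - j - 1) τ) * h1 +
      (wtInt p 1 r (-L) (j - k - 1) (-τ - 1)) * h2
  rw [Finset.sum_congr rfl hterm, Finset.sum_range_sub']
  simp only [Nat.cast_zero, zero_sub, sub_zero]
  rw [wtInt_unit_eq_zero hp0 hp1 hr0 hr1 (k := ((k + 1 : ℕ) : ℤ) - k - 1) (by push_cast; omega)]
  simp

/-- Read backwards, `nint_double` assembles the sum into a double integral. The condition on L
removes the w-singularity at 0 and l ≥ 0 the one at 1, so Cauchy's formula evaluates the w-integral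
at w = v. What is left is the integral of u^(l-k-1) du, a Kronecker delta. -/
theorem gramBdry_start {r R : ℝ} (hp0 : 0 < p) (hp1 : p < 1) (hr0 : 0 < r) (hr1 : r < 1)
    (hR1 : 1 < R) (hR : R < 1 / (1 - p)) {L x : ℤ} (k l : ℕ) (hl : x + l + 1 ≤ L) :
    gramBdry p r R L k l x = if k = l then 1 else 0 := by
  have hregR := regPt_big hp1 hR1 hR
  have hregr := regPt_unit hp0 hp1 hr0 hr1
  have hα : ∀ z ∈ closedBall (1 : ℂ) r, DifferentiableAt ℂ
      (fun v : ℂ => (1 - p * ((v - 1) / v)) ^ (-x) * v ^ (-L - 2)) z := by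
    intro w hw
    have h0 := ne_zero_of_mem_closedBall hr1 hw
    have hu : DifferentiableAt ℂ (fun w : ℂ => (w - 1) / w) w :=
      (differentiableAt_id.sub_const 1).div differentiableAt_id h0
    exact ((((differentiableAt_const _).mul hu).const_sub 1).zpow (Or.inl
      (one_sub_mul_div_ne_zero h0 (lin_ne_zero_of_mem hp1 (unit_lt_inv hp0 hp1 hr1) hw)))).mul
        (differentiableAt_id.zpow (Or.inl h0))
  have key := nint_double hr0 hr1 hR1 hα (k + 1) _ (continuousOn_wtFun hregR L l x)
  have hsum : gramBdry p r R L k l x = ∑ j ∈ Finset.range (k + 1),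
      nint 1 r (fun v => (1 - p * ((v - 1) / v)) ^ (-x) * v ^ (-L - 2) *
        ((v - 1) / v) ^ ((j : ℤ) - ((k + 1 : ℕ) : ℤ))) *
      nint 1 R (fun w => wtFun p L l x w * ((w - 1) / w) ^ (-(j : ℤ) - 1)) := by
    refine Finset.sum_congr rfl fun j _ => ?_
    unfold wtInt
    congr 1
    · refine nint_congr hr0.le fun v hv => ?_
      simp only [wtFun]
      rw [show (j : ℤ) - ((k + 1 : ℕ) : ℤ) = (j : ℤ) - k - 1 by push_cast; ring]
      ring
    · refine nint_congr (by linarith) fun w hw => ?_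
      simp only [wtFun]
      rw [show (l : ℤ) - j - 1 = l + (-(j : ℤ) - 1) by ring, zpow_add₀ (hregR w hw).div_ne]
      ring
  rw [hsum, ← key, nint_congr hr0.le (g := wtFun p 0 (l - k - 1) 0)]
  · change wtInt p 1 r 0 (l - k - 1) 0 = _
    split_ifs with hkl
    · subst hkl
      rw [sub_self, zero_sub, wtInt_unit_neg_one hp0 hp1 hr0 hr1]
    · exact wtInt_zero_of_ne hr0.le hregr (by omega)
  · intro v hv
    have hvb : v ∈ ball (1 : ℂ) R := by
      simp only [mem_sphere, mem_ball] at hv ⊢; linarith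
    have hv := hregr v hv
    have hin : nint 1 R (fun w => wtFun p L l x w * ((w - 1) / w - (v - 1) / v)⁻¹) =
        nint 1 R (fun w => (fun w : ℂ => v * w ^ (L - 1 - l - x) *
          (((1 - p) * w + p) ^ x * (w - 1) ^ (l : ℤ))) w / (w - v)) := by
      refine nint_congr (by linarith) fun w hw => ?_
      have hw := hregR w hw
      simp only
      rw [wtFun_eq hw, inv_sub_div_eq hw.1 hv.1,
        show L - 1 - l - x = L - 2 - l - x + 1 by ring, zpow_add_one₀ hw.1]
      ring
    simp only
    rw [hin, nint_cauchy hvb]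
    · have := wtFun_eq hv L l x
      rw [show L - 1 - l - x = L - 2 - l - x + 1 by ring, zpow_add_one₀ hv.1,
        show v * (v ^ (L - 2 - l - x) * v) * (((1 - (p : ℂ)) * v + p) ^ x * (v - 1) ^ (l : ℤ)) =
          v * v * wtFun p L l x v by rw [this]; ring]
      simp only [wtFun, zpow_zero, one_mul]
      have e1 : (l : ℤ) - k - 1 = -((k + 1 : ℕ) : ℤ) + l := by push_cast; ring
      rw [e1, zpow_add₀ hv.div_ne, zpow_neg (1 - (p : ℂ) * ((v - 1) / v)) x]
      have h1 := zpow_ne_zero x hv.2.2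
      have h2 : v ^ (-L - 2) * (v * v) * v ^ (L - 2) = v ^ (0 - 2 : ℤ) := by
        rw [← pow_two, ← zpow_natCast v 2, ← zpow_add₀ hv.1, ← zpow_add₀ hv.1]
        congr 1; push_cast; ring
      rw [← h2]
      generalize (1 - (p : ℂ) * ((v - 1) / v)) ^ x = A at *
      field_simp
    · intro w hw
      refine DifferentiableAt.mul (DifferentiableAt.mul (differentiableAt_const _)
        (DifferentiableAt.zpow (by fun_prop) (Or.inr (by omega)))) ?_
      exact (DifferentiableAt.zpow (f := fun w : ℂ => (1 - p) * w + p) (by fun_prop)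
        (Or.inl (lin_ne_zero_of_mem hp1 hR hw))).mul
        (DifferentiableAt.zpow (f := fun w => w - 1) (m := (l : ℤ)) (by fun_prop) (Or.inr (by omega)))

end KernelParts

end KernelDecomposition

/-! ### Fredholm expansions: summability, finite sections, trace class. -/

section Fredholm

open Finset Filter Topology

/-- Expanding the product of row sums runs over all maps of the index set, and the Leibniz formula
only over the bijective ones. -/
theorem norm_det_le_prod_sum {n : Type*} [Fintype n] [DecidableEq n] (B : Matrix n n ℂ) :
    ‖B.det‖ ≤ ∏ i, ∑ j, ‖B i j‖ := by
  rw [← Matrix.det_transpose, Matrix.det_apply]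
  refine (norm_sum_le _ _).trans ?_
  rw [Finset.prod_univ_sum, Fintype.piFinset_univ]
  have h : ∀ σ : Equiv.Perm n, ‖Equiv.Perm.sign σ • ∏ i, B.transpose (σ i) i‖ =
      (fun f : n → n => ∏ i, ‖B i (f i)‖) σ := by
    intro σ
    rcases Int.units_eq_one_or (Equiv.Perm.sign σ) with h | h <;>
      simp [h, Matrix.transpose_apply, Units.neg_smul, norm_prod]
  simp_rw [h]
  rw [← Finset.sum_image (f := fun f : n → n => ∏ i, ‖B i (f i)‖)
    (s := Finset.univ) (g := fun σ : Equiv.Perm n => (σ : n → n))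
    (fun a _ b _ hab => DFunLike.coe_injective hab)]
  exact Finset.sum_le_sum_of_subset_of_nonneg (Finset.subset_univ _)
    fun f _ _ => Finset.prod_nonneg fun i _ => norm_nonneg _

theorem sum_prod_le_pow {S : Type*} {b : S → ℝ} (hb : ∀ s, 0 ≤ b s) (hs : Summable b) {k : ℕ}
    (u : Finset (Fin k → S)) : ∑ s ∈ u, ∏ i, b (s i) ≤ (∑' s, b s) ^ k := by
  classical
  calc ∑ s ∈ u, ∏ i, b (s i)
      ≤ ∑ s ∈ Fintype.piFinset fun i => u.image fun s => s i, ∏ i, b (s i) :=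
        Finset.sum_le_sum_of_subset_of_nonneg
          (fun s hs => Fintype.mem_piFinset.2 fun i => Finset.mem_image_of_mem _ hs)
          fun s _ _ => Finset.prod_nonneg fun i _ => hb _
    _ = ∏ i : Fin k, ∑ s ∈ u.image fun s => s i, b s := by rw [Finset.prod_univ_sum]
    _ ≤ ∏ _i : Fin k, ∑' s, b s :=
        Finset.prod_le_prod (fun i _ => Finset.sum_nonneg fun s _ => hb s)
          fun i _ => hs.sum_le_tsum _ fun s _ => hb s
    _ = _ := by simp

variable {S : Type*}

/-- The terms of the Fredholm expansion of `det(1 - A)`. -/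
def fredholmTerm (A : S → S → ℂ) (q : Σ k : ℕ, (Fin k → S)) : ℂ :=
  ((-1 : ℂ) ^ q.1 / (q.1.factorial : ℂ)) * (Matrix.of fun i j : Fin q.1 => A (q.2 i) (q.2 j)).det

/-- For an injective tuple each row sum of the minor is at most the full row sum; for any other
tuple the minor has two equal rows. -/
theorem norm_fredholmTerm_le {A : S → S → ℂ} (hA : Summable fun q : S × S => ‖A q.1 q.2‖)
    (q : Σ k : ℕ, (Fin k → S)) :
    ‖fredholmTerm A q‖ ≤ ((q.1.factorial : ℝ))⁻¹ * ∏ i, ∑' s', ‖A (q.2 i) s'‖ := by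
  obtain ⟨k, s⟩ := q
  simp only [fredholmTerm]
  rw [norm_mul, norm_div, norm_pow, norm_neg, norm_one, one_pow, one_div, Complex.norm_natCast]
  refine mul_le_mul_of_nonneg_left ?_ (by positivity)
  by_cases hs : Function.Injective s
  · refine (norm_det_le_prod_sum _).trans (Finset.prod_le_prod
      (fun i _ => Finset.sum_nonneg fun j _ => norm_nonneg _) fun i _ => ?_)
    have := (hA.prod_factor (s i))
    calc ∑ j, ‖A (s i) (s j)‖ = ∑ s' ∈ univ.map ⟨s, hs⟩, ‖A (s i) s'‖ := by simp
      _ ≤ _ := this.sum_le_tsum _ fun _ _ => norm_nonneg _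
  · simp only [Function.Injective, not_forall] at hs
    obtain ⟨i, j, hij, hne⟩ := hs
    rw [Matrix.det_zero_of_row_eq hne (by ext l; simp [hij]), norm_zero]
    exact Finset.prod_nonneg fun i _ => tsum_nonneg fun _ => norm_nonneg _

theorem summable_inv_factorial_mul_prod {b : S → ℝ} (hb0 : ∀ s, 0 ≤ b s) (hb : Summable b) :
    Summable fun q : Σ k : ℕ, (Fin k → S) => ((q.1.factorial : ℝ))⁻¹ * ∏ i, b (q.2 i) := by
  have hk : ∀ k : ℕ, Summable fun s : Fin k → S => ∏ i, b (s i) := fun k =>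
    summable_of_sum_le (fun s => Finset.prod_nonneg fun i _ => hb0 _) (sum_prod_le_pow hb0 hb)
  have hnn : ∀ q : Σ k : ℕ, (Fin k → S), 0 ≤ ((q.1.factorial : ℝ))⁻¹ * ∏ i, b (q.2 i) := fun q =>
    mul_nonneg (by positivity) (Finset.prod_nonneg fun i _ => hb0 _)
  refine (summable_sigma_of_nonneg hnn).2 ⟨fun k => (hk k).mul_left ((k.factorial : ℝ))⁻¹, ?_⟩
  have hle : ∀ k : ℕ, ∑' s : Fin k → S, ((k.factorial : ℝ))⁻¹ * ∏ i, b (s i) ≤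
      (∑' s, b s) ^ k / (k.factorial : ℝ) := by
    intro k
    rw [tsum_mul_left, div_eq_inv_mul]
    exact mul_le_mul_of_nonneg_left
      ((hk k).tsum_le_of_sum_le (sum_prod_le_pow hb0 hb)) (by positivity)
  exact (Real.summable_pow_div_factorial (∑' s, b s)).of_nonneg_of_le
    (fun k => tsum_nonneg fun s => hnn ⟨k, s⟩) hle

theorem fredholmSummable_of_summable {A : S → S → ℂ}
    (hA : Summable fun q : S × S => ‖A q.1 q.2‖) : FredholmSummable A := by
  have hsum := summable_inv_factorial_mul_prod (b := fun s => ∑' s', ‖A s s'‖)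
    (fun s => tsum_nonneg fun _ => norm_nonneg _) hA.prod
  exact hsum.of_nonneg_of_le (fun q => norm_nonneg (fredholmTerm A q)) (norm_fredholmTerm_le hA)

theorem fredholmTerm_conj (A : S → S → ℂ) {ρ : S → ℂ} (hρ : ∀ s, ρ s ≠ 0) :
    fredholmTerm (fun s s' => ρ s * A s s' * (ρ s')⁻¹) = fredholmTerm A := by
  ext ⟨k, s⟩
  simp only [fredholmTerm]
  congr 1
  have h1 := Matrix.det_mul_row (fun j => (ρ (s j))⁻¹)
    (Matrix.of fun i j : Fin k => ρ (s i) * A (s i) (s j))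
  have h2 := Matrix.det_mul_column (fun i => ρ (s i)) (Matrix.of fun i j : Fin k => A (s i) (s j))
  simp only [Matrix.of_apply] at h1 h2
  simp_rw [mul_comm _ (ρ _)⁻¹]
  rw [h1, h2, ← mul_assoc, ← Finset.prod_mul_distrib]
  simp [hρ]

theorem fredholmSummable_iff {A : S → S → ℂ} :
    FredholmSummable A ↔ Summable fun q => ‖fredholmTerm A q‖ := Iff.rfl

theorem fredholmSummable_of_conj {A : S → S → ℂ} {ρ : S → ℂ} (hρ : ∀ s, ρ s ≠ 0)
    (h : FredholmSummable fun s s' => ρ s * A s s' * (ρ s')⁻¹) : FredholmSummable A := by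
  rw [fredholmSummable_iff] at h ⊢
  rwa [fredholmTerm_conj A hρ] at h

theorem fredholmDet_eq_tsum {A : S → S → ℂ} (h : FredholmSummable A) :
    fredholmDet A = ∑' q, fredholmTerm A q := by
  have hs : Summable (fredholmTerm A) := Summable.of_norm h
  rw [hs.tsum_sigma]
  unfold fredholmDet fredholmTerm
  simp_rw [tsum_mul_left]

/-- Tuples with a repetition contribute zero, and each k-element set T is enumerated by k! injective
tuples with the same minor. -/
theorem sum_det_submatrix_eq {n : Type*} [Fintype n] [DecidableEq n] (M : Matrix n n ℂ) (k : ℕ) :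
    ∑ s : Fin k → n, (M.submatrix s s).det =
      k.factorial * ∑ T ∈ univ.powersetCard k,
        (M.submatrix (Subtype.val : T → n) (Subtype.val : T → n)).det := by
  have h0 : ∀ s : Fin k → n, ¬ Function.Injective s → (M.submatrix s s).det = 0 := by
    intro s hs
    simp only [Function.Injective, not_forall] at hs
    obtain ⟨i, j, hij, hne⟩ := hs
    exact Matrix.det_zero_of_row_eq hne (by ext l; simp [hij])
  rw [← Finset.sum_subset (Finset.subset_univ (univ.filter fun s : Fin k → n => Function.Injective s))
    fun s _ hs => h0 s (by simpa using hs),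
    ← Finset.sum_fiberwise_of_maps_to (t := univ.powersetCard k) (g := fun s => univ.image s)
      (fun s hs => by
        rw [mem_powersetCard]
        exact ⟨subset_univ _, by rw [card_image_of_injective _ (by simpa using hs)]; simp⟩),
    Finset.mul_sum]
  refine Finset.sum_congr rfl fun T hT => ?_
  have hTk : T.card = k := (mem_powersetCard.1 hT).2
  have hcard : Fintype.card (Fin k ≃ T) = k.factorial := by
    rw [Fintype.card_equiv ((Fintype.equivFinOfCardEq (by simp [hTk])).symm), Fintype.card_fin]
  have key : ∑ s ∈ {s ∈ univ.filter fun s : Fin k → n => Function.Injective s | univ.image s = T},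
      (M.submatrix s s).det = ∑ _e : Fin k ≃ T,
        (M.submatrix (Subtype.val : T → n) (Subtype.val : T → n)).det := by
    symm
    refine Finset.sum_bij (fun e _ => fun i => (e i : n)) ?_ ?_ ?_ ?_
    · intro e _
      simp only [mem_filter, mem_univ, true_and]
      refine ⟨Subtype.val_injective.comp e.injective, ?_⟩
      ext a
      simp only [mem_image, mem_univ, true_and]
      constructor
      · rintro ⟨i, rfl⟩; exact (e i).2
      · intro ha; exact ⟨e.symm ⟨a, ha⟩, by simp⟩
    · intro e _ e' _ h
      ext i; exact congrFun h i
    · intro s hs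
      simp only [mem_filter, mem_univ, true_and] at hs
      obtain ⟨hinj, him⟩ := hs
      have hmem : ∀ i, s i ∈ T := fun i => him ▸ mem_image_of_mem _ (mem_univ i)
      refine ⟨Equiv.ofBijective (fun i => ⟨s i, hmem i⟩) ⟨fun i j h => hinj (by simpa using h), ?_⟩,
        mem_univ _, rfl⟩
      rintro ⟨a, ha⟩
      rw [← him, mem_image] at ha
      obtain ⟨i, _, rfl⟩ := ha
      exact ⟨i, rfl⟩
    · intro e _
      rw [← Matrix.det_submatrix_equiv_self e]
      rfl
  rw [key, Finset.sum_const, Finset.card_univ, hcard, nsmul_eq_mul]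

/-- Multilinearity in the rows of -M + 1 gives the sum of all principal minors of -M. -/
theorem det_one_sub_eq_sum {n : Type*} [Fintype n] [DecidableEq n] (M : Matrix n n ℂ) :
    (1 - M).det = ∑ k ∈ range (Fintype.card n + 1), ((-1 : ℂ) ^ k / k.factorial) *
      ∑ s : Fin k → n, (M.submatrix s s).det := by
  have h1 : (1 - M).det = ∑ T : Finset n,
      ((-M).submatrix (Subtype.val : T → n) (Subtype.val : T → n)).det := by
    rw [sub_eq_neg_add]
    refine ((Matrix.detRowAlternating (n := n) (R := ℂ)).map_add_univ (-M).row
      (1 : Matrix n n ℂ).row).trans (Finset.sum_congr rfl fun T _ => ?_)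
    exact Matrix.det_piecewise_one_eq_submatrix_det (-M) T
  rw [h1, ← Finset.powerset_univ, Finset.sum_powerset]
  refine Finset.sum_congr (by simp) fun k _ => ?_
  rw [sum_det_submatrix_eq, ← mul_assoc, div_mul_cancel₀ _ (by exact_mod_cast k.factorial_ne_zero),
    Finset.mul_sum]
  refine Finset.sum_congr rfl fun T hT => ?_
  have : (-M).submatrix (Subtype.val : T → n) (Subtype.val : T → n) =
    -(M.submatrix (Subtype.val : T → n) (Subtype.val : T → n)) := rfl
  rw [this, Matrix.det_neg, Fintype.card_coe, (mem_powersetCard.1 hT).2]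

theorem tsum_fredholmTerm_restrict [DecidableEq S] {A : S → S → ℂ} (h : FredholmSummable A) (F : Finset S) :
    ∑' q, (if ∀ i, q.2 i ∈ F then fredholmTerm A q else 0) =
      (1 - Matrix.of fun s s' : F => A s s').det := by
  have hs : Summable fun q : Σ k : ℕ, (Fin k → S) =>
      if ∀ i, q.2 i ∈ F then fredholmTerm A q else 0 := by
    refine Summable.of_norm_bounded (g := fun q => ‖fredholmTerm A q‖) h fun q => ?_
    split_ifs
    · exact le_rfl
    · simp
  have hk : ∀ k : ℕ, (∑' s : Fin k → S, if ∀ i, s i ∈ F then fredholmTerm A ⟨k, s⟩ else 0) =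
      ((-1 : ℂ) ^ k / k.factorial) * ∑ s : Fin k → F,
        ((Matrix.of fun s s' : F => A s s').submatrix s s).det := by
    intro k
    rw [tsum_eq_sum (s := Fintype.piFinset fun _ => F) fun s hs =>
      if_neg fun h => hs (Fintype.mem_piFinset.2 h), Finset.mul_sum]
    symm
    refine Finset.sum_bij (fun s _ => fun i => (s i : S)) ?_ ?_ ?_ ?_
    · intro s _; exact Fintype.mem_piFinset.2 fun i => (s i).2
    · intro s _ s' _ h; ext i; exact congrFun h i
    · intro s hs
      rw [Fintype.mem_piFinset] at hs
      exact ⟨fun i => ⟨s i, hs i⟩, mem_univ _, rfl⟩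
    · intro s _
      rw [if_pos fun i => (s i).2]
      rfl
  rw [hs.tsum_sigma, det_one_sub_eq_sum]
  simp_rw [hk]
  refine tsum_eq_sum fun k hk => ?_
  rw [Finset.mem_range, not_lt] at hk
  rw [Finset.sum_eq_zero, mul_zero]
  intro s _
  have : ¬ Function.Injective s := fun hi => by
    have := Fintype.card_le_of_injective s hi
    rw [Fintype.card_fin] at this
    omega
  simp only [Function.Injective, not_forall] at this
  obtain ⟨i, j, hij, hne⟩ := this
  exact Matrix.det_zero_of_row_eq hne (by ext l; simp [hij])

/-- The Fredholm determinant is the limit of the determinants of finite sections. -/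
theorem tendsto_det_one_sub [DecidableEq S] {A : S → S → ℂ} (h : FredholmSummable A) (F : ℕ → Finset S)
    (hF : Monotone F) (hF' : ∀ s, ∃ M, s ∈ F M) :
    Tendsto (fun M => (1 - Matrix.of fun s s' : F M => A s s').det) atTop (𝓝 (fredholmDet A)) := by
  rw [fredholmDet_eq_tsum h]
  simp_rw [← tsum_fredholmTerm_restrict h]
  -- A finite section keeps exactly the terms whose tuple lies in it, so the full expansion
  -- dominates.
  refine tendsto_tsum_of_dominated_convergence (bound := fun q => ‖fredholmTerm A q‖) h
    (fun q => ?_) (Eventually.of_forall fun M q => ?_)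
  · have : ∀ᶠ M in atTop, ∀ i, q.2 i ∈ F M := by
      rw [eventually_all]
      intro i
      obtain ⟨M, hM⟩ := hF' (q.2 i)
      filter_upwards [eventually_ge_atTop M] with M' hM'
      exact hF hM' hM
    exact tendsto_const_nhds.congr' (this.mono fun M hM => (if_pos hM).symm)
  · split_ifs
    · exact le_rfl
    · simp

end Fredholm

/-- The operator is the sum of its matrix units A(s, s') e_s ⊗ e_{s'}, rank one operators of norm
|A(s, s')|. -/
theorem traceClass_of_summable {S : Type} {A : S → S → ℂ}
    (hA : Summable fun q : S × S => ‖A q.1 q.2‖) :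
    ∃ T : lp (fun _ : S => ℂ) 2 →L[ℂ] lp (fun _ : S => ℂ) 2, IsTraceClass T ∧
      ∀ s s', open Classical in T (lp.single 2 s' (1 : ℂ)) s = A s s' := by
  classical
  let e : S → lp (fun _ : S => ℂ) 2 := fun s => lp.single 2 s (1 : ℂ)
  have he : ∀ s, ‖e s‖ = 1 := fun s => by
    simp only [e]; rw [lp.norm_single (by norm_num)]; simp
  have hinner : ∀ s s', inner ℂ (e s) (e s') = if s = s' then 1 else 0 := by
    intro s s'
    simp only [e]
    rw [lp.inner_single_left]
    simp [lp.single_apply, Pi.single_apply]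
  let T0 : S × S → (lp (fun _ : S => ℂ) 2 →L[ℂ] lp (fun _ : S => ℂ) 2) := fun q =>
    (innerSL ℂ (e q.2)).smulRight (A q.1 q.2 • e q.1)
  have hT0 : Summable T0 := by
    refine Summable.of_norm_bounded hA fun q => ?_
    simp only [T0]
    rw [ContinuousLinearMap.norm_smulRight_apply, innerSL_apply_norm, norm_smul, he, he]
    simp
  have happ : ∀ f, HasSum (fun q : S × S => inner ℂ (e q.2) f • (A q.1 q.2 • e q.1)) ((∑' q, T0 q) f) := by
    intro f
    have := (ContinuousLinearMap.apply ℂ (lp (fun _ : S => ℂ) 2) f).hasSum hT0.hasSum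
    simpa [T0] using this
  refine ⟨∑' q, T0 q, ⟨S × S, fun q => A q.1 q.2 • e q.1, fun q => e q.2, ?_, happ⟩, ?_⟩
  · simpa [norm_smul, he] using hA
  · intro s s'
    have h1 := happ (e s')
    have h2 := (innerSL ℂ (e s)).hasSum h1
    have h3 : HasSum (fun q : S × S => inner ℂ (e s) (inner ℂ (e q.2) (e s') • (A q.1 q.2 • e q.1)))
        (A s s') := by
      have : (fun q : S × S => inner ℂ (e s) (inner ℂ (e q.2) (e s') • (A q.1 q.2 • e q.1))) =
          fun q => if q = (s, s') then A s s' else 0 := by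
        ext ⟨a, b⟩
        simp only [inner_smul_right, hinner, Prod.mk.injEq]
        by_cases h1 : b = s' <;> by_cases h2 : s = a <;> simp [h1, h2, eq_comm]
      rw [this]
      exact hasSum_ite_eq _ _
    have h4 := h2.unique h3
    simp only [innerSL_apply_apply] at h4
    rw [← h4]
    simp only [e]
    rw [lp.inner_single_left]
    simp

/-! ### Reduction of finite sections to a fixed-size determinant, and its limit. -/

section LevelAlgebra

open Finset Filter Topology

/-- The relations between the functions of the biorthogonal expansion, with time counted from the
left end of the half line. -/
structure LevelData (p : ℂ) (φ ψ : ℤ → ℕ → ℂ) (ω : ℕ → ℕ → ℕ → ℂ) : Prop where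
  ne_zero : p ≠ 0
  phi_diff : ∀ k t, φ k (t + 1) - φ k t = p * φ (k - 1) (t + 1)
  phi_neg : ∀ k t, k < 0 → φ k t = 0
  phi_zero : ∀ t, φ 0 t = p
  psi_diff : ∀ k t, ψ k t - ψ k (t + 1) = p * ψ (k + 1) t
  omega_zero : ∀ s t, ω 0 s t = if s = t then 1 else 0
  omega_succ : ∀ d s t, ω (d + 1) s t = p * ∑ σ ∈ range (t + 1), ω d s σ

/-- Summation over the past. -/
def cumSum (p : ℂ) (g : ℕ → ℂ) (t : ℕ) : ℂ := p * ∑ σ ∈ range (t + 1), g σ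

/-- The part of the level function `φ (l - j)` that is accounted for by the cut-offs of the levels
below `l`. -/
def cutPart (p : ℂ) (φ : ℤ → ℕ → ℂ) (χ : ℕ → ℕ → ℂ) (j : ℕ) : ℕ → ℕ → ℂ
  | 0 => fun _ => 0
  | l + 1 => cumSum p fun t => cutPart p φ χ j l t + χ l t * (φ (l - j) t - cutPart p φ χ j l t)

/-- What remains of the level function after the cut-offs of the lower levels. -/
def restPart (p : ℂ) (φ : ℤ → ℕ → ℂ) (χ : ℕ → ℕ → ℂ) (j l t : ℕ) : ℂ :=
  φ (l - j) t - cutPart p φ χ j l t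

variable {p : ℂ} {φ ψ : ℤ → ℕ → ℂ} {ω : ℕ → ℕ → ℕ → ℂ} {χ : ℕ → ℕ → ℂ}

theorem cutPart_succ (j l t : ℕ) : cutPart p φ χ j (l + 1) t =
    cumSum p (fun t => cutPart p φ χ j l t + χ l t * restPart p φ χ j l t) t := rfl

/-- Unrolls the recursion, since ω at distance d is d-fold summation over the past. In matrix form
the rest parts solve R(1 + U) = Φ, with U the cut-off transition function. The bound t < M serves
only to make the delta function at distance 0 visible inside `range M`. -/
theorem cutPart_eq (D : LevelData p φ ψ ω) (j M l : ℕ) : ∀ t < M, cutPart p φ χ j l t =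
    ∑ k ∈ range l, ∑ σ ∈ range M, χ k σ * restPart p φ χ j k σ * ω (l - k) σ t := by
  induction l with
  | zero => intro t _; simp [cutPart]
  | succ l ih =>
    intro t ht
    rw [cutPart_succ, cumSum]
    have h1 : ∀ τ ∈ range (t + 1), cutPart p φ χ j l τ + χ l τ * restPart p φ χ j l τ =
        ∑ k ∈ range (l + 1), ∑ σ ∈ range M, χ k σ * restPart p φ χ j k σ * ω (l - k) σ τ := by
      intro τ hτ
      have hτM : τ < M := by simp at hτ; omega
      rw [sum_range_succ, ih τ hτM]
      congr 1
      simp [D.omega_zero, hτM]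
    rw [Finset.sum_congr rfl h1, Finset.sum_comm, Finset.mul_sum]
    refine Finset.sum_congr rfl fun k hk => ?_
    rw [Finset.sum_comm, Finset.mul_sum]
    refine Finset.sum_congr rfl fun σ _ => ?_
    rw [show l + 1 - k = l - k + 1 by simp at hk; omega, D.omega_succ, ← Finset.mul_sum]
    ring

theorem cutPart_of_le (D : LevelData p φ ψ ω) {j l : ℕ} (h : l ≤ j) (t : ℕ) :
    cutPart p φ χ j l t = 0 := by
  induction l generalizing t with
  | zero => rfl
  | succ l ih =>
    rw [cutPart_succ, cumSum]
    simp [restPart, ih (by omega), D.phi_neg ((l : ℤ) - j) _ (by omega)]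

theorem restPart_of_lt (D : LevelData p φ ψ ω) {j l : ℕ} (h : l < j) (t : ℕ) :
    restPart p φ χ j l t = 0 := by
  simp [restPart, cutPart_of_le D h.le, D.phi_neg ((l : ℤ) - j) _ (by omega)]

theorem restPart_self (D : LevelData p φ ψ ω) (l t : ℕ) : restPart p φ χ l l t = p := by
  simp [restPart, cutPart_of_le D le_rfl, D.phi_zero]

theorem restPart_zero (D : LevelData p φ ψ ω) (j t : ℕ) :
    restPart p φ χ j 0 (t + 1) = restPart p φ χ j 0 t := by
  have := D.phi_diff (0 - j) t
  simp only [restPart, cutPart, Nat.cast_zero, sub_zero]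
  rw [D.phi_neg _ (t + 1) (by omega : (0 : ℤ) - j - 1 < 0)] at this
  linear_combination this

/-- The subtraction removes what is accumulated where χ_l = 1, so the rest part grows only at times
that the cut-off of level l excludes. -/
theorem restPart_succ (D : LevelData p φ ψ ω) (j l t : ℕ) :
    restPart p φ χ j (l + 1) (t + 1) - restPart p φ χ j (l + 1) t =
      p * ((1 - χ l (t + 1)) * restPart p φ χ j l (t + 1)) := by
  have h1 := D.phi_diff ((l + 1 : ℕ) - j) t
  have h2 : cutPart p φ χ j (l + 1) (t + 1) - cutPart p φ χ j (l + 1) t =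
      p * (cutPart p φ χ j l (t + 1) + χ l (t + 1) * restPart p φ χ j l (t + 1)) := by
    rw [cutPart_succ, cutPart_succ, cumSum, cumSum, sum_range_succ _ (t + 1)]
    ring
  rw [show ((l + 1 : ℕ) : ℤ) - j - 1 = l - j by push_cast; ring] at h1
  have h3 : restPart p φ χ j l (t + 1) = φ (l - j) (t + 1) - cutPart p φ χ j l (t + 1) := rfl
  simp only [restPart] at h2 ⊢
  linear_combination h1 - h2

/-- Abel summation. With truncated subtraction the increment at t = 0 is zero, and s 0 = 0 covers
the boundary term when B = 0. -/
theorem sum_mul_sub_eq (G s : ℕ → ℂ) (hs : s 0 = 0) (B : ℕ) :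
    ∑ t ∈ range B, G t * (s t - s (t + 1)) =
      -(G (B - 1) * s B) + ∑ t ∈ range B, (G t - G (t - 1)) * s t := by
  induction B with
  | zero => simp [hs]
  | succ B ih =>
    rw [sum_range_succ, sum_range_succ, ih, Nat.add_sub_cancel]
    ring

/-- Iterated summation by parts for the sums below the cut-offs. -/
theorem sum_restPart_mul (D : LevelData p φ ψ ω) (sm : ℤ → ℕ → ℂ)
    (hsm : ∀ k t, sm k t - sm k (t + 1) = p * sm (k + 1) t) (h i : ℕ)
    (hsm0 : ∀ k : ℤ, k < h → sm k 0 = 0) (B : ℕ → ℕ)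
    (hB : ∀ l < h, B l ≤ B (l + 1))
    (hχ : ∀ l < h, ∀ t < B (l + 1), 1 - χ l t = if t < B l then 1 else 0) (j : ℕ) :
    ∀ l ≤ h, p * ∑ t ∈ range (B l), restPart p φ χ j l t * sm (l - i) t =
      -∑ k ∈ range (l + 1), restPart p φ χ j k (B k - 1) * sm (k - 1 - i) (B k) := by
  have step : ∀ (l : ℕ) (G : ℕ → ℂ), l ≤ h → p * ∑ t ∈ range (B l), G t * sm (l - i) t =
      -(G (B l - 1) * sm (l - 1 - i) (B l)) +
        ∑ t ∈ range (B l), (G t - G (t - 1)) * sm (l - 1 - i) t := by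
    intro l G hl
    rw [← sum_mul_sub_eq G _ (hsm0 _ (by omega)) (B l), Finset.mul_sum]
    refine Finset.sum_congr rfl fun t _ => ?_
    rw [hsm, show (l : ℤ) - 1 - i + 1 = l - i by ring]
    ring
  intro l
  induction l with
  | zero =>
    intro h0
    rw [step 0 _ h0, Finset.sum_range_one]
    rw [Finset.sum_eq_zero fun t _ => ?_, add_zero]
    rcases t with _ | t
    · simp
    · rw [Nat.add_sub_cancel, restPart_zero D, sub_self, zero_mul]
  | succ l ih =>
    intro hl
    rw [step _ _ hl, sum_range_succ, neg_add, ← ih (by omega), add_comm]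
    congr 1
    -- The increments at level l + 1 vanish from time B l on. One summation by parts thus turns the
    -- sum up to B (l + 1) into the sum up to B l one level lower, plus a boundary term.
    have h1 : ∀ t ∈ range (B (l + 1)), (restPart p φ χ j (l + 1) t - restPart p φ χ j (l + 1) (t - 1)) *
        sm ((l + 1 : ℕ) - 1 - i) t =
        if t < B l then p * (restPart p φ χ j l t * sm (l - i) t) else 0 := by
      intro t ht
      rw [show ((l + 1 : ℕ) : ℤ) - 1 - i = l - i by push_cast; ring]
      have h2 := hχ l (by omega) t (mem_range.1 ht)
      rcases t with _ | t
      · have h0 := hsm0 (l - i) (by omega)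
        simp [h0]
      · rw [Nat.add_sub_cancel, restPart_succ D, h2]
        split_ifs <;> ring
    rw [Finset.sum_congr rfl h1, ← Finset.sum_filter, Finset.mul_sum]
    refine Finset.sum_congr ?_ fun _ _ => rfl
    ext t
    have := hB l (by omega)
    simp only [mem_filter, mem_range]
    omega

/-- At most geometric growth with ratio `κ`. -/
def GeomBdd (κ : ℝ) (g : ℕ → ℂ) : Prop := ∃ C : ℝ, ∀ t, ‖g t‖ ≤ C * κ ^ t

theorem GeomBdd.add {κ : ℝ} {f g : ℕ → ℂ} (hf : GeomBdd κ f) (hg : GeomBdd κ g) :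
    GeomBdd κ fun t => f t + g t := by
  obtain ⟨C, hC⟩ := hf
  obtain ⟨C', hC'⟩ := hg
  exact ⟨C + C', fun t => (norm_add_le _ _).trans (by rw [add_mul]; exact add_le_add (hC t) (hC' t))⟩

theorem GeomBdd.neg {κ : ℝ} {f : ℕ → ℂ} (hf : GeomBdd κ f) : GeomBdd κ fun t => -f t := by
  simpa only [GeomBdd, norm_neg] using hf

theorem GeomBdd.sub {κ : ℝ} {f g : ℕ → ℂ} (hf : GeomBdd κ f) (hg : GeomBdd κ g) :
    GeomBdd κ fun t => f t - g t := by
  simpa only [sub_eq_add_neg] using hf.add hg.neg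

theorem GeomBdd.cut {κ : ℝ} {f c : ℕ → ℂ} (hc : ∀ t, ‖c t‖ ≤ 1) (hf : GeomBdd κ f) :
    GeomBdd κ fun t => c t * f t := by
  obtain ⟨C, hC⟩ := hf
  refine ⟨C, fun t => ?_⟩
  rw [norm_mul]
  exact (mul_le_of_le_one_left (norm_nonneg _) (hc t)).trans (hC t)

theorem GeomBdd.const {κ : ℝ} (hκ : 1 < κ) (c : ℂ) : GeomBdd κ fun _ => c :=
  ⟨‖c‖, fun _ => le_mul_of_one_le_right (norm_nonneg _) (one_le_pow₀ hκ.le)⟩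

theorem norm_sum_range_le {κ C : ℝ} (hκ : 1 < κ) {g : ℕ → ℂ} (h : ∀ t, ‖g t‖ ≤ C * κ ^ t)
    (M : ℕ) : ‖∑ t ∈ range M, g t‖ ≤ C / (κ - 1) * κ ^ M := by
  have hC : 0 ≤ C := by simpa using (norm_nonneg _).trans (h 0)
  refine (norm_sum_le_of_le _ fun t _ => h t).trans ?_
  rw [← Finset.mul_sum, geom_sum_eq hκ.ne', div_mul_eq_mul_div, mul_div_assoc]
  have : 0 < κ - 1 := by linarith
  gcongr
  linarith

theorem GeomBdd.sum_range {κ : ℝ} (hκ : 1 < κ) {g : ℕ → ℂ} (h : GeomBdd κ g) :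
    GeomBdd κ fun M => ∑ t ∈ range M, g t := by
  obtain ⟨C, hC⟩ := h
  exact ⟨_, norm_sum_range_le hκ hC⟩

theorem GeomBdd.const_mul {κ : ℝ} {g : ℕ → ℂ} (c : ℂ) (h : GeomBdd κ g) :
    GeomBdd κ fun M => c * g M := by
  obtain ⟨C, hC⟩ := h
  refine ⟨‖c‖ * C, fun t => ?_⟩
  rw [norm_mul, mul_assoc]
  exact mul_le_mul_of_nonneg_left (hC t) (norm_nonneg _)

theorem GeomBdd.succ {κ : ℝ} {g : ℕ → ℂ} (h : GeomBdd κ g) : GeomBdd κ fun M => g (M + 1) := by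
  obtain ⟨C, hC⟩ := h
  refine ⟨C * κ, fun t => (hC (t + 1)).trans_eq (by ring)⟩

theorem GeomBdd.cumSum {κ : ℝ} (hκ : 1 < κ) {g : ℕ → ℂ} (h : GeomBdd κ g) :
    GeomBdd κ (cumSum p g) := ((h.sum_range hκ).const_mul p).succ

/-- Each function is a constant plus the cumulative sum of the preceding one, and cumulative
summation preserves a bound κ^t with κ > 1. -/
theorem LevelData.geomBdd_phi (D : LevelData p φ ψ ω) {κ : ℝ} (hκ : 1 < κ) (k : ℤ) :
    GeomBdd κ (φ k) := by
  rcases lt_or_ge k 0 with hk | hk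
  · exact ⟨0, fun t => by simp [D.phi_neg k t hk]⟩
  lift k to ℕ using hk
  induction k with
  | zero =>
    have : φ ((0 : ℕ) : ℤ) = fun _ => p := by ext t; exact D.phi_zero t
    rw [this]; exact GeomBdd.const hκ p
  | succ k ih =>
    have : φ ((k + 1 : ℕ) : ℤ) = fun t => (φ ((k + 1 : ℕ) : ℤ) 0 - p * φ k 0) + _root_.cumSum p (φ k) t := by
      ext t
      induction t with
      | zero => simp [_root_.cumSum]
      | succ t iht =>
        have h1 := D.phi_diff ((k + 1 : ℕ) : ℤ) t
        rw [show ((k + 1 : ℕ) : ℤ) - 1 = k by push_cast; ring] at h1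
        simp only [_root_.cumSum] at iht ⊢
        rw [sum_range_succ]
        linear_combination h1 + iht
    rw [this]
    exact (GeomBdd.const hκ _).add (ih.cumSum hκ)

theorem LevelData.geomBdd_cutPart (D : LevelData p φ ψ ω) {κ : ℝ} (hκ : 1 < κ)
    (hχ : ∀ l t, ‖χ l t‖ ≤ 1) (j l : ℕ) : GeomBdd κ (cutPart p φ χ j l) := by
  induction l with
  | zero => exact ⟨0, fun t => by simp [cutPart]⟩
  | succ l ih =>
    exact GeomBdd.cumSum hκ (ih.add (GeomBdd.cut (hχ l) ((D.geomBdd_phi hκ _).sub ih)))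

theorem LevelData.geomBdd_restPart (D : LevelData p φ ψ ω) {κ : ℝ} (hκ : 1 < κ)
    (hχ : ∀ l t, ‖χ l t‖ ≤ 1) (j l : ℕ) : GeomBdd κ (restPart p φ χ j l) :=
  (D.geomBdd_phi hκ _).sub (D.geomBdd_cutPart hκ hχ j l)

theorem LevelData.norm_omega_le (D : LevelData p φ ψ ω) {κ : ℝ} (hκ : 1 < κ) (d : ℕ) :
    ∃ C : ℝ, ∀ s t, ‖ω d s t‖ ≤ C * (κ⁻¹ ^ s * κ ^ t) := by
  have hκ0 : 0 < κ := by linarith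
  induction d with
  | zero =>
    refine ⟨1, fun s t => ?_⟩
    rw [D.omega_zero]
    split_ifs with h
    · subst h
      rw [← mul_pow, inv_mul_cancel₀ hκ0.ne']; simp
    · simp; positivity
  | succ d ih =>
    obtain ⟨C, hC⟩ := ih
    refine ⟨‖p‖ * (C / (κ - 1) * κ), fun s t => ?_⟩
    rw [D.omega_succ, norm_mul]
    have := norm_sum_range_le hκ (g := fun σ => ω d s σ) (C := C * κ⁻¹ ^ s)
      (fun t => (hC s t).trans_eq (by ring)) (t + 1)
    calc _ ≤ ‖p‖ * (C * κ⁻¹ ^ s / (κ - 1) * κ ^ (t + 1)) := by gcongr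
      _ = _ := by ring

theorem tendsto_zero_of_geomBdd {κ lam : ℝ} (hκ : 0 < κ) (hlam : 0 < lam) (h1 : κ * lam < 1)
    {f g : ℕ → ℂ} (hf : GeomBdd κ f) (hg : GeomBdd lam g) :
    Tendsto (fun M => f M * g M) atTop (𝓝 0) := by
  obtain ⟨C, hC⟩ := hf
  obtain ⟨C', hC'⟩ := hg
  have hC0 : 0 ≤ C := by simpa using (norm_nonneg _).trans (hC 0)
  have h2 : Tendsto (fun M : ℕ => C * C' * (κ * lam) ^ M) atTop (𝓝 0) := by
    simpa using (tendsto_pow_atTop_nhds_zero_of_lt_one (by positivity) h1).const_mul (C * C')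
  refine squeeze_zero_norm (fun M => ?_) h2
  rw [norm_mul, mul_pow]
  calc _ ≤ (C * κ ^ M) * (C' * lam ^ M) :=
        mul_le_mul (hC M) (hC' M) (norm_nonneg _) (by positivity)
    _ = _ := by ring

theorem sum_mul_psi_eq (D : LevelData p φ ψ ω) (g : ℕ → ℂ) (k : ℤ) (M : ℕ) :
    p * ∑ t ∈ range M, g t * ψ k t =
      (p * ∑ t ∈ range M, g t) * ψ k M + p * ∑ t ∈ range M, cumSum p g t * ψ (k + 1) t := by
  induction M with
  | zero => simp
  | succ M ih =>
    have h := D.psi_diff k M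
    rw [sum_range_succ, mul_add, ih, sum_range_succ _ M, sum_range_succ _ M]
    simp only [cumSum]
    rw [sum_range_succ _ M]
    linear_combination (p * (∑ t ∈ range M, g t + g M)) * h

/-- Passing from ψ_k to ψ_{k+1} by parts costs a boundary term of order (κ·lam)^M, which tends to 0.
-/
theorem tendsto_sum_mul_psi_sub (D : LevelData p φ ψ ω) {κ lam : ℝ} (hκ : 1 < κ) (hlam : 0 < lam)
    (h1 : κ * lam < 1) (hψ : ∀ k, GeomBdd lam (ψ k)) {g : ℕ → ℂ} (hg : GeomBdd κ g) (k : ℤ) :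
    Tendsto (fun M => ∑ t ∈ range M, g t * ψ k t - ∑ t ∈ range M, cumSum p g t * ψ (k + 1) t)
      atTop (𝓝 0) := by
  have := tendsto_zero_of_geomBdd (by linarith) hlam h1 (hg.sum_range hκ) (hψ k)
  refine this.congr fun M => ?_
  have h2 := sum_mul_psi_eq D g k M
  refine mul_left_cancel₀ D.ne_zero ?_
  linear_combination -h2

/-- Carrying the contribution of each level one level up, again and again, collects everything below
l into a pairing of the cut part with ψ at level l. -/
theorem tendsto_sum_levels (D : LevelData p φ ψ ω) {κ lam : ℝ} (hκ : 1 < κ) (hlam : 0 < lam)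
    (h1 : κ * lam < 1) (hψ : ∀ k, GeomBdd lam (ψ k)) (hχ : ∀ l t, ‖χ l t‖ ≤ 1) (j i l : ℕ) :
    Tendsto (fun M => ∑ k ∈ range l, ∑ t ∈ range M,
        χ k t * restPart p φ χ j k t * ψ (k - i) t -
      ∑ t ∈ range M, cutPart p φ χ j l t * ψ (l - i) t) atTop (𝓝 0) := by
  induction l with
  | zero => simp [cutPart]
  | succ l ih =>
    have hg : GeomBdd κ fun t => cutPart p φ χ j l t + χ l t * restPart p φ χ j l t :=
      (D.geomBdd_cutPart hκ hχ j l).add (GeomBdd.cut (hχ l) (D.geomBdd_restPart hκ hχ j l))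
    have h2 := ih.add (tendsto_sum_mul_psi_sub D hκ hlam h1 hψ hg (l - i))
    rw [add_zero] at h2
    refine h2.congr fun M => ?_
    rw [sum_range_succ]
    simp only [add_mul, Finset.sum_add_distrib]
    rw [show ((l + 1 : ℕ) : ℤ) - i = l - i + 1 by push_cast; ring]
    simp only [cutPart_succ]
    ring

/-- The limit of the finite section matrices. -/
theorem tendsto_section_entry (D : LevelData p φ ψ ω) {κ lam : ℝ} (hκ : 1 < κ) (hlam : 0 < lam)
    (h1 : κ * lam < 1) (hψ : ∀ k, GeomBdd lam (ψ k)) (hχ : ∀ l t, ‖χ l t‖ ≤ 1) {h j i B : ℕ}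
    (hB : ∀ t, 1 - χ h t = if t < B then 1 else 0)
    (hG : Tendsto (fun M => ∑ t ∈ range M, φ (h - j) t * ψ (h - i) t) atTop
      (𝓝 (if j = i then 1 else 0))) :
    Tendsto (fun M => (if j = i then 1 else 0) - ∑ l ∈ range (h + 1), ∑ t ∈ range M,
        χ l t * restPart p φ χ j l t * ψ (l - i) t) atTop
      (𝓝 (∑ t ∈ range B, restPart p φ χ j h t * ψ (h - i) t)) := by
  have h2 := tendsto_sum_levels D hκ hlam h1 hψ hχ j i h
  have h3 := ((hG.const_sub (if j = i then (1 : ℂ) else 0)).sub h2).add_const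
    (∑ t ∈ range B, restPart p φ χ j h t * ψ (h - i) t)
  rw [sub_self, sub_zero, zero_add] at h3
  refine h3.congr' ?_
  filter_upwards [eventually_ge_atTop B] with M hM
  rw [sum_range_succ]
  -- At the top level χ·rest = φ - cut - (1 - χ)·rest. The first term yields the Kronecker delta,
  -- the second absorbs the lower levels, and the third is the finite sum that survives.
  have h4 : ∑ t ∈ range M, χ h t * restPart p φ χ j h t * ψ (h - i) t =
      ∑ t ∈ range M, φ (h - j) t * ψ (h - i) t - ∑ t ∈ range M, cutPart p φ χ j h t * ψ (h - i) t -
        ∑ t ∈ range B, restPart p φ χ j h t * ψ (h - i) t := by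
    have h5 : ∑ t ∈ range B, restPart p φ χ j h t * ψ (h - i) t =
        ∑ t ∈ range M, (1 - χ h t) * (restPart p φ χ j h t * ψ (h - i) t) := by
      simp_rw [hB, ite_mul, one_mul, zero_mul]
      rw [← Finset.sum_filter]
      refine Finset.sum_congr ?_ fun _ _ => rfl
      ext t; simp only [mem_filter, mem_range]; omega
    rw [h5, ← Finset.sum_sub_distrib, ← Finset.sum_sub_distrib]
    refine Finset.sum_congr rfl fun t _ => ?_
    simp only [restPart]
    ring
  rw [h4]
  ring

/-- The finite sections of the kernel reduce to matrices of fixed size. -/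
theorem det_section_eq (D : LevelData p φ ψ ω) {m : ℕ} {n : Fin m → ℕ} (hn : StrictMono n) {h : ℕ}
    (hh : ∀ i, n i ≤ h) (hχ : ∀ l t, χ l t * χ l t = χ l t)
    (hχ0 : ∀ l, (∀ i, n i ≠ l) → ∀ t, χ l t = 0) (M : ℕ)
    (A : Matrix (Fin m × Fin M) (Fin m × Fin M) ℂ)
    (hA : ∀ s s', A s s' = χ (n s.1) s.2 * ((∑ j ∈ range (n s'.1 + 1),
      ψ (n s.1 - j) s.2 * φ (n s'.1 - j) s'.2) -
        if n s.1 < n s'.1 then ω (n s'.1 - n s.1) s.2 s'.2 else 0) * χ (n s'.1) s'.2) :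
    (1 - A).det = (Matrix.of fun j i : Fin (h + 1) => (if (j : ℕ) = i then (1 : ℂ) else 0) -
      ∑ l ∈ range (h + 1), ∑ t ∈ range M, χ l t * restPart p φ χ j l t * ψ (l - (i : ℕ)) t).det := by
  classical
  let C : Matrix (Fin m × Fin M) (Fin (h + 1)) ℂ :=
    Matrix.of fun s j => χ (n s.1) s.2 * ψ (n s.1 - (j : ℕ)) s.2
  let Rm : Matrix (Fin (h + 1)) (Fin m × Fin M) ℂ :=
    Matrix.of fun j s => χ (n s.1) s.2 * restPart p φ χ j (n s.1) s.2
  let U : Matrix (Fin m × Fin M) (Fin m × Fin M) ℂ :=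
    Matrix.of fun s s' => χ (n s.1) s.2 *
      (if n s.1 < n s'.1 then ω (n s'.1 - n s.1) s.2 s'.2 else 0) * χ (n s'.1) s'.2
  have sum_levels : ∀ (b : ℕ) (G : ℕ → ℂ), (∀ l, (∀ i, n i ≠ l) → G l = 0) →
      ∑ l ∈ range b, G l = ∑ i : Fin m, if n i < b then G (n i) else 0 := by
    intro b G hG
    rw [← Finset.sum_filter, ← Finset.sum_image (f := G) (s := univ.filter fun i => n i < b) (g := n)
      (fun a _ c _ h => hn.injective h)]
    symm
    refine Finset.sum_subset ?_ fun l hl hl' => hG l fun i hi => hl' ?_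
    · intro l hl
      simp only [mem_image, mem_filter, mem_univ, true_and] at hl
      obtain ⟨i, hi, rfl⟩ := hl
      exact mem_range.2 hi
    · exact mem_image.2 ⟨i, by simpa [hi] using hl, hi⟩
  -- With Φ denoting the right side, A = CΦ - U, so this relation gives 1 - A = (1 - C·Rm)(1 + U).
  have hRW : Rm * (1 + U) = Matrix.of fun j s => φ (n s.1 - ((j : Fin (h + 1)) : ℕ)) s.2 * χ (n s.1) s.2 := by
    ext j s'
    rw [Matrix.mul_add, Matrix.mul_one, Matrix.add_apply, Matrix.mul_apply, Matrix.of_apply]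
    have hY := cutPart_eq (χ := χ) D j M (n s'.1) s'.2 s'.2.2
    rw [sum_levels _ _ fun l hl => Finset.sum_eq_zero fun σ _ => by rw [hχ0 l hl]; simp] at hY
    have h2 : ∑ s, Rm j s * U s s' = cutPart p φ χ j (n s'.1) s'.2 * χ (n s'.1) s'.2 := by
      rw [hY, Fintype.sum_prod_type, Finset.sum_mul]
      refine Finset.sum_congr rfl fun i _ => ?_
      split_ifs with hi
      · rw [← Fin.sum_univ_eq_sum_range
          (fun t => χ (n i) t * restPart p φ χ j (n i) t * ω (n s'.1 - n i) t s'.2), Finset.sum_mul]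
        refine Finset.sum_congr rfl fun t _ => ?_
        simp only [Rm, U, Matrix.of_apply, if_pos hi]
        linear_combination (restPart p φ χ j (n i) t * ω (n s'.1 - n i) t s'.2 * χ (n s'.1) s'.2) *
          hχ (n i) t
      · simp [U, if_neg hi]
    rw [h2]
    simp only [Rm, Matrix.of_apply, restPart]
    ring
  have hfac : 1 - A = (1 - C * Rm) * (1 + U) := by
    rw [sub_mul, one_mul, Matrix.mul_assoc, hRW]
    ext s s'
    rw [Matrix.sub_apply, Matrix.sub_apply, Matrix.add_apply, hA, Matrix.mul_apply]
    have h3 : ∑ j ∈ range (n s'.1 + 1), ψ (n s.1 - j) s.2 * φ (n s'.1 - j) s'.2 =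
        ∑ j : Fin (h + 1), ψ (n s.1 - (j : ℕ)) s.2 * φ (n s'.1 - (j : ℕ)) s'.2 := by
      rw [Fin.sum_univ_eq_sum_range (fun j : ℕ => ψ (n s.1 - j) s.2 * φ (n s'.1 - j) s'.2)]
      refine Finset.sum_subset (range_mono (by have := hh s'.1; omega)) fun j _ hj => ?_
      rw [D.phi_neg _ _ (by simp at hj; omega), mul_zero]
    have h4 : ∑ j, C s j * (Matrix.of fun j s => φ (n s.1 - ((j : Fin (h + 1)) : ℕ)) s.2 *
        χ (n s.1) s.2) j s' = χ (n s.1) s.2 * (∑ j : Fin (h + 1), ψ (n s.1 - (j : ℕ)) s.2 *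
          φ (n s'.1 - (j : ℕ)) s'.2) * χ (n s'.1) s'.2 := by
      rw [Finset.mul_sum, Finset.sum_mul]
      refine Finset.sum_congr rfl fun j _ => ?_
      simp only [C, Matrix.of_apply]
      ring
    rw [h3, h4]
    simp only [U, Matrix.of_apply]
    ring
  -- The transition part only leads to strictly higher levels, so U is strictly block triangular.
  have hdetU : (1 + U).det = 1 := by
    have hbt : (1 + U).BlockTriangular (fun s => s.1) := by
      intro s s' hs
      have h1 : ¬ n s.1 < n s'.1 := fun h => absurd (hn.lt_iff_lt.1 h) (lt_asymm hs)
      have h2 : s ≠ s' := by rintro rfl; exact lt_irrefl _ hs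
      simp [U, h1, h2]
    rw [hbt.det_fintype]
    refine Finset.prod_eq_one fun i _ => ?_
    have : (1 + U).toSquareBlock (fun s => s.1) i = 1 := by
      ext ⟨s, hs⟩ ⟨s', hs'⟩
      have h1 : s.1 = s'.1 := by rw [hs, hs']
      simp [Matrix.toSquareBlock, Matrix.toSquareBlockProp, U, h1, Matrix.one_apply]
    rw [this, Matrix.det_one]
  rw [hfac, Matrix.det_mul, hdetU, mul_one, Matrix.det_one_sub_mul_comm]
  congr 1
  ext j i
  rw [Matrix.sub_apply, Matrix.of_apply, Matrix.mul_apply, Matrix.one_apply]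
  simp only [Fin.ext_iff]
  congr 1
  rw [sum_levels _ _ fun l hl => Finset.sum_eq_zero fun t _ => by rw [hχ0 l hl]; simp,
    Fintype.sum_prod_type]
  refine Finset.sum_congr rfl fun k _ => ?_
  rw [if_pos (by have := hh k; omega), ← Fin.sum_univ_eq_sum_range
    (fun t => χ (n k) t * restPart p φ χ j (n k) t * ψ (n k - (i : ℕ)) t)]
  refine Finset.sum_congr rfl fun t _ => ?_
  simp only [Rm, C, Matrix.of_apply]
  linear_combination (restPart p φ χ j (n k) t * ψ (n k - (i : ℕ)) t) * hχ (n k) t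

/-- Factorization of the limit matrix. -/
theorem det_limit_eq (D : LevelData p φ ψ ω) (sm : ℤ → ℕ → ℂ)
    (hsm : ∀ k t, sm k t - sm k (t + 1) = p * sm (k + 1) t) (h : ℕ)
    (hsm0 : ∀ k : ℤ, k < h → sm k 0 = 0) (hψ : ∀ (k : ℤ) t, 0 ≤ k → ψ k t = sm k t) (B : ℕ → ℕ)
    (hB : ∀ l < h, B l ≤ B (l + 1))
    (hχ : ∀ l < h, ∀ t < B (l + 1), 1 - χ l t = if t < B l then 1 else 0) :
    (Matrix.of fun j i : Fin (h + 1) =>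
      ∑ t ∈ range (B h), restPart p φ χ j h t * ψ (h - (i : ℕ)) t).det =
    (Matrix.of fun i l : Fin (h + 1) => -sm ((l : ℕ) - 1 - (i : ℕ)) (B l)).det := by
  -- The boundary terms of the iterated summation by parts factor: the rest parts form a triangular
  -- matrix with diagonal p, and the ψ-side integrals form the target determinant.
  let Q : Matrix (Fin (h + 1)) (Fin (h + 1)) ℂ :=
    Matrix.of fun j l => p⁻¹ * restPart p φ χ j l (B l - 1)
  let G : Matrix (Fin (h + 1)) (Fin (h + 1)) ℂ :=
    Matrix.of fun i l : Fin (h + 1) => -sm ((l : ℕ) - 1 - (i : ℕ)) (B l)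
  have hfac : (Matrix.of fun j i : Fin (h + 1) =>
      ∑ t ∈ range (B h), restPart p φ χ j h t * ψ (h - (i : ℕ)) t) = Q * G.transpose := by
    ext j i
    have h1 := sum_restPart_mul D sm hsm h i hsm0 B hB hχ j h le_rfl
    rw [Matrix.of_apply, Matrix.mul_apply]
    have h2 : ∑ t ∈ range (B h), restPart p φ χ j h t * ψ (h - (i : ℕ)) t =
        ∑ t ∈ range (B h), restPart p φ χ j h t * sm (h - (i : ℕ)) t :=
      Finset.sum_congr rfl fun t _ => by rw [hψ _ _ (by omega)]
    rw [h2]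
    refine mul_left_cancel₀ D.ne_zero ?_
    rw [h1, ← Fin.sum_univ_eq_sum_range
      (fun k : ℕ => restPart p φ χ j k (B k - 1) * sm (k - 1 - (i : ℕ)) (B k)), Finset.mul_sum,
      ← Finset.sum_neg_distrib]
    refine Finset.sum_congr rfl fun k _ => ?_
    simp only [Q, G, Matrix.of_apply, Matrix.transpose_apply]
    have := D.ne_zero
    field_simp
  have hQ : Q.det = 1 := by
    rw [Matrix.det_of_isUpperTriangular (M := Q) fun j l hjl => ?_]
    · refine Finset.prod_eq_one fun l _ => ?_
      simp [Q, restPart_self D, D.ne_zero]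
    · have : (l : ℕ) < j := hjl
      simp [Q, restPart_of_lt D this]
  rw [hfac, Matrix.det_mul, hQ, one_mul, Matrix.det_transpose]

end LevelAlgebra

/-! ### Application to the cut-off kernel. -/

section CutKernel

open Finset Filter Topology

variable {p : ℝ}

theorem stepKer_succ_eq_sum {R : ℝ} (hp0 : 0 < p) (hp1 : p < 1) (hR1 : 1 < R)
    (hR : R < 1 / (1 - p)) (x : ℤ) (d s t : ℕ) :
    stepKer p R ((d + 1 : ℕ) : ℤ) (x + s) (x + t) =
      p * ∑ σ ∈ range (t + 1), stepKer p R d (x + s) (x + σ) := by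
  have hd := fun y => stepKer_diff hp1 hR1 hR ((d + 1 : ℕ) : ℤ) (x + s) y
  have hd1 : ((d + 1 : ℕ) : ℤ) - 1 = d := by push_cast; ring
  induction t with
  | zero =>
    have h1 := hd (x - 1)
    rw [hd1, sub_add_cancel, stepKer_of_lt hp0 hp1 hR1 hR (d + 1) (s := x + s) (t := x - 1) (by omega),
      sub_zero] at h1
    simpa using h1
  | succ t ih =>
    have h1 := hd (x + t)
    rw [hd1, ih] at h1
    rw [sum_range_succ, show x + ((t + 1 : ℕ) : ℤ) = x + t + 1 by push_cast; ring]
    linear_combination h1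

theorem levelData_kernel {r R : ℝ} (hp0 : 0 < p) (hp1 : p < 1) (hr0 : 0 < r) (hr1 : r < 1)
    (hR1 : 1 < R) (hR : R < 1 / (1 - p)) (L x : ℤ) :
    LevelData (p : ℂ) (fun k t => phiFun p r L k (x + t)) (fun k t => wtInt p 1 R L k (x + t))
      (fun d s t => stepKer p R d (x + s) (x + t)) where
  ne_zero := by exact_mod_cast hp0.ne'
  phi_diff k t := by
    have := phiFun_diff hp0 hp1 hr0 hr1 L k (x + t)
    rwa [add_assoc] at this
  phi_neg k t hk := phiFun_neg hp0 hp1 hr0 hr1 hk L _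
  phi_zero t := phiFun_zero hp0 hp1 hr0 hr1 L _
  psi_diff k t := by
    have := wtInt_diff (by linarith) (regPt_big hp1 hR1 hR) L k (x + t)
    rwa [add_assoc] at this
  omega_zero s t := by
    split_ifs with h
    · subst h; exact stepKer_zero_self hp0 hp1 hR1 hR _
    · exact stepKer_zero_of_ne hp0 hp1 hR1 hR (by omega)
  omega_succ d s t := stepKer_succ_eq_sum hp0 hp1 hR1 hR x d s t

theorem geomBdd_of_eventually {lam C : ℝ} (hlam : 0 < lam) {g : ℕ → ℂ} (T : ℕ)
    (h : ∀ t, T ≤ t → ‖g t‖ ≤ C * lam ^ t) : GeomBdd lam g := by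
  refine ⟨|C| + ∑ t ∈ range T, ‖g t‖ / lam ^ t, fun t => ?_⟩
  have hs : 0 ≤ ∑ t ∈ range T, ‖g t‖ / lam ^ t := Finset.sum_nonneg fun _ _ => by positivity
  rcases le_or_gt T t with ht | ht
  · refine (h t ht).trans (mul_le_mul_of_nonneg_right ?_ (by positivity))
    linarith [le_abs_self C]
  · have h1 : ‖g t‖ / lam ^ t ≤ ∑ t ∈ range T, ‖g t‖ / lam ^ t :=
      Finset.single_le_sum (f := fun t => ‖g t‖ / lam ^ t) (fun _ _ => by positivity) (mem_range.2 ht)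
    rw [← div_le_iff₀ (by positivity)]
    linarith [abs_nonneg C]

theorem geomBdd_psi {R : ℝ} (hp0 : 0 < p) (hp1 : p < 1) (hR1 : 1 < R) (L x k : ℤ) :
    GeomBdd (1 - p / 2) fun t => wtInt p 1 R L k (x + t) := by
  obtain ⟨C, hC⟩ := exists_norm_wtInt_big_le hp0 hp1 hR1 L k
  have hlam : (0 : ℝ) < 1 - p / 2 := by linarith
  refine geomBdd_of_eventually (C := C * (1 - p / 2) ^ x) hlam (-x).toNat fun t ht => ?_
  have h1 := hC (x + t).toNat
  have h2 : (((x + t).toNat : ℕ) : ℤ) = x + t := by omega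
  rw [h2] at h1
  refine h1.trans_eq ?_
  rw [← zpow_natCast, h2, zpow_add₀ hlam.ne', zpow_natCast, mul_assoc]

theorem exists_pow_mul_lt_one {lam : ℝ} (hlam : lam < 1) (k : ℕ) :
    ∃ ζ : ℝ, 1 < ζ ∧ ζ ^ k * lam < 1 := by
  have h1 : Tendsto (fun z : ℝ => z ^ k * lam) (𝓝[>] 1) (𝓝 (1 ^ k * lam)) :=
    ((continuous_pow k).mul continuous_const).continuousAt.tendsto.mono_left nhdsWithin_le_nhds
  rw [one_pow, one_mul] at h1
  obtain ⟨z, hz, hz'⟩ := ((h1.eventually_lt_const hlam).and self_mem_nhdsWithin).exists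
  exact ⟨z, hz', hz⟩

/-- `LevelTime` with time counted from `x`. -/
def levelTimeEquiv (m : ℕ) (x : ℤ) : Fin m × ℕ ≃ LevelTime m x where
  toFun s := (s.1, ⟨x + s.2, by omega⟩)
  invFun s := (s.1, (s.2.1 - x).toNat)
  left_inv s := by ext <;> simp
  right_inv s := by
    obtain ⟨i, t, ht⟩ := s
    simp only [Prod.mk.injEq, Subtype.mk.injEq, true_and]
    omega

/-- The indicator of the cut-off, by level and time. -/
def levelCut {m N : ℕ} (x : ℤ) (n : Fin m → Fin N) (a : Fin m → ℝ) (l t : ℕ) : ℂ :=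
  open Classical in if ∃ i, (n i : ℕ) = l ∧ a i < ((x + t : ℤ) : ℝ) then 1 else 0

theorem levelCut_apply {m N : ℕ} (x : ℤ) {n : Fin m → Fin N} (hn : StrictMono n) (a : Fin m → ℝ)
    (s : Fin m × ℕ) : levelCut x n a (n s.1) s.2 = cutoff a (levelTimeEquiv m x s) := by
  unfold levelCut cutoff
  refine if_congr ?_ rfl rfl
  constructor
  · rintro ⟨i, hi, h⟩
    rw [hn.injective (Fin.ext hi)] at h
    exact h
  · exact fun h => ⟨s.1, rfl, h⟩

theorem levelCut_mul_self {m N : ℕ} (x : ℤ) (n : Fin m → Fin N) (a : Fin m → ℝ) (l t : ℕ) :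
    levelCut x n a l t * levelCut x n a l t = levelCut x n a l t := by
  unfold levelCut; split_ifs <;> simp

theorem norm_levelCut_le {m N : ℕ} (x : ℤ) (n : Fin m → Fin N) (a : Fin m → ℝ) (l t : ℕ) :
    ‖levelCut x n a l t‖ ≤ 1 := by
  unfold levelCut; split_ifs <;> simp

theorem norm_cutoff_le {m : ℕ} {x : ℤ} (a : Fin m → ℝ) (s : LevelTime m x) : ‖cutoff a s‖ ≤ 1 := by
  unfold cutoff; split_ifs <;> simp

theorem norm_cutKernel_le {N m : ℕ} {x : ℤ} {r R : ℝ} (n : Fin m → Fin N) (a : Fin m → ℝ)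
    (s s' : LevelTime m x) : ‖cutKernel p N x r R n a s s'‖ ≤
      ‖corrKernel p N x r R ((n s.1 : ℕ) + 1) s.2.1 ((n s'.1 : ℕ) + 1) s'.2.1‖ := by
  unfold cutKernel
  rw [norm_mul, norm_mul]
  exact (mul_le_of_le_one_right (by positivity) (norm_cutoff_le a s')).trans
    (mul_le_of_le_one_left (norm_nonneg _) (norm_cutoff_le a s))

/-- Geometric bounds for the blocks of the kernel. -/
theorem exists_norm_corrKernel_le {r R : ℝ} (hp0 : 0 < p) (hp1 : p < 1) (hr0 : 0 < r) (hr1 : r < 1)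
    (hR1 : 1 < R) (hR : R < 1 / (1 - p)) (N : ℕ) (x : ℤ) (n₁ n₂ : ℕ) {κ η : ℝ} (hκ : 1 < κ)
    (hη : 1 < η) : ∃ C : ℝ, 0 ≤ C ∧ ∀ t t' : ℕ,
      ‖corrKernel p N x r R (n₁ + 1) (x + t) (n₂ + 1) (x + t')‖ ≤
        C * ((1 - p / 2) ^ t * κ ^ t' + if n₁ < n₂ then η⁻¹ ^ t * η ^ t' else 0) := by
  have D := levelData_kernel hp0 hp1 hr0 hr1 hR1 hR (x + N) x
  have hlam : (0 : ℝ) < 1 - p / 2 := by linarith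
  choose C₁ hC₁ using fun k => geomBdd_psi hp0 hp1 hR1 (x + N) x k
  choose C₂ hC₂ using fun k => D.geomBdd_phi hκ k
  obtain ⟨C₃, hC₃⟩ := D.norm_omega_le hη (n₂ - n₁)
  have hC₁0 : ∀ k, 0 ≤ C₁ k := fun k => by simpa using (norm_nonneg _).trans (hC₁ k 0)
  have hC₂0 : ∀ k, 0 ≤ C₂ k := fun k => by simpa using (norm_nonneg _).trans (hC₂ k 0)
  have hC₃0 : 0 ≤ C₃ := by simpa using (norm_nonneg _).trans (hC₃ 0 0)
  have hS : 0 ≤ ∑ j ∈ range (n₂ + 1), C₁ (n₁ - j) * C₂ (n₂ - j) :=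
    Finset.sum_nonneg fun j _ => mul_nonneg (hC₁0 _) (hC₂0 _)
  refine ⟨(∑ j ∈ range (n₂ + 1), C₁ (n₁ - j) * C₂ (n₂ - j)) + C₃, by positivity, fun t t' => ?_⟩
  rw [corrKernel_eq hp0 hp1 hr0 hr1 hR1 hR]
  refine (norm_sub_le _ _).trans ?_
  have h1 : ‖∑ j ∈ range (n₂ + 1), wtInt p 1 R (x + N) (n₁ - j) (x + t) *
      phiFun p r (x + N) (n₂ - j) (x + t')‖ ≤
      (∑ j ∈ range (n₂ + 1), C₁ (n₁ - j) * C₂ (n₂ - j)) * ((1 - p / 2) ^ t * κ ^ t') := by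
    rw [Finset.sum_mul]
    refine norm_sum_le_of_le _ fun j _ => ?_
    rw [norm_mul]
    calc _ ≤ (C₁ (n₁ - j) * (1 - p / 2) ^ t) * (C₂ (n₂ - j) * κ ^ t') :=
          mul_le_mul (hC₁ _ t) (hC₂ _ t') (norm_nonneg _) (mul_nonneg (hC₁0 _) (by positivity))
      _ = _ := by ring
  have h2 : ‖if n₁ < n₂ then stepKer p R (n₂ - n₁) (x + t) (x + t') else 0‖ ≤
      C₃ * if n₁ < n₂ then η⁻¹ ^ t * η ^ t' else 0 := by
    split_ifs with h
    · have := hC₃ t t'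
      rwa [Nat.cast_sub h.le] at this
    · simp
  have h3 : 0 ≤ (1 - p / 2) ^ t * κ ^ t' := by positivity
  have h4 : 0 ≤ if n₁ < n₂ then η⁻¹ ^ t * η ^ t' else 0 := by
    split_ifs
    · positivity
    · exact le_rfl
  nlinarith

/-- After conjugation with a diagonal matrix the kernel has absolutely summable entries. -/
theorem exists_summable_conj {r R : ℝ} (hp0 : 0 < p) (hp1 : p < 1) (hr0 : 0 < r) (hr1 : r < 1)
    (hR1 : 1 < R) (hR : R < 1 / (1 - p)) (N : ℕ) (x : ℤ) {m : ℕ} {n : Fin m → Fin N}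
    (hn : StrictMono n) (a : Fin m → ℝ) :
    ∃ ρ : LevelTime m x → ℝ, (∀ s, 0 < ρ s) ∧ Summable fun q : LevelTime m x × LevelTime m x =>
      ‖(ρ q.1 : ℂ) * cutKernel p N x r R n a q.1 q.2 * (ρ q.2 : ℂ)⁻¹‖ := by
  have hlam : (0 : ℝ) < 1 - p / 2 := by linarith
  -- The weights go up to ζ^(2m) per unit of time. The exponent 2m + 1 leaves one spare factor ζ of
  -- decay against (1 - p/2)^t.
  obtain ⟨ζ, hζ, hζ'⟩ := exists_pow_mul_lt_one (show 1 - p / 2 < 1 by linarith) (2 * m + 1)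
  have hζ0 : 0 < ζ := by linarith
  let e := levelTimeEquiv m x
  -- The weight rate increases with the level. The transition term occurs only for i < i', and its
  -- free rate is taken to be ζ^(2i+3), strictly between ζ^(2i+2) and ζ^(2i'+2); after conjugation
  -- it decays in both times.
  let ρ : LevelTime m x → ℝ := fun s => (ζ ^ (2 * (s.1 : ℕ) + 2)) ^ (e.symm s).2
  refine ⟨ρ, fun s => by positivity, ?_⟩
  choose C hC0 hC using fun q : Fin m × Fin m =>
    exists_norm_corrKernel_le hp0 hp1 hr0 hr1 hR1 hR N x (n q.1) (n q.2) hζ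
      (one_lt_pow₀ hζ (show 2 * (q.1 : ℕ) + 3 ≠ 0 by omega))
  let K : ℝ := ∑ q, C q
  have hCK : ∀ q, C q ≤ K := fun q => Finset.single_le_sum (fun q _ => hC0 q) (mem_univ q)
  have hz1 : ζ⁻¹ < 1 := inv_lt_one_of_one_lt₀ hζ
  have hz0 : 0 < ζ⁻¹ := by positivity
  have hsum1 : Summable fun s : Fin m × ℕ => ζ⁻¹ ^ s.2 := by
    rw [summable_prod_of_nonneg fun s => by positivity]
    exact ⟨fun _ => summable_geometric_of_lt_one hz0.le hz1, (hasSum_fintype _).summable⟩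
  have hsum2 : Summable fun q : (Fin m × ℕ) × (Fin m × ℕ) => 2 * K * (ζ⁻¹ ^ q.1.2 * ζ⁻¹ ^ q.2.2) :=
    (hsum1.mul_of_nonneg hsum1 (fun _ => by positivity) (fun _ => by positivity)).mul_left _
  rw [← (e.prodCongr e).summable_iff]
  refine hsum2.of_nonneg_of_le (fun q => norm_nonneg _) ?_
  rintro ⟨⟨i, t⟩, ⟨i', t'⟩⟩
  have hρ : ∀ s : Fin m × ℕ, ρ (e s) = (ζ ^ (2 * (s.1 : ℕ) + 2)) ^ s.2 := fun s => by
    simp only [ρ, Equiv.symm_apply_apply]; rfl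
  simp only [Function.comp, Equiv.prodCongr_apply, Prod.map]
  rw [hρ, hρ, norm_mul, norm_mul, norm_inv, Complex.norm_real, Complex.norm_real,
    Real.norm_of_nonneg (by positivity), Real.norm_of_nonneg (by positivity)]
  have hk : ‖cutKernel p N x r R n a (e (i, t)) (e (i', t'))‖ ≤ K * ((1 - p / 2) ^ t * ζ ^ t' +
      if (n i : ℕ) < n i' then (ζ ^ (2 * (i : ℕ) + 3))⁻¹ ^ t * (ζ ^ (2 * (i : ℕ) + 3)) ^ t' else 0) := by
    refine (norm_cutKernel_le n a _ _).trans ((hC (i, i') t t').trans ?_)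
    refine mul_le_mul_of_nonneg_right (hCK _) ?_
    have h3 : 0 ≤ (1 - p / 2) ^ t * ζ ^ t' := by positivity
    split_ifs
    · positivity
    · simpa using h3
  have hb1 : (ζ ^ (2 * (i : ℕ) + 2)) ^ t * (1 - p / 2) ^ t ≤ ζ⁻¹ ^ t := by
    rw [← mul_pow]
    refine pow_le_pow_left₀ (by positivity) ?_ t
    rw [inv_eq_one_div, le_div_iff₀ hζ0]
    calc ζ ^ (2 * (i : ℕ) + 2) * (1 - p / 2) * ζ = ζ ^ (2 * (i : ℕ) + 3) * (1 - p / 2) := by ring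
      _ ≤ ζ ^ (2 * m + 1) * (1 - p / 2) := by
        have := i.2
        exact mul_le_mul_of_nonneg_right (pow_le_pow_right₀ hζ.le (by omega)) hlam.le
      _ ≤ 1 := hζ'.le
  have hb2 : ζ ^ t' * ((ζ ^ (2 * (i' : ℕ) + 2)) ^ t')⁻¹ ≤ ζ⁻¹ ^ t' := by
    rw [← inv_pow, ← mul_pow]
    refine pow_le_pow_left₀ (by positivity) ?_ t'
    rw [← div_eq_mul_inv, inv_eq_one_div, div_le_div_iff₀ (by positivity) hζ0]
    calc ζ * ζ = ζ ^ 2 := by ring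
      _ ≤ ζ ^ (2 * (i' : ℕ) + 2) := pow_le_pow_right₀ hζ.le (by omega)
      _ = _ := by ring
  have hb3 : (ζ ^ (2 * (i : ℕ) + 2)) ^ t * (ζ ^ (2 * (i : ℕ) + 3))⁻¹ ^ t ≤ ζ⁻¹ ^ t := by
    rw [← mul_pow]
    refine pow_le_pow_left₀ (by positivity) (le_of_eq ?_) t
    rw [pow_succ ζ (2 * (i : ℕ) + 2)]
    field_simp
  have hb4 : (n i : ℕ) < n i' →
      (ζ ^ (2 * (i : ℕ) + 3)) ^ t' * ((ζ ^ (2 * (i' : ℕ) + 2)) ^ t')⁻¹ ≤ ζ⁻¹ ^ t' := by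
    intro hlt
    have : (i : ℕ) < i' := hn.lt_iff_lt.1 hlt
    rw [← inv_pow, ← mul_pow]
    refine pow_le_pow_left₀ (by positivity) ?_ t'
    rw [← div_eq_mul_inv, inv_eq_one_div, div_le_div_iff₀ (by positivity) hζ0, one_mul, ← pow_succ]
    exact pow_le_pow_right₀ hζ.le (by omega)
  have hK : 0 ≤ K := Finset.sum_nonneg fun q _ => hC0 q
  calc _ ≤ (ζ ^ (2 * (i : ℕ) + 2)) ^ t * (K * ((1 - p / 2) ^ t * ζ ^ t' +
          if (n i : ℕ) < n i' then (ζ ^ (2 * (i : ℕ) + 3))⁻¹ ^ t * (ζ ^ (2 * (i : ℕ) + 3)) ^ t' else 0)) *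
        ((ζ ^ (2 * (i' : ℕ) + 2)) ^ t')⁻¹ := by gcongr
    _ = K * (((ζ ^ (2 * (i : ℕ) + 2)) ^ t * (1 - p / 2) ^ t) *
          (ζ ^ t' * ((ζ ^ (2 * (i' : ℕ) + 2)) ^ t')⁻¹) +
        if (n i : ℕ) < n i' then ((ζ ^ (2 * (i : ℕ) + 2)) ^ t * (ζ ^ (2 * (i : ℕ) + 3))⁻¹ ^ t) *
          ((ζ ^ (2 * (i : ℕ) + 3)) ^ t' * ((ζ ^ (2 * (i' : ℕ) + 2)) ^ t')⁻¹) else 0) := by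
      split_ifs <;> ring
    _ ≤ K * (ζ⁻¹ ^ t * ζ⁻¹ ^ t' + ζ⁻¹ ^ t * ζ⁻¹ ^ t') := by
      refine mul_le_mul_of_nonneg_left (add_le_add
        (mul_le_mul hb1 hb2 (by positivity) (by positivity)) ?_) hK
      split_ifs with h
      · exact mul_le_mul hb3 (hb4 h) (by positivity) (by positivity)
      · positivity
    _ = _ := by ring

theorem cutKernel_traceClass_and_summable {r R : ℝ} (hp0 : 0 < p) (hp1 : p < 1) (hr0 : 0 < r)
    (hr1 : r < 1) (hR1 : 1 < R) (hR : R < 1 / (1 - p)) (N : ℕ) (x : ℤ) {m : ℕ} {n : Fin m → Fin N}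
    (hn : StrictMono n) (a : Fin m → ℝ) :
    TraceClassUpToConjugation (cutKernel p N x r R n a) ∧
      FredholmSummable (cutKernel p N x r R n a) := by
  obtain ⟨ρ, hρ, hs⟩ := exists_summable_conj hp0 hp1 hr0 hr1 hR1 hR N x hn a
  refine ⟨⟨ρ, hρ, traceClass_of_summable hs⟩, ?_⟩
  exact fredholmSummable_of_conj (ρ := fun s => (ρ s : ℂ))
    (fun s => by exact_mod_cast (hρ s).ne') (fredholmSummable_of_summable hs)

/-- The partial sums telescope: the boundary term at time x is the Kronecker delta, and the one at
infinity vanishes because growth κ^t loses to decay (1 - p/2)^t. -/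
theorem tendsto_gram {r R : ℝ} (hp0 : 0 < p) (hp1 : p < 1) (hr0 : 0 < r) (hr1 : r < 1)
    (hR1 : 1 < R) (hR : R < 1 / (1 - p)) {L x : ℤ} (k l : ℕ) (hl : x + l + 1 ≤ L) :
    Tendsto (fun M : ℕ => ∑ t ∈ range M, phiFun p r L k (x + t) * wtInt p 1 R L l (x + t)) atTop
      (𝓝 (if k = l then 1 else 0)) := by
  have D := levelData_kernel hp0 hp1 hr0 hr1 hR1 hR L x
  have hlam : (0 : ℝ) < 1 - p / 2 := by linarith
  obtain ⟨κ, hκ, hκ'⟩ := exists_pow_mul_lt_one (show 1 - p / 2 < 1 by linarith) 1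
  rw [pow_one] at hκ'
  have h1 : ∀ M : ℕ, ∑ t ∈ range M, phiFun p r L k (x + t) * wtInt p 1 R L l (x + t) =
      gramBdry p r R L k l x - gramBdry p r R L k l (x + M) := by
    intro M
    have h2 : ∀ t ∈ range M, phiFun p r L k (x + t) * wtInt p 1 R L l (x + t) =
        (fun t : ℕ => gramBdry p r R L k l (x + t)) t -
        (fun t : ℕ => gramBdry p r R L k l (x + t)) (t + 1) := by
      intro t _
      rw [← gramBdry_sub hp0 hp1 hr0 hr1 hR1 hR]
      simp only [Nat.cast_add, Nat.cast_one, add_assoc]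
    rw [Finset.sum_congr rfl h2, Finset.sum_range_sub']
    simp
  simp_rw [h1]
  rw [← gramBdry_start hp0 hp1 hr0 hr1 hR1 hR k l hl]
  have hpc : (p : ℂ) ≠ 0 := by exact_mod_cast hp0.ne'
  have h2 : Tendsto (fun M : ℕ => gramBdry p r R L k l (x + M)) atTop (𝓝 0) := by
    unfold gramBdry
    rw [show (0 : ℂ) = ∑ j ∈ range (k + 1), 0 by simp]
    refine tendsto_finsetSum _ fun j _ => ?_
    have hφ : GeomBdd κ fun t : ℕ => wtInt p 1 r (-L) (j - k - 1) (-(x + t)) := by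
      -- The origin x - 1 compensates the extra -1 in the time exponent of `phiFun`.
      have h3 := (levelData_kernel hp0 hp1 hr0 hr1 hR1 hR L (x - 1)).geomBdd_phi hκ (k - j)
      have h4 := h3.const_mul (p : ℂ)⁻¹
      convert h4 using 2 with t
      rw [phiFun, ← mul_assoc, inv_mul_cancel₀ hpc, one_mul]
      congr 1 <;> ring
    exact tendsto_zero_of_geomBdd (by linarith) hlam hκ' hφ (geomBdd_psi hp0 hp1 hR1 L x _)
  simpa using tendsto_const_nhds.sub h2

/-- The part of the index set with the first `M` times. -/
def levelTimeSection (m : ℕ) (x : ℤ) (M : ℕ) : Finset (LevelTime m x) :=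
  (univ ×ˢ range M).map (levelTimeEquiv m x).toEmbedding

theorem mem_levelTimeSection {m : ℕ} {x : ℤ} {M : ℕ} {s : LevelTime m x} :
    s ∈ levelTimeSection m x M ↔ ((levelTimeEquiv m x).symm s).2 < M := by
  rw [levelTimeSection, Finset.mem_map_equiv]; simp

/-- Enumeration of `levelTimeSection`. -/
def levelTimeSectionEquiv (m : ℕ) (x : ℤ) (M : ℕ) : Fin m × Fin M ≃ levelTimeSection m x M where
  toFun s := ⟨levelTimeEquiv m x (s.1, s.2), mem_levelTimeSection.2 (by simp)⟩
  invFun s := (((levelTimeEquiv m x).symm s.1).1, ⟨((levelTimeEquiv m x).symm s.1).2,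
    mem_levelTimeSection.1 s.2⟩)
  left_inv s := by simp
  right_inv s := Subtype.ext ((levelTimeEquiv m x).apply_symm_apply s.1)

theorem det_section_cutKernel {r R : ℝ} (hp0 : 0 < p) (hp1 : p < 1) (hr0 : 0 < r) (hr1 : r < 1)
    (hR1 : 1 < R) (hR : R < 1 / (1 - p)) (N : ℕ) (x : ℤ) {m : ℕ} {n : Fin m → Fin N}
    (hn : StrictMono n) (a : Fin m → ℝ) {h : ℕ} (hh : ∀ i, (n i : ℕ) ≤ h) (M : ℕ) :
    (1 - Matrix.of fun s s' : levelTimeSection m x M => cutKernel p N x r R n a s s').det =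
      (Matrix.of fun j i : Fin (h + 1) => (if (j : ℕ) = i then (1 : ℂ) else 0) -
        ∑ l ∈ range (h + 1), ∑ t ∈ range M, levelCut x n a l t *
          restPart p (fun k t => phiFun p r (x + N) k (x + t)) (levelCut x n a) j l t *
          wtInt p 1 R (x + N) (l - (i : ℕ)) (x + t)).det := by
  have D := levelData_kernel hp0 hp1 hr0 hr1 hR1 hR (x + N) x
  rw [← Matrix.det_submatrix_equiv_self (levelTimeSectionEquiv m x M), Matrix.submatrix_sub,
    Pi.sub_apply, Pi.sub_apply, Matrix.submatrix_one_equiv]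
  have hmain := det_section_eq D (n := fun i => (n i : ℕ)) (fun i j hij => hn hij) hh
    (levelCut_mul_self x n a) (fun l hl t => if_neg fun ⟨i, hi, _⟩ => hl i hi) M
    ((Matrix.of fun s s' : levelTimeSection m x M => cutKernel p N x r R n a s s').submatrix
      (levelTimeSectionEquiv m x M) (levelTimeSectionEquiv m x M)) fun s s' => ?_
  · rw [← hmain]
  · have h1 : ((Matrix.of fun s s' : levelTimeSection m x M => cutKernel p N x r R n a s s').submatrix
        (levelTimeSectionEquiv m x M) (levelTimeSectionEquiv m x M)) s s' =
        cutoff a (levelTimeEquiv m x (s.1, s.2)) *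
          corrKernel p N x r R ((n s.1 : ℕ) + 1) (x + s.2) ((n s'.1 : ℕ) + 1) (x + s'.2) *
          cutoff a (levelTimeEquiv m x (s'.1, s'.2)) := rfl
    rw [h1, ← levelCut_apply x hn a (s.1, s.2), ← levelCut_apply x hn a (s'.1, s'.2),
      corrKernel_eq hp0 hp1 hr0 hr1 hR1 hR N x]
    congr 3
    refine ite_congr rfl (fun hlt => ?_) fun _ => rfl
    rw [Nat.cast_sub hlt.le]

/-- The Fredholm determinant as a determinant of the size of the highest level. -/
theorem fredholmDet_cutKernel_eq {r R : ℝ} (hp0 : 0 < p) (hp1 : p < 1) (hr0 : 0 < r) (hr1 : r < 1)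
    (hR1 : 1 < R) (hR : R < 1 / (1 - p)) (N : ℕ) (x : ℤ) {m : ℕ} {n : Fin m → Fin N}
    (hn : StrictMono n) (a : Fin m → ℝ) {h : ℕ} (hhN : h < N) (hh : ∀ i, (n i : ℕ) ≤ h) (B : ℕ → ℕ)
    (hB : ∀ l < h, B l ≤ B (l + 1))
    (hχ : ∀ l < h, ∀ t < B (l + 1), 1 - levelCut x n a l t = if t < B l then 1 else 0)
    (hχh : ∀ t, 1 - levelCut x n a h t = if t < B h then 1 else 0) :
    fredholmDet (cutKernel p N x r R n a) = (Matrix.of fun i l : Fin (h + 1) =>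
      -wtInt p 0 (p / 2) (x + N) ((l : ℕ) - 1 - (i : ℕ)) (x + B l)).det := by
  have D := levelData_kernel hp0 hp1 hr0 hr1 hR1 hR (x + N) x
  have hlam : (0 : ℝ) < 1 - p / 2 := by linarith
  obtain ⟨κ, hκ, hκ'⟩ := exists_pow_mul_lt_one (show 1 - p / 2 < 1 by linarith) 1
  rw [pow_one] at hκ'
  have hdet := det_limit_eq (χ := levelCut x n a) D
    (fun k t => wtInt p 0 (p / 2) (x + N) k (x + t))
    (fun k t => by
      have := wtInt_diff (by linarith) (regPt_small hp0 hp1) (x + N) k (x + t)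
      rwa [add_assoc] at this) h
    -- At time x the exponent of w is N - 2 - k, nonnegative because k < h < N.
    (fun k hk => wtInt_small_eq_zero hp0 hp1 (by push_cast; omega))
    (fun k t hk => wtInt_big_eq_small hp0 hp1 hR1 hR _ hk _) B hB hχ
  rw [← hdet]
  have hlim := tendsto_det_one_sub
    (cutKernel_traceClass_and_summable hp0 hp1 hr0 hr1 hR1 hR N x hn a).2 (levelTimeSection m x)
    (fun M M' hM s hs => mem_levelTimeSection.2 ((mem_levelTimeSection.1 hs).trans_le hM))
    fun s => ⟨_, mem_levelTimeSection.2 (Nat.lt_succ_self _)⟩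
  refine tendsto_nhds_unique hlim ?_
  refine Tendsto.congr (fun M =>
    (det_section_cutKernel hp0 hp1 hr0 hr1 hR1 hR N x hn a hh M).symm) ?_
  refine ((Continuous.matrix_det continuous_id).tendsto _).comp ?_
  refine tendsto_pi_nhds.2 fun j => tendsto_pi_nhds.2 fun i => ?_
  refine tendsto_section_entry D hκ hlam hκ' (geomBdd_psi hp0 hp1 hR1 (x + N) x)
    (norm_levelCut_le x n a) hχh ?_
  have := tendsto_gram hp0 hp1 hr0 hr1 hR1 hR (L := x + N) (x := x) (h - j) (h - i) (by omega)
  have hji : (h - (j : ℕ) = h - i) = ((j : ℕ) = i) := by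
    have := j.2; have := i.2; apply propext; omega
  simp only [hji] at this
  rw [Nat.cast_sub (by omega), Nat.cast_sub (by omega)] at this
  exact this

end CutKernel

/-! ### The exit determinant and its backward equation. -/

section ExitDeterminant

open Finset

/-- The particles with index at most `h`. -/
abbrev Lead (N h : ℕ) : Type := {i : Fin N // (i : ℕ) ≤ h}

/-- The entries of the determinantal formula for the exit times. -/
def rowEnt (p : ℝ) (L τ : ℕ) (k : ℤ) : ℂ := -wtInt p 0 (p / 2) L k τ

variable {p : ℝ}

theorem rowEnt_time (hp0 : 0 < p) (hp1 : p < 1) (L τ : ℕ) (k : ℤ) :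
    rowEnt p (L + 1) (τ + 1) k = (1 - p) * rowEnt p (L + 1) τ k + p * rowEnt p L τ k := by
  have := wtInt_time (by linarith) (regPt_small hp0 hp1) ((L + 1 : ℕ) : ℤ) k τ
  unfold rowEnt
  rw [show ((L + 1 : ℕ) : ℤ) - 1 = L by push_cast; ring] at this
  rw [show ((τ + 1 : ℕ) : ℤ) = τ + 1 by push_cast; ring, this]
  ring

theorem rowEnt_space (hp0 : 0 < p) (hp1 : p < 1) (L τ : ℕ) (k : ℤ) :
    rowEnt p L τ k = rowEnt p (L + 1) τ k - rowEnt p (L + 1) τ (k + 1) := by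
  have := wtInt_space (by linarith) (regPt_small hp0 hp1) ((L + 1 : ℕ) : ℤ) k τ
  unfold rowEnt
  rw [show ((L + 1 : ℕ) : ℤ) - 1 = L by push_cast; ring] at this
  rw [this]
  ring

theorem rowEnt_zero_neg_one (hp0 : 0 < p) (hp1 : p < 1) (τ : ℕ) : rowEnt p 0 τ (-1) = 1 := by
  have := wtInt_small_zero_neg_one hp0 hp1 τ
  simp [rowEnt, this]

theorem rowEnt_zero_of_nonneg (hp0 : 0 < p) (hp1 : p < 1) (τ : ℕ) {k : ℤ} (hk : 0 ≤ k) :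
    rowEnt p 0 τ k = 0 := by
  lift k to ℕ using hk
  have := wtInt_small_zero_of_nonneg hp0 hp1 k τ
  simp [rowEnt, this]

theorem rowEnt_time_zero (hp0 : 0 < p) (hp1 : p < 1) {L : ℕ} {k : ℤ} (h : 0 ≤ (L : ℤ) - 2 - k) :
    rowEnt p L 0 k = 0 := by
  rw [rowEnt, wtInt_small_eq_zero hp0 hp1 (by push_cast; omega), neg_zero]

variable {N h : ℕ}

/-- The matrix of the determinantal formula, with the rows in `S` replaced by unit vectors. -/
def exitMat (p : ℝ) (S : Finset (Lead N h)) (Lv τ : Lead N h → ℕ) :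
    Matrix (Lead N h) (Lead N h) ℂ :=
  Matrix.of fun i j => if i ∈ S then (if i = j then 1 else 0) else
    rowEnt p (Lv i) (τ j) (((j.1 : ℕ) : ℤ) - 1 - ((i.1 : ℕ) : ℤ))

/-- The rows of finished particles may be replaced by unit vectors. -/
theorem det_exitMat_eq (hp0 : 0 < p) (hp1 : p < 1) {S : Finset (Lead N h)}
    (hS : ∀ i ∈ S, ∀ j ≤ i, j ∈ S) {Lv : Lead N h → ℕ} (hLv : ∀ i ∈ S, Lv i = 0) (τ : Lead N h → ℕ) :
    (exitMat p ∅ Lv τ).det = (exitMat p S Lv τ).det := by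
  -- A row with no jump left vanishes to the right of the diagonal and is 1 on it. Such rows form
  -- the unit triangular factor P.
  let P : Matrix (Lead N h) (Lead N h) ℂ := Matrix.of fun i j =>
    if i ∈ S then exitMat p ∅ Lv τ i j else if i = j then 1 else 0
  have hrow : ∀ i ∈ S, ∀ j, i < j → exitMat p ∅ Lv τ i j = 0 := by
    intro i hi j hij
    have : ((i.1 : ℕ) : ℤ) < (j.1 : ℕ) := by exact_mod_cast (show (i.1 : ℕ) < j.1 from hij)
    simp only [exitMat, Matrix.of_apply, notMem_empty, if_false, hLv i hi]
    exact rowEnt_zero_of_nonneg hp0 hp1 _ (by omega)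
  have hfac : exitMat p ∅ Lv τ = P * exitMat p S Lv τ := by
    ext i j
    rw [Matrix.mul_apply]
    by_cases hi : i ∈ S
    · rw [Finset.sum_eq_single j]
      · by_cases hj : j ∈ S
        · simp [P, hi, exitMat, hj]
        · have hij : i < j := lt_of_not_ge fun hle => hj (hS i hi j hle)
          simp [P, hi, hrow i hi j hij]
      · intro k _ hkj
        by_cases hk : k ∈ S
        · simp [exitMat, hk, hkj]
        · have hik : i < k := lt_of_not_ge fun hle => hk (hS i hi k hle)
          simp [P, hi, hrow i hi k hik]
      · simp
    · rw [Finset.sum_eq_single i]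
      · simp [P, hi, exitMat]
      · intro k _ hk
        simp [P, hi, Ne.symm hk]
      · simp
  have hP : P.det = 1 := by
    rw [Matrix.det_of_isLowerTriangular (M := P)]
    · refine Finset.prod_eq_one fun i _ => ?_
      by_cases hi : i ∈ S
      · simp [P, hi, exitMat, hLv i hi, rowEnt_zero_neg_one hp0 hp1]
      · simp [P, hi]
    · intro i j hij
      have hij : i < j := hij
      by_cases hi : i ∈ S
      · simp [P, hi, hrow i hi j hij]
      · simp [P, hi, hij.ne]
  rw [hfac, Matrix.det_mul, hP, one_mul]

theorem det_exitMat_of_zero (hp0 : 0 < p) (hp1 : p < 1) {Lv : Lead N h → ℕ} (hLv : ∀ i, Lv i = 0)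
    (τ : Lead N h → ℕ) : (exitMat p ∅ Lv τ).det = 1 := by
  rw [det_exitMat_eq hp0 hp1 (S := univ) (fun _ _ _ _ => mem_univ _) fun i _ => hLv i]
  have : exitMat p (univ : Finset (Lead N h)) Lv τ = 1 := by
    ext i j; simp [exitMat, Matrix.one_apply]
  rw [this, Matrix.det_one]

/-- The determinant vanishes when some particle is too late. -/
theorem det_exitMat_eq_zero (hp0 : 0 < p) (hp1 : p < 1) {Lv τ : Lead N h → ℕ} (hLv : Monotone Lv)
    (hτ : Monotone τ) {k : Lead N h} (hk : τ k = 0) (hLk : Lv k ≠ 0) :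
    (exitMat p ∅ Lv τ).det = 0 := by
  rw [det_exitMat_eq hp0 hp1 (S := univ.filter fun i => Lv i = 0)
    (fun i hi j hj => by
      simp only [mem_filter, mem_univ, true_and] at hi ⊢
      have := hLv hj; omega) (fun i hi => by simpa using hi)]
  -- The first unfinished particle also has no time left. Its column is zero: finished rows are unit
  -- vectors elsewhere, and in unfinished rows no pole remains at time 0.
  obtain ⟨k₀, hk₀, hmin⟩ := WellFounded.has_min (wellFounded_lt (α := Lead N h))
    {i | Lv i ≠ 0} ⟨k, hLk⟩
  have hk₀k : k₀ ≤ k := not_lt.1 (hmin k hLk)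
  have hτ0 : τ k₀ = 0 := by have := hτ hk₀k; omega
  refine Matrix.det_eq_zero_of_column_eq_zero k₀ fun i => ?_
  simp only [exitMat, Matrix.of_apply, mem_filter, mem_univ, true_and, hτ0]
  split_ifs with h1 h2
  · subst h2; exact absurd h1 hk₀
  · rfl
  · have hki : k₀ ≤ i := not_lt.1 (hmin i h1)
    have : ((k₀.1 : ℕ) : ℤ) ≤ (i.1 : ℕ) := by exact_mod_cast (show (k₀.1 : ℕ) ≤ i.1 from hki)
    exact rowEnt_time_zero hp0 hp1 (by omega)

/-- Independent jumps: the probability of a jump or of a stay. -/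
def freeWt (p : ℝ) (b : Bool) : ℂ := if b then p else 1 - p

theorem sum_freeWt_restrict {α : Type*} [Fintype α] [DecidableEq α] (P : α → Prop) [DecidablePred P]
    (G : ({a // P a} → Bool) → ℂ) :
    ∑ ε : α → Bool, (∏ a, freeWt p (ε a)) * G (fun a => ε a) =
      ∑ ε : {a // P a} → Bool, (∏ a, freeWt p (ε a)) * G ε := by
  rw [← (Equiv.piEquivPiSubtypeProd P fun _ => Bool).symm.sum_comp, Fintype.sum_prod_type]
  refine Finset.sum_congr rfl fun ε₁ _ => ?_
  have h1 : ∀ ε₂ : {a // ¬ P a} → Bool,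
      (∏ a, freeWt p ((Equiv.piEquivPiSubtypeProd P fun _ => Bool).symm (ε₁, ε₂) a)) *
        G (fun a => (Equiv.piEquivPiSubtypeProd P fun _ => Bool).symm (ε₁, ε₂) a) =
      ((∏ a, freeWt p (ε₁ a)) * G ε₁) * ∏ a, freeWt p (ε₂ a) := by
    intro ε₂
    rw [← Fintype.prod_subtype_mul_prod_subtype P]
    have e1 : ∀ a : {a // P a}, (Equiv.piEquivPiSubtypeProd P fun _ => Bool).symm (ε₁, ε₂) a = ε₁ a := by
      intro a; simp [Equiv.piEquivPiSubtypeProd, a.2]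
    have e2 : ∀ a : {a // ¬ P a}, (Equiv.piEquivPiSubtypeProd P fun _ => Bool).symm (ε₁, ε₂) a = ε₂ a := by
      intro a; simp [Equiv.piEquivPiSubtypeProd, a.2]
    simp only [e1, e2]
    ring
  simp_rw [h1]
  rw [← Finset.mul_sum]
  have h2 : ∑ ε₂ : {a // ¬ P a} → Bool, ∏ a, freeWt p (ε₂ a) = 1 := by
    have := (Finset.prod_univ_sum (fun _ : {a // ¬ P a} => (univ : Finset Bool))
      (fun _ b => freeWt p b)).symm
    rw [Fintype.piFinset_univ] at this
    rw [this]
    simp [freeWt]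
  rw [h2, mul_one]

/-- Number of jumps that remain until the targets `T` are reached. -/
def remJumps (T : Lead N h → ℤ) (c : Fin N → ℤ) (i : Lead N h) : ℕ := (T i - c i.1).toNat

/-- The configuration after the jumps `ε`. -/
def jumpTo (c : Fin N → ℤ) (ε : Fin N → Bool) : Fin N → ℤ := fun i => c i + if ε i then 1 else 0

/-- Particle `i` is blocked, given the jumps of the particles before it. -/
def Blocked (c : Fin N → ℤ) (ε : Fin N → Bool) (i : Fin N) : Prop :=
  ∃ j : Fin N, (j : ℕ) + 1 = i ∧ jumpTo c ε j - c i = 1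

open Classical in
/-- The weight of the move of particle `i`, given the jumps of the particles before it. -/
def moveWt (p : ℝ) (c : Fin N → ℤ) (ε : Fin N → Bool) (i : Fin N) : ℂ :=
  if Blocked c ε i then (if ε i then 0 else 1) else freeWt p (ε i)

theorem blocked_update {c : Fin N → ℤ} {ε : Fin N → Bool} {i k : Fin N} (hik : i ≤ k) (b : Bool) :
    Blocked c (Function.update ε k b) i ↔ Blocked c ε i := by
  unfold Blocked
  refine exists_congr fun j => and_congr_right fun hj => ?_
  have : j ≠ k := by rintro rfl; have : (i : ℕ) ≤ j := hik; omega
  simp [jumpTo, this]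

/-- By `rowEnt_time` each unfinished row is the Bernoulli mixture of the rows after a jump and after
a stay, and unit rows are mixtures of themselves. Multilinearity turns this into a sum over
independent jumps. -/
theorem exitMat_rows_expand (hp0 : 0 < p) (hp1 : p < 1) {Lv τ : Lead N h → ℕ} (hLv : Monotone Lv)
    (hτ : ∀ i, τ i = 0 → Lv i = 0) :
    (exitMat p ∅ Lv τ).det = ∑ ε : Lead N h → Bool, (∏ i, freeWt p (ε i)) *
      (exitMat p (univ.filter fun i => Lv i = 0) (fun i => Lv i - if ε i then 1 else 0)
        (fun i => τ i - 1)).det := by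
  set S : Finset (Lead N h) := univ.filter fun i => Lv i = 0
  have hS : ∀ i ∈ S, ∀ j ≤ i, j ∈ S := fun i hi j hj => by
    simp only [S, mem_filter, mem_univ, true_and] at hi ⊢
    have := hLv hj; omega
  rw [det_exitMat_eq hp0 hp1 hS (fun i hi => by simpa [S] using hi)]
  have hrow : exitMat p S Lv τ = fun i => ∑ b : Bool, freeWt p b •
      (fun j => if i ∈ S then (if i = j then (1 : ℂ) else 0) else
        rowEnt p (Lv i - if b then 1 else 0) (τ j - 1) (((j.1 : ℕ) : ℤ) - 1 - ((i.1 : ℕ) : ℤ))) := by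
    ext i j
    by_cases hi : i ∈ S
    · simp only [exitMat, Matrix.of_apply, hi, if_true, freeWt, Fintype.sum_bool, Pi.add_apply,
        Pi.smul_apply, smul_eq_mul, Bool.false_eq_true, if_false]
      ring
    · have hi0 : Lv i ≠ 0 := by simpa [S] using hi
      simp only [exitMat, Matrix.of_apply, hi, if_false, Fintype.sum_bool, freeWt, if_true,
        Bool.false_eq_true, Pi.add_apply, Pi.smul_apply, smul_eq_mul, Nat.sub_zero]
      obtain ⟨L, hL⟩ := Nat.exists_eq_succ_of_ne_zero hi0
      rw [hL]
      -- Truncated subtraction freezes a remaining time 0. This is harmless: such a j precedes i,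
      -- and the entries at time 0 vanish before and after the jump.
      rcases hτj : τ j with _ | t
      · have hji : j < i := lt_of_not_ge fun hle => by
          have := hLv hle; have := hτ j hτj; omega
        have : ((j.1 : ℕ) : ℤ) < (i.1 : ℕ) := by exact_mod_cast (show (j.1 : ℕ) < i.1 from hji)
        have hz : ∀ L' : ℕ, rowEnt p L' 0 (((j.1 : ℕ) : ℤ) - 1 - ((i.1 : ℕ) : ℤ)) = 0 :=
          fun L' => rowEnt_time_zero hp0 hp1 (by omega)
        simp [hz]
      · simp only [Nat.succ_eq_add_one, Nat.add_sub_cancel]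
        rw [rowEnt_time hp0 hp1]
        ring
  have hdet : (exitMat p S Lv τ).det = Matrix.detRowAlternating (exitMat p S Lv τ) := rfl
  rw [hdet, hrow, ← AlternatingMap.coe_multilinearMap, MultilinearMap.map_sum]
  refine Finset.sum_congr rfl fun ε _ => ?_
  rw [MultilinearMap.map_smul_univ, smul_eq_mul]
  rfl

/-- If a particle is blocked then its virtual jump does not change the determinant. -/
theorem det_exitMat_blocked (hp0 : 0 < p) (hp1 : p < 1) {T : Lead N h → ℤ}
    (hT : ∀ i j : Lead N h, (i.1 : ℕ) + 1 = j.1 → T i = T j + 1) (c : Config N) {ε : Fin N → Bool}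
    {k : Fin N} (hb : Blocked c.1 ε k) (τ : Lead N h → ℕ) (b b' : Bool) :
    (exitMat p (univ.filter fun i => remJumps T c.1 i = 0)
      (fun i => remJumps T c.1 i - if Function.update ε k b i.1 then 1 else 0) τ).det =
    (exitMat p (univ.filter fun i => remJumps T c.1 i = 0)
      (fun i => remJumps T c.1 i - if Function.update ε k b' i.1 then 1 else 0) τ).det := by
  by_cases hkI : (k : ℕ) ≤ h
  swap
  · congr 2
    ext i
    have : i.1 ≠ k := fun hik => hkI (hik ▸ i.2)
    simp [this]
  obtain ⟨j, hj, hcj⟩ := hb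
  have hcjk : c.1 k < c.1 j := c.2 (show j < k from by
    rw [Fin.lt_def]; omega)
  have hεj : ε j = false := by
    by_contra hne
    simp only [Bool.not_eq_false] at hne
    simp only [jumpTo, hne, if_true] at hcj
    omega
  have hadj : c.1 j = c.1 k + 1 := by
    simp only [jumpTo, hεj] at hcj
    simp at hcj; omega
  set kI : Lead N h := ⟨k, hkI⟩
  set jI : Lead N h := ⟨j, by omega⟩
  -- The blocking neighbour is adjacent and stays, and its target lies one site ahead, so both
  -- particles have the same number of jumps left.
  have hrem : remJumps T c.1 jI = remJumps T c.1 kI := by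
    have := hT jI kI hj
    simp only [remJumps, this, jI, kI, hadj]
    congr 1; ring
  have hjk : jI ≠ kI := by
    intro hh
    have : (j : ℕ) = k := congrArg (fun i : Lead N h => (i.1 : ℕ)) hh
    omega
  suffices H : ∀ b, (exitMat p (univ.filter fun i => remJumps T c.1 i = 0)
      (fun i => remJumps T c.1 i - if Function.update ε k b i.1 then 1 else 0) τ).det =
      (exitMat p (univ.filter fun i => remJumps T c.1 i = 0)
      (fun i => remJumps T c.1 i - if Function.update ε k false i.1 then 1 else 0) τ).det by
    rw [H b, H b']
  intro b
  cases b with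
  | false => rfl
  | true =>
    set S : Finset (Lead N h) := univ.filter fun i => remJumps T c.1 i = 0
    set A := exitMat p S
      (fun i => remJumps T c.1 i - if Function.update ε k false i.1 then 1 else 0) τ
    by_cases hk0 : kI ∈ S
    · congr 1
      ext i l
      by_cases hi : i = kI
      · subst hi; simp [A, exitMat, hk0]
      · have : i.1 ≠ k := fun hik => hi (Subtype.ext hik)
        simp [A, exitMat, this]
    · have hk0' : remJumps T c.1 kI ≠ 0 := by simpa [S] using hk0
      have hj0 : jI ∉ S := by simpa [S, hrem] using hk0'
      obtain ⟨L, hL⟩ := Nat.exists_eq_succ_of_ne_zero hk0'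
      -- By `rowEnt_space`, the row of k after a virtual jump is its row without the jump minus the
      -- row of the neighbour j.
      have hkey := Matrix.det_updateRow_add_smul_self A hjk.symm (-1)
      rw [← hkey]
      congr 1
      ext i l
      by_cases hi : i = kI
      · subst hi
        rw [Matrix.updateRow_self]
        have hjk' : j ≠ k := fun hjk' => hjk (Subtype.ext hjk')
        simp only [A, exitMat, Matrix.of_apply, hk0, hj0, if_false, Pi.add_apply, Pi.smul_apply,
          smul_eq_mul]
        have hu1 : Function.update ε k true kI.1 = true := Function.update_self ..
        have hu2 : Function.update ε k false kI.1 = false := Function.update_self ..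
        have hu3 : Function.update ε k false jI.1 = false := by
          rw [Function.update_of_ne hjk']; exact hεj
        rw [hu1, hu2, hu3, hrem, hL]
        simp only [if_true, Bool.false_eq_true, if_false, Nat.sub_zero, Nat.succ_eq_add_one,
          Nat.add_sub_cancel]
        rw [rowEnt_space hp0 hp1,
          show ((l.1 : ℕ) : ℤ) - 1 - ((jI.1 : ℕ) : ℤ) = ((l.1 : ℕ) : ℤ) - 1 - ((kI.1 : ℕ) : ℤ) + 1 by
            simp only [jI, kI]; omega]
        ring
      · rw [Matrix.updateRow_ne hi]
        have : i.1 ≠ k := fun hik => hi (Subtype.ext hik)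
        simp [A, exitMat, this]

/-- Replacing independent jumps by the moves of the exclusion process. -/
theorem sum_moveWt_eq_sum_freeWt (c : Fin N → ℤ) (G : (Fin N → Bool) → ℂ)
    (hG : ∀ ε k b b', Blocked c ε k → G (Function.update ε k b) = G (Function.update ε k b')) :
    ∑ ε : Fin N → Bool, (∏ i, moveWt p c ε i) * G ε =
      ∑ ε : Fin N → Bool, (∏ i, freeWt p (ε i)) * G ε := by
  -- Interpolation: the first k particles follow the exclusion rule and the others jump
  -- independently.
  have key : ∀ k ≤ N, ∑ ε : Fin N → Bool,
      (∏ i : Fin N, if (i : ℕ) < k then moveWt p c ε i else freeWt p (ε i)) * G ε =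
      ∑ ε : Fin N → Bool, (∏ i, freeWt p (ε i)) * G ε := by
    intro k
    induction k with
    | zero => intro _; simp
    | succ k ih =>
      intro hk
      rw [← ih (by omega), ← sub_eq_zero, ← Finset.sum_sub_distrib]
      let kk : Fin N := ⟨k, by omega⟩
      have hsplit : ∀ ε : Fin N → Bool,
          (∏ i : Fin N, if (i : ℕ) < k + 1 then moveWt p c ε i else freeWt p (ε i)) * G ε -
          (∏ i : Fin N, if (i : ℕ) < k then moveWt p c ε i else freeWt p (ε i)) * G ε =
          (∏ i ∈ univ.erase kk, if (i : ℕ) < k then moveWt p c ε i else freeWt p (ε i)) *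
            ((moveWt p c ε kk - freeWt p (ε kk)) * G ε) := by
        intro ε
        rw [← Finset.mul_prod_erase univ _ (mem_univ kk), ← Finset.mul_prod_erase univ
          (fun i : Fin N => if (i : ℕ) < k then moveWt p c ε i else freeWt p (ε i)) (mem_univ kk)]
        have : ∏ i ∈ univ.erase kk, (if (i : ℕ) < k + 1 then moveWt p c ε i else freeWt p (ε i)) =
            ∏ i ∈ univ.erase kk, (if (i : ℕ) < k then moveWt p c ε i else freeWt p (ε i)) := by
          refine Finset.prod_congr rfl fun i hi => ?_
          have : (i : ℕ) ≠ k := fun hik => (mem_erase.1 hi).1 (Fin.ext hik)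
          exact if_congr (by omega) rfl rfl
        rw [this]
        simp only [kk, Nat.lt_succ_self, lt_irrefl, if_true, if_false]
        ring
      simp_rw [hsplit]
      -- Pair the two choices for particle k. If it is blocked, the weight differences are -p and p
      -- while the rest of the summand is equal; if not, both differences are zero.
      refine Finset.sum_involution (fun ε _ => Function.update ε kk (!ε kk)) ?_ ?_
        (fun _ _ => mem_univ _) ?_
      · intro ε _
        have hrest : ∏ i ∈ univ.erase kk, (if (i : ℕ) < k then
              moveWt p c (Function.update ε kk (!ε kk)) i else
              freeWt p (Function.update ε kk (!ε kk) i)) =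
            ∏ i ∈ univ.erase kk, (if (i : ℕ) < k then moveWt p c ε i else freeWt p (ε i)) := by
          refine Finset.prod_congr rfl fun i hi => ?_
          have hik : i ≠ kk := (mem_erase.1 hi).1
          split_ifs with hlt
          · have hiff := blocked_update (c := c) (ε := ε) (show i ≤ kk from hlt.le) (!ε kk)
            unfold moveWt
            rw [Function.update_of_ne hik]
            by_cases hb : Blocked c ε i
            · rw [if_pos hb, if_pos (hiff.2 hb)]
            · rw [if_neg hb, if_neg fun hh => hb (hiff.1 hh)]
          · rw [Function.update_of_ne hik]
        rw [hrest, ← mul_add]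
        by_cases hb : Blocked c ε kk
        · have hb' := (blocked_update le_rfl (!ε kk)).2 hb
          have hGe : G (Function.update ε kk (!ε kk)) = G ε := by
            have := hG ε kk (!ε kk) (ε kk) hb
            rwa [Function.update_eq_self] at this
          rw [hGe]
          simp only [moveWt, if_pos hb, if_pos hb', Function.update_self]
          cases ε kk <;> simp [freeWt]
        · have hb' : ¬ Blocked c (Function.update ε kk (!ε kk)) kk := fun hh =>
            hb ((blocked_update le_rfl _).1 hh)
          simp [moveWt, if_neg hb, if_neg hb']
      · intro ε _ _ hh
        have := congrFun hh kk
        simp at this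
      · intro ε _
        simp
  have := key N le_rfl
  simpa using this

/-- The backward equation for the determinant. -/
theorem det_exitMat_step (hp0 : 0 < p) (hp1 : p < 1) {T : Lead N h → ℤ}
    (hT : ∀ i j : Lead N h, (i.1 : ℕ) + 1 = j.1 → T i = T j + 1) (c : Config N)
    (hmono : Monotone (remJumps T c.1)) {τ : Lead N h → ℕ}
    (hτ : ∀ i, τ i = 0 → remJumps T c.1 i = 0) :
    ∑ ε : Fin N → Bool, (∏ i, moveWt p c.1 ε i) *
      (exitMat p ∅ (remJumps T (jumpTo c.1 ε)) (fun i => τ i - 1)).det =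
    (exitMat p ∅ (remJumps T c.1) τ).det := by
  set S : Finset (Lead N h) := univ.filter fun i => remJumps T c.1 i = 0
  have hS : ∀ i ∈ S, ∀ j ≤ i, j ∈ S := fun i hi j hj => by
    simp only [S, mem_filter, mem_univ, true_and] at hi ⊢
    have := hmono hj; omega
  have hG : ∀ ε : Fin N → Bool, (exitMat p ∅ (remJumps T (jumpTo c.1 ε)) (fun i => τ i - 1)).det =
      (exitMat p S (fun i => remJumps T c.1 i - if ε i.1 then 1 else 0) (fun i => τ i - 1)).det := by
    intro ε
    have h1 : remJumps T (jumpTo c.1 ε) = fun i => remJumps T c.1 i - if ε i.1 then 1 else 0 := by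
      ext i
      simp only [remJumps, jumpTo]
      split_ifs <;> omega
    rw [h1, det_exitMat_eq hp0 hp1 hS]
    intro i hi
    have : remJumps T c.1 i = 0 := by simpa [S] using hi
    simp [this]
  simp_rw [hG]
  rw [sum_moveWt_eq_sum_freeWt c.1 (fun ε => (exitMat p S
    (fun i => remJumps T c.1 i - if ε i.1 then 1 else 0) (fun i => τ i - 1)).det)
    fun ε k b b' hb => det_exitMat_blocked hp0 hp1 hT c hb _ b b']
  rw [sum_freeWt_restrict (fun i : Fin N => (i : ℕ) ≤ h) (fun ε => (exitMat p S
    (fun i => remJumps T c.1 i - if ε i then 1 else 0) (fun i => τ i - 1)).det)]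
  exact (exitMat_rows_expand hp0 hp1 hmono hτ).symm

end ExitDeterminant

/-! ### From the determinant to the law of the process. -/

section Markov

open Finset

variable {p : ℝ} {N : ℕ}

theorem config_gap (c : Config N) {i j : Fin N} (hij : i ≤ j) :
    ((j : ℕ) : ℤ) - (i : ℕ) ≤ c.1 i - c.1 j := by
  obtain ⟨d, hd⟩ := Nat.exists_eq_add_of_le (show (i : ℕ) ≤ j from hij)
  induction d generalizing j with
  | zero =>
    have : i = j := Fin.ext (by omega)
    subst this; simp
  | succ d ih =>
    have hj := j.2
    have h1 := ih (j := ⟨i + d, by omega⟩) (by rw [Fin.le_def]; simp) rfl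
    have h2 : c.1 j < c.1 ⟨i + d, by omega⟩ := c.2 (by rw [Fin.lt_def]; simp; omega)
    simp only at h1
    push_cast at h1
    omega

theorem exists_jumpTo_of_stepProb_ne_zero {d y : Config N} (hne : stepProb p d y ≠ 0) :
    ∃ ε : Fin N → Bool, d.1 = jumpTo y.1 ε := by
  refine ⟨fun i => decide (d.1 i - y.1 i = 1), ?_⟩
  ext i
  have := Finset.prod_ne_zero_iff.1 hne i (mem_univ i)
  by_cases h1 : d.1 i - y.1 i = 1
  · simp [jumpTo, h1]; omega
  · by_cases h0 : d.1 i - y.1 i = 0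
    · simp [jumpTo, h1]; omega
    · exact absurd (by simp [h0, h1]) this

theorem strictAnti_jumpTo {y : Config N} {ε : Fin N → Bool} (hne : ∏ i, moveWt p y.1 ε i ≠ 0) :
    StrictAnti (jumpTo y.1 ε) := by
  intro i j hij
  have hij' : (i : ℕ) < j := hij
  have hgap := config_gap y hij.le
  by_cases hadj : (i : ℕ) + 1 = j
  · have hj := Finset.prod_ne_zero_iff.1 hne j (mem_univ j)
    by_contra hle
    simp only [jumpTo] at hle
    -- The order can only break at adjacent labels through a jump of a blocked particle, and that
    -- has weight zero.
    have hb : Blocked y.1 ε j := by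
      refine ⟨i, hadj, ?_⟩
      simp only [jumpTo]
      split_ifs at hle ⊢ <;> omega
    have hε : ε j = true := by
      by_contra hε
      simp only [hε] at hle
      split_ifs at hle <;> simp at hle <;> omega
    exact hj (by simp [moveWt, hb, hε])
  · simp only [jumpTo]
    split_ifs <;> omega

theorem stepProb_jumpTo {y d : Config N} {ε : Fin N → Bool} (hd : d.1 = jumpTo y.1 ε) :
    (stepProb p d y : ℂ) = ∏ i, moveWt p y.1 ε i := by
  unfold stepProb
  rw [Complex.ofReal_prod]
  refine Finset.prod_congr rfl fun i _ => ?_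
  have hbl : (∃ j : Fin N, (j : ℕ) + 1 = i ∧ d.1 j - y.1 i = 1) ↔ Blocked y.1 ε i := by
    unfold Blocked; rw [hd]
  have hdi : d.1 i = y.1 i + if ε i then 1 else 0 := by rw [hd]; rfl
  by_cases hb : Blocked y.1 ε i
  · have hb' := hbl.2 hb
    cases hε : ε i with
    | false => simp [moveWt, hb, hb', hdi, hε]
    -- The one-step formula alone would give p for this jump. The case cannot occur: the target site
    -- is occupied in d, whose positions are distinct.
    | true =>
      obtain ⟨j, hj, hj1⟩ := hb'
      have := d.2 (show j < i by rw [Fin.lt_def]; omega)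
      rw [hε] at hdi
      simp at hdi
      omega
  · rw [if_neg fun hh => hb (hbl.1 hh)]
    cases hε : ε i <;> simp [moveWt, hb, hdi, hε, freeWt]

variable {Ω : Type*} [MeasurableSpace Ω] {μ : Measure Ω} {X : ℕ → Ω → Config N}

namespace IsStepTASEP

theorem measurableSet_prefix (hX : IsStepTASEP μ N p X) (t : ℕ) (c : ℕ → Config N) :
    MeasurableSet {ω | ∀ s ≤ t, X s ω = c s} := by
  have : {ω | ∀ s ≤ t, X s ω = c s} = ⋂ s, ⋂ _ : s ≤ t, X s ⁻¹' {c s} := by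
    ext ω; simp
  rw [this]
  exact MeasurableSet.iInter fun s => MeasurableSet.iInter fun _ =>
    hX.measurable s (measurableSet_singleton _)

variable {h : ℕ}

theorem measurableSet_future (hX : IsStepTASEP μ N p X) (s : Lead N h → ℕ) (T : Lead N h → ℤ) (t : ℕ) :
    MeasurableSet {ω | ∀ k : Lead N h, t ≤ s k → T k ≤ (X (s k) ω).1 k.1} := by
  have : {ω | ∀ k : Lead N h, t ≤ s k → T k ≤ (X (s k) ω).1 k.1} =
      ⋂ k, ⋂ _ : t ≤ s k, X (s k) ⁻¹' {d | T k ≤ d.1 k.1} := by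
    ext ω; simp
  rw [this]
  exact MeasurableSet.iInter fun k => MeasurableSet.iInter fun _ =>
    hX.measurable _ (Set.to_countable _).measurableSet

theorem real_prefix_succ (hX : IsStepTASEP μ N p X) (t : ℕ) (c : ℕ → Config N) (d : Config N) :
    μ.real {ω | ∀ s ≤ t + 1, X s ω = Function.update c (t + 1) d s} =
      μ.real {ω | ∀ s ≤ t, X s ω = c s} * stepProb p d (c t) := by
  rw [hX.trajectory, hX.trajectory, prod_range_succ, mul_assoc]
  have hprod : ∏ s ∈ range t, stepProb p (Function.update c (t + 1) d (s + 1))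
      (Function.update c (t + 1) d s) = ∏ s ∈ range t, stepProb p (c (s + 1)) (c s) := by
    refine Finset.prod_congr rfl fun s hs => ?_
    have := mem_range.1 hs
    rw [Function.update_of_ne (by omega), Function.update_of_ne (by omega)]
  rw [hprod, Function.update_self, Function.update_of_ne (by omega),
    Function.update_of_ne (by omega)]

variable [IsProbabilityMeasure μ]

theorem ae_start (hX : IsStepTASEP μ N p X) : ∀ᵐ ω ∂μ, X 0 ω = stepConfig N := by
  have h := hX.trajectory 0 fun _ => stepConfig N
  simp only [Nat.le_zero, forall_eq, if_true, range_zero, prod_empty, mul_one] at h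
  rw [MeasureTheory.ae_iff]
  have hm : MeasurableSet {ω | X 0 ω = stepConfig N} := hX.measurable 0 (measurableSet_singleton _)
  have := prob_compl_eq_zero_iff (μ := μ) hm
  refine this.2 ?_
  rw [Measure.real, ENNReal.toReal_eq_one_iff] at h
  exact h

/-- There are countably many finite trajectories, and each one containing an impossible step is
null. -/
theorem ae_stepProb_ne_zero (hX : IsStepTASEP μ N p X) :
    ∀ᵐ ω ∂μ, ∀ t, stepProb p (X (t + 1) ω) (X t ω) ≠ 0 := by
  rw [ae_all_iff]
  intro t
  have h : ∀ᵐ ω ∂μ, ∀ c : Fin (t + 2) → Config N,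
      stepProb p (c ⟨t + 1, by omega⟩) (c ⟨t, by omega⟩) = 0 →
      ¬ ∀ s : Fin (t + 2), X s ω = c s := by
    rw [ae_all_iff]
    intro c
    by_cases hc : stepProb p (c ⟨t + 1, by omega⟩) (c ⟨t, by omega⟩) = 0
    swap
    · exact Filter.Eventually.of_forall fun _ h => absurd h hc
    let c' : ℕ → Config N := fun s => if hs : s < t + 2 then c ⟨s, hs⟩ else stepConfig N
    have h0 := hX.trajectory (t + 1) c'
    rw [Finset.prod_eq_zero (i := t) (by simp) (by simpa [c'] using hc), mul_zero,
      measureReal_eq_zero_iff] at h0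
    rw [MeasureTheory.ae_iff]
    refine measure_mono_null (fun ω hω => ?_) h0
    simp only [Set.mem_ofPred_eq, hc, true_imp_iff, not_not] at hω ⊢
    intro s hs
    simp only [c', dif_pos (show s < t + 2 by omega)]
    exact hω ⟨s, by omega⟩
  filter_upwards [h] with ω hω h0
  exact hω (fun s => X s ω) h0 fun s => rfl

/-- Backward induction on the number n of steps after which all deadlines have passed. Intersecting
with a full trajectory prefix takes the place of conditioning, so the product formula supplies the
Markov property directly. -/
theorem real_prefix_inter_future (hX : IsStepTASEP μ N p X) (hp0 : 0 < p) (hp1 : p < 1) (D : ℤ)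
    {s : Lead N h → ℕ} (hs : Monotone s) (n : ℕ) : ∀ (t : ℕ) (c : ℕ → Config N),
    (∀ k, s k < t + n) →
    (∀ k : Lead N h, s k < t → D - ((k.1 : ℕ) : ℤ) ≤ (c t).1 k.1) →
    (μ.real ({ω | ∀ s ≤ t, X s ω = c s} ∩
      {ω | ∀ k : Lead N h, t ≤ s k → D - ((k.1 : ℕ) : ℤ) ≤ (X (s k) ω).1 k.1}) : ℂ) =
    μ.real {ω | ∀ s ≤ t, X s ω = c s} *
      (exitMat p ∅ (remJumps (fun k : Lead N h => D - ((k.1 : ℕ) : ℤ)) (c t).1)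
        (fun k => s k - t)).det := by
  set T : Lead N h → ℤ := fun k => D - ((k.1 : ℕ) : ℤ) with hTdef
  have hT : ∀ i j : Lead N h, (i.1 : ℕ) + 1 = j.1 → T i = T j + 1 := by
    intro i j hij
    simp only [hTdef]; omega
  have hmono : ∀ c : Config N, Monotone (remJumps T c.1) := by
    intro c i j hij
    have := config_gap c (show i.1 ≤ j.1 from hij)
    simp only [remJumps, hTdef]
    exact Int.toNat_le_toNat (by omega)
  induction n with
  | zero =>
    intro t c hlt hc
    rw [det_exitMat_of_zero hp0 hp1, mul_one]
    · congr 2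
      ext ω
      simp only [Set.mem_inter_iff, Set.mem_ofPred_eq, and_iff_left_iff_imp]
      intro _ k hk
      have := hlt k; omega
    · intro i
      have := hc i (by simpa using hlt i)
      simp only [remJumps, hTdef]; omega
  | succ n ih =>
    intro t c hlt hc
    -- If a deadline falls now and is missed, the event is empty and the determinant has a zero
    -- column.
    by_cases hA : ∃ k, s k = t ∧ remJumps T (c t).1 k ≠ 0
    · obtain ⟨k, hk, hrk⟩ := hA
      rw [det_exitMat_eq_zero hp0 hp1 (hmono (c t))
        (fun i j hij => Nat.sub_le_sub_right (hs hij) t) (k := k) (by omega) hrk, mul_zero]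
      have : ({ω | ∀ s ≤ t, X s ω = c s} ∩
          {ω | ∀ k : Lead N h, t ≤ s k → T k ≤ (X (s k) ω).1 k.1}) = ∅ := by
        ext ω
        simp only [Set.mem_inter_iff, Set.mem_ofPred_eq, Set.mem_empty_iff_false, iff_false, not_and]
        intro h1 h2
        have h3 := h2 k hk.ge
        rw [hk, h1 t le_rfl] at h3
        simp only [remJumps] at hrk
        omega
      rw [this]; simp
    · push Not at hA
      have hdone : ∀ k : Lead N h, s k ≤ t → T k ≤ (c t).1 k.1 := by
        intro k hk
        rcases hk.lt_or_eq with hk | hk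
        · exact hc k hk
        · have := hA k hk
          simp only [remJumps] at this; omega
      have hset : ({ω | ∀ s ≤ t, X s ω = c s} ∩
          {ω | ∀ k : Lead N h, t ≤ s k → T k ≤ (X (s k) ω).1 k.1}) =
          ({ω | ∀ s ≤ t, X s ω = c s} ∩
          {ω | ∀ k : Lead N h, t + 1 ≤ s k → T k ≤ (X (s k) ω).1 k.1}) := by
        ext ω
        simp only [Set.mem_inter_iff, Set.mem_ofPred_eq]
        refine and_congr_right fun h1 => ⟨fun h2 k hk => h2 k (by omega), fun h2 k hk => ?_⟩
        rcases hk.lt_or_eq with hk | hk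
        · exact h2 k hk
        · rw [← hk, h1 t le_rfl]; exact hdone k hk.ge
      rw [hset]
      set A := ({ω | ∀ s ≤ t, X s ω = c s} ∩
          {ω | ∀ k : Lead N h, t + 1 ≤ s k → T k ≤ (X (s k) ω).1 k.1}) with hAdef
      have hAm : MeasurableSet A :=
        (hX.measurableSet_prefix t c).inter (hX.measurableSet_future s T (t + 1))
      let B : (Fin N → Bool) → Set Ω := fun ε => {ω | (X (t + 1) ω).1 = jumpTo (c t).1 ε}
      have hBm : ∀ ε, MeasurableSet (B ε) := fun ε =>
        hX.measurable (t + 1) (Set.to_countable {d : Config N | d.1 = jumpTo (c t).1 ε}).measurableSet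
      have hBd : Pairwise (Function.onFun Disjoint fun ε => A ∩ B ε) := by
        intro ε ε' hne
        refine Set.disjoint_left.2 fun ω h1 h2 => hne ?_
        have h3 : jumpTo (c t).1 ε = jumpTo (c t).1 ε' := h1.2.symm.trans h2.2
        ext i
        have := congrFun h3 i
        simp only [jumpTo] at this
        cases h5 : ε i <;> cases h6 : ε' i <;> simp_all
      -- Decompose by the jump pattern of the next step. Patterns that break the order give an empty
      -- event, and their move weight is zero too.
      have hsum : μ.real A = ∑ ε, μ.real (A ∩ B ε) := by
        rw [← measureReal_iUnion_fintype hBd fun ε => hAm.inter (hBm ε)]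
        refine measureReal_congr ?_
        filter_upwards [hX.ae_stepProb_ne_zero] with ω hω
        refine propext ⟨fun hωA => ?_, fun hω' => ?_⟩
        · obtain ⟨ε, hε⟩ := exists_jumpTo_of_stepProb_ne_zero (hω t)
          have hXt : X t ω = c t := (hωA : ω ∈ A).1 t le_rfl
          rw [hXt] at hε
          exact Set.mem_iUnion.2 ⟨ε, hωA, hε⟩
        · obtain ⟨ε, hε⟩ := Set.mem_iUnion.1 hω'
          exact hε.1
      rw [hsum, Complex.ofReal_sum, ← det_exitMat_step hp0 hp1 hT (c t) (hmono _)
        (τ := fun k => s k - t) (fun i hi => by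
          have := hdone i (by omega)
          simp only [remJumps]; omega), Finset.mul_sum]
      refine Finset.sum_congr rfl fun ε _ => ?_
      by_cases hε : StrictAnti (jumpTo (c t).1 ε)
      · have hpre : ∀ ω, (∀ s ≤ t + 1, X s ω = Function.update c (t + 1) ⟨_, hε⟩ s) ↔
            (∀ s ≤ t, X s ω = c s) ∧ (X (t + 1) ω).1 = jumpTo (c t).1 ε := by
          intro ω
          constructor
          · intro h1
            refine ⟨fun s hs => ?_, ?_⟩
            · have := h1 s (by omega)
              rwa [Function.update_of_ne (by omega)] at this
            · have := h1 (t + 1) le_rfl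
              rw [Function.update_self] at this
              rw [this]
          · rintro ⟨h1, h2⟩ s hs
            rcases hs.lt_or_eq with hs | rfl
            · rw [Function.update_of_ne (by omega)]; exact h1 s (by omega)
            · rw [Function.update_self]; exact Subtype.ext h2
        have hAB : A ∩ B ε = {ω | ∀ s ≤ t + 1, X s ω = Function.update c (t + 1) ⟨_, hε⟩ s} ∩
            {ω | ∀ k : Lead N h, t + 1 ≤ s k → T k ≤ (X (s k) ω).1 k.1} := by
          ext ω
          simp only [hAdef, B, Set.mem_inter_iff, Set.mem_ofPred_eq, hpre]
          tauto
        rw [hAB, ih (t + 1) _ (fun k => by have := hlt k; omega), hX.real_prefix_succ,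
          Complex.ofReal_mul, stepProb_jumpTo (ε := ε) rfl, mul_assoc]
        · simp only [Function.update_self, Nat.sub_sub]
        · intro k hk
          have := hdone k (by omega)
          simp only [hTdef] at this
          rw [Function.update_self]
          simp only [jumpTo]
          split_ifs <;> omega
      · have h0 : ∏ i, moveWt p (c t).1 ε i = 0 := by
          by_contra hne; exact hε (strictAnti_jumpTo hne)
        have : A ∩ B ε = ∅ := by
          ext ω
          simp only [Set.mem_inter_iff, Set.mem_empty_iff_false, iff_false, not_and]
          intro _ h2
          have h2 : (X (t + 1) ω).1 = jumpTo (c t).1 ε := h2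
          exact hε (h2 ▸ (X (t + 1) ω).2)
        rw [this, h0]; simp

/-- The joint distribution of the exit times of the particles with index at most `h`. -/
theorem real_exit_eq_det (hX : IsStepTASEP μ N p X) (hp0 : 0 < p) (hp1 : p < 1) (D : ℤ)
    {s : Lead N h → ℕ} (hs : Monotone s) :
    (μ.real {ω | ∀ k : Lead N h, D - ((k.1 : ℕ) : ℤ) ≤ (X (s k) ω).1 k.1} : ℂ) =
      (exitMat p ∅ (fun _ : Lead N h => D.toNat) s).det := by
  have hbd : ∀ k, s k < 0 + (univ.sup s + 1) := fun k => by
    have := Finset.le_sup (f := s) (mem_univ k); omega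
  have hmain := real_prefix_inter_future hX hp0 hp1 D hs (univ.sup s + 1) 0 (fun _ => stepConfig N)
    hbd (fun k hk => absurd hk (by omega))
  have hrem : remJumps (fun k : Lead N h => D - ((k.1 : ℕ) : ℤ)) (stepConfig N).1 =
      fun _ => D.toNat := by
    ext k
    simp [remJumps, stepConfig]
  have hone : μ.real {ω | ∀ s ≤ 0, X s ω = stepConfig N} = 1 := by
    rw [hX.trajectory 0 fun _ => stepConfig N]; simp
  rw [hrem, hone, Complex.ofReal_one, one_mul] at hmain
  simp only [Nat.sub_zero] at hmain
  rw [← hmain]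
  congr 1
  refine measureReal_congr ?_
  filter_upwards [hX.ae_start] with ω hω
  refine propext ⟨fun h1 => ⟨fun s hs => ?_, fun k _ => h1 k⟩, fun h1 k => h1.2 k (Nat.zero_le _)⟩
  rw [Nat.le_zero.1 hs]; exact hω

end IsStepTASEP

end Markov

/-! ### Exit times in terms of particle positions. -/

section ExitTimes

open Finset

variable {p : ℝ} {N : ℕ} {Ω : Type*} {X : ℕ → Ω → Config N} {ω : Ω}

/-- Positions grow by 0 or 1 per step, so a particle beyond the site at time b + 1 has jumped off it
at some time ≤ b. The hypothesis on x ensures that no particle starts beyond its exit site. -/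
theorem jumpOffTime_le_iff (h0 : X 0 ω = stepConfig N)
    (hstep : ∀ t, stepProb p (X (t + 1) ω) (X t ω) ≠ 0) {x : ℤ} (hx : 1 - (N : ℤ) ≤ x) (i : Fin N)
    (b : ℕ) : jumpOffTime X i (exitSite N x i) ω ≤ b ↔ x + N - ((i : ℕ) : ℤ) ≤ (X (b + 1) ω).1 i := by
  have hinc : ∀ t, (X t ω).1 i ≤ (X (t + 1) ω).1 i ∧ (X (t + 1) ω).1 i ≤ (X t ω).1 i + 1 := by
    intro t
    obtain ⟨ε, hε⟩ := exists_jumpTo_of_stepProb_ne_zero (hstep t)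
    rw [hε]
    simp only [jumpTo]
    split_ifs <;> omega
  have hmono : Monotone fun t => (X t ω).1 i := monotone_nat_of_le_succ fun t => (hinc t).1
  constructor
  · intro hle
    have hne : {τ : ℕ∞ | ∃ t : ℕ, τ = t ∧ (X t ω).1 i = exitSite N x i ∧
        (X (t + 1) ω).1 i = exitSite N x i + 1}.Nonempty := by
      by_contra hemp
      rw [Set.not_nonempty_iff_eq_empty] at hemp
      rw [jumpOffTime, hemp, sInf_empty] at hle
      exact absurd hle (by simp)
    obtain ⟨t, ht, -, ht1⟩ := csInf_mem hne
    change jumpOffTime X i (exitSite N x i) ω = t at ht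
    rw [ht] at hle
    have hle' : t ≤ b := by exact_mod_cast hle
    have := hmono (show t + 1 ≤ b + 1 by omega)
    simp only [ht1, exitSite] at this
    omega
  · intro hb
    have hex : ∃ t, x + N - ((i : ℕ) : ℤ) ≤ (X (t + 1) ω).1 i := ⟨b, hb⟩
    classical
    have hspec := Nat.find_spec hex
    have hmin := fun t => Nat.find_min (m := t) hex
    have hfb : Nat.find hex ≤ b := Nat.find_min' hex hb
    generalize Nat.find hex = t at hspec hmin hfb
    have hlt : (X t ω).1 i < x + N - ((i : ℕ) : ℤ) := by
      cases t with
      | zero => rw [h0]; simp only [stepConfig]; omega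
      | succ t => exact not_le.1 (hmin t (by omega))
    have := hinc t
    have hmem : (t : ℕ∞) ∈ {τ : ℕ∞ | ∃ t : ℕ, τ = t ∧ (X t ω).1 i = exitSite N x i ∧
        (X (t + 1) ω).1 i = exitSite N x i + 1} := by
      refine ⟨t, rfl, ?_, ?_⟩ <;> simp only [exitSite] <;> omega
    exact (sInf_le hmem).trans (by exact_mod_cast hfb)

/-- The exit sites of two particles differ by exactly their label difference, the least possible
distance between them, so the particle behind cannot leave first. -/
theorem jumpOffTime_mono (h0 : X 0 ω = stepConfig N)
    (hstep : ∀ t, stepProb p (X (t + 1) ω) (X t ω) ≠ 0) {x : ℤ} (hx : 1 - (N : ℤ) ≤ x) :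
    Monotone fun i => jumpOffTime X i (exitSite N x i) ω := by
  intro i j hij
  simp only
  induction hb : jumpOffTime X j (exitSite N x j) ω using ENat.recTopCoe with
  | top => exact le_top
  | coe b =>
    rw [jumpOffTime_le_iff h0 hstep hx]
    have := (jumpOffTime_le_iff h0 hstep hx j b).1 hb.le
    have := config_gap (X (b + 1) ω) hij
    omega

theorem exists_eq_coe_and_le_iff {τ : ℕ∞} {a : ℝ} (ha : 0 ≤ a) :
    (∃ t : ℕ, τ = t ∧ (t : ℝ) ≤ a) ↔ τ ≤ (⌊a⌋₊ : ℕ) := by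
  constructor
  · rintro ⟨t, rfl, ht⟩
    exact_mod_cast Nat.le_floor ht
  · intro h
    lift τ to ℕ using ne_top_of_le_ne_top (ENat.natCast_ne_top _) h
    exact ⟨τ, rfl, (Nat.le_floor_iff ha).1 (by exact_mod_cast h)⟩

end ExitTimes

/-! ### Matching the Fredholm determinant with the exit law. -/

section FredholmExit

open Finset

variable {p : ℝ} {N m : ℕ} {n : Fin m → Fin N} {a : Fin m → ℝ} {h : ℕ} {b : ℕ → ℤ}

/-- The Fredholm determinant in terms of the running minima `b` of the time bounds. -/
theorem fredholmDet_cutKernel_eq_det_lead (hp0 : 0 < p) (hp1 : p < 1) {r R : ℝ} (hr0 : 0 < r)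
    (hr1 : r < 1) (hR1 : 1 < R) (hR : R < 1 / (1 - p)) (x : ℤ) (hn : StrictMono n) (hhN : h < N)
    (hh : ∀ i, (n i : ℕ) ≤ h) (hb : ∀ l i, l ≤ (n i : ℕ) → b l ≤ ⌊a i⌋)
    (hb' : ∀ l ≤ h, ∃ i, l ≤ (n i : ℕ) ∧ b l = ⌊a i⌋) :
    fredholmDet (cutKernel p N x r R n a) =
      (Matrix.of fun i l : Lead N h => -wtInt p 0 (p / 2) (x + N)
        (((l.1 : ℕ) : ℤ) - 1 - ((i.1 : ℕ) : ℤ)) (b l.1 + 1)).det := by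
  have hbm : ∀ l < h, b l ≤ b (l + 1) := by
    intro l hl
    obtain ⟨i, hi, hbi⟩ := hb' (l + 1) hl
    rw [hbi]; exact hb l i (by omega)
  have hin : ∀ l t, t < (b l - x + 1).toNat → levelCut x n a l t = 0 := by
    intro l t ht
    refine if_neg ?_
    rintro ⟨i, hi, hai⟩
    have h1 := hb l i hi.ge
    have h2 : x + t ≤ ⌊a i⌋ := by omega
    exact absurd (Int.le_floor.1 h2) (not_le.2 hai)
  have hout : ∀ l t i, (n i : ℕ) = l → b l = ⌊a i⌋ → ¬ t < (b l - x + 1).toNat →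
      levelCut x n a l t = 1 := by
    intro l t i hi hbi ht
    exact if_pos ⟨i, hi, Int.floor_lt.1 (by omega)⟩
  rw [fredholmDet_cutKernel_eq hp0 hp1 hr0 hr1 hR1 hR N x hn a hhN hh
    (fun l => (b l - x + 1).toNat)]
  · let e : Fin (h + 1) ≃ Lead N h :=
      { toFun := fun i => ⟨⟨i, by omega⟩, by simp; omega⟩
        invFun := fun i => ⟨i.1, by have := i.2; omega⟩
        left_inv := fun i => rfl
        right_inv := fun i => rfl }
    rw [← Matrix.det_submatrix_equiv_self e]
    congr 1
    ext i l
    simp only [Matrix.of_apply, Matrix.submatrix_apply, e, Equiv.coe_fn_mk]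
    rcases le_total x (b l + 1) with hle | hle
    · rw [show x + (((b l - x + 1).toNat : ℕ) : ℤ) = b l + 1 by omega]
    · rw [wtInt_small_eq_zero hp0 hp1 (by omega), wtInt_small_eq_zero hp0 hp1 (by omega)]
  · intro l hl
    have := hbm l hl
    omega
  · intro l hl t ht
    split_ifs with htl
    · rw [hin l t htl, sub_zero]
    -- A time in [B l, B (l + 1)) exists only if the running minimum jumps after l. The minimum is
    -- then attained at level l itself, so this level carries a cut-off.
    · obtain ⟨i, hi, hbi⟩ := hb' l hl.le
      have hil : (n i : ℕ) = l := by
        by_contra hne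
        have := hb (l + 1) i (by omega)
        omega
      rw [hout l t i hil hbi htl, sub_self]
  · intro t
    split_ifs with htl
    · rw [hin h t htl, sub_zero]
    · obtain ⟨i, hi, hbi⟩ := hb' h le_rfl
      rw [hout h t i (le_antisymm (hh i) hi) hbi htl, sub_self]

variable {Ω : Type*} [MeasurableSpace Ω] {μ : Measure Ω} [IsProbabilityMeasure μ]
  {X : ℕ → Ω → Config N}

/-- The joint distribution of the exit times as a Fredholm determinant. -/
theorem IsStepTASEP.real_jumpOffTime_eq (hX : IsStepTASEP μ N p X) (hp0 : 0 < p) (hp1 : p < 1)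
    {x : ℤ} (hx : 1 - (N : ℤ) ≤ x) (hn : StrictMono n) (a : Fin m → ℝ) {r R : ℝ} (hr0 : 0 < r)
    (hr1 : r < 1) (hR1 : 1 < R) (hR : R < 1 / (1 - p)) :
    (μ.real {ω | ∀ i, ∃ t : ℕ,
        jumpOffTime X (n i) (exitSite N x (n i)) ω = t ∧ (t : ℝ) ≤ a i} : ℂ) =
      fredholmDet (cutKernel p N x r R n a) := by
  rcases Nat.eq_zero_or_pos m with rfl | hm
  · have hempty : IsEmpty (LevelTime 0 x) := ⟨fun s => s.1.elim0⟩
    have h1 : fredholmDet (cutKernel p N x r R n a) = 1 := by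
      unfold fredholmDet
      rw [tsum_eq_single 0]
      · simp
      · intro k hk
        have : IsEmpty (Fin k → LevelTime 0 x) := ⟨fun s => (s ⟨0, by omega⟩).1.elim0⟩
        simp
    rw [h1]
    simp
  let last : Fin m := ⟨m - 1, by omega⟩
  obtain ⟨h, hlast⟩ : ∃ h : ℕ, h = ((n last : Fin N) : ℕ) := ⟨_, rfl⟩
  have hhN : h < N := hlast ▸ (n last).2
  have hh : ∀ i, (n i : ℕ) ≤ h := fun i => hlast ▸ hn.monotone (show i ≤ last by
    rw [Fin.le_def]; have := i.2; simp only [last]; omega)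
  have hex : ∀ l : ℕ, ∃ bl : ℤ, (∀ i, l ≤ (n i : ℕ) → bl ≤ ⌊a i⌋) ∧
      (l ≤ h → ∃ i, l ≤ (n i : ℕ) ∧ bl = ⌊a i⌋) := by
    intro l
    by_cases hl : l ≤ h
    · obtain ⟨i, hi, hmin⟩ := Finset.exists_min_image (univ.filter fun i => l ≤ (n i : ℕ))
        (fun i => ⌊a i⌋) ⟨last, by simpa [hlast] using hl⟩
      refine ⟨⌊a i⌋, fun j hj => hmin j (by simpa using hj), fun _ => ⟨i, by simpa using hi, rfl⟩⟩
    · exact ⟨0, fun i hi => absurd (hi.trans (hh i)) hl, fun hl' => absurd hl' hl⟩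
  choose b hb hb' using hex
  rw [fredholmDet_cutKernel_eq_det_lead hp0 hp1 hr0 hr1 hR1 hR x hn hhN hh hb hb']
  -- A negative bound makes the event empty. It forces b 0 + 1 ≤ 0, and the first column of the
  -- determinant has no pole left.
  by_cases hneg : ∃ i, a i < 0
  · obtain ⟨i, hi⟩ := hneg
    have hset : {ω | ∀ i, ∃ t : ℕ,
        jumpOffTime X (n i) (exitSite N x (n i)) ω = t ∧ (t : ℝ) ≤ a i} = ∅ := by
      ext ω
      simp only [Set.mem_ofPred_eq, Set.mem_empty_iff_false, iff_false]
      intro hω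
      obtain ⟨t, -, ht⟩ := hω i
      have : (0 : ℝ) ≤ t := Nat.cast_nonneg t
      linarith
    have hb0 : b 0 ≤ -1 := by
      have h1 := hb 0 i (Nat.zero_le _)
      have h2 : ⌊a i⌋ < 0 := Int.floor_lt.2 (by simpa using hi)
      omega
    rw [hset, Matrix.det_eq_zero_of_column_eq_zero (⟨⟨0, by omega⟩, Nat.zero_le _⟩ : Lead N h)]
    · simp
    · intro i
      simp only [Matrix.of_apply]
      rw [wtInt_small_eq_zero hp0 hp1 (by push_cast; omega), neg_zero]
  · push Not at hneg
    have hb0 : ∀ l ≤ h, 0 ≤ b l := by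
      intro l hl
      obtain ⟨i, -, hbi⟩ := hb' l hl
      rw [hbi]; exact Int.floor_nonneg.2 (hneg i)
    have hs : Monotone fun k : Lead N h => (b k.1).toNat + 1 := by
      intro k k' hkk
      obtain ⟨i, hi, hbi⟩ := hb' k'.1 k'.2
      have := hb k.1 i (le_trans (show (k.1 : ℕ) ≤ k'.1 from hkk) hi)
      simp only
      omega
    have hdet := hX.real_exit_eq_det hp0 hp1 (x + N) hs
    have hmat : (Matrix.of fun i l : Lead N h => -wtInt p 0 (p / 2) (x + N)
        (((l.1 : ℕ) : ℤ) - 1 - ((i.1 : ℕ) : ℤ)) (b l.1 + 1)) =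
        exitMat p ∅ (fun _ : Lead N h => (x + N).toNat) fun k => (b k.1).toNat + 1 := by
      ext i l
      have h1 : (((x + N).toNat : ℕ) : ℤ) = x + N := by omega
      have h2 : (((b l.1).toNat + 1 : ℕ) : ℤ) = b l.1 + 1 := by have := hb0 l.1 l.2; omega
      simp only [exitMat, rowEnt, Matrix.of_apply, notMem_empty, if_false, h1, h2]
    rw [hmat, ← hdet]
    congr 1
    refine measureReal_congr ?_
    filter_upwards [hX.ae_start, hX.ae_stepProb_ne_zero] with ω h0 hstep
    have hiff : (∀ i, ∃ t : ℕ, jumpOffTime X (n i) (exitSite N x (n i)) ω = t ∧ (t : ℝ) ≤ a i) ↔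
        ∀ k : Lead N h, x + N - ((k.1 : ℕ) : ℤ) ≤ (X ((b k.1).toNat + 1) ω).1 k.1 := by
      simp_rw [← jumpOffTime_le_iff h0 hstep hx]
      rw [forall_congr' fun i => exists_eq_coe_and_le_iff (hneg i)]
      have hfl : ∀ i, (⌊a i⌋₊ : ℤ) = ⌊a i⌋ := fun i => Int.natCast_floor_eq_floor (hneg i)
      -- Passing between the chosen particles and all leading ones: the bound of particle k is that
      -- of some chosen particle with at least its index, and exit times increase with the index.
      constructor
      · intro hω k
        obtain ⟨i, hi, hbi⟩ := hb' k.1 k.2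
        have h1 : (b k.1).toNat = ⌊a i⌋₊ := by rw [hbi, ← hfl]; simp
        rw [h1]
        exact (jumpOffTime_mono h0 hstep hx (show k.1 ≤ n i from hi)).trans (hω i)
      · intro hω i
        refine (hω ⟨n i, hh i⟩).trans ?_
        have h1 := hb (n i) i le_rfl
        have h2 := hfl i
        have : (b (n i)).toNat ≤ ⌊a i⌋₊ := by omega
        exact_mod_cast this
    exact propext hiff

end FredholmExit

/-! ### Almost sure finiteness of the exit times. -/

section Finiteness

open Filter Topology

variable {p : ℝ} {N m : ℕ} {n : Fin m → Fin N}

/-- Raising the bounds only deletes terms of the expansion, so the expansion with the smaller bounds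
dominates. -/
theorem fredholmTerm_cutKernel_eq (x : ℤ) (r R : ℝ) {a a' : Fin m → ℝ} (ha : a ≤ a')
    (q : Σ k : ℕ, (Fin k → LevelTime m x)) :
    fredholmTerm (cutKernel p N x r R n a') q =
      open Classical in if ∀ i, a' (q.2 i).1 < ((q.2 i).2.1 : ℝ) then
        fredholmTerm (cutKernel p N x r R n a) q else 0 := by
  split_ifs with hq
  · unfold fredholmTerm
    congr 2
    ext i j
    have h1 : ∀ i, cutoff a' (q.2 i) = 1 := fun i => if_pos (hq i)
    have h2 : ∀ i, cutoff a (q.2 i) = 1 := fun i => if_pos ((ha _).trans_lt (hq i))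
    simp only [Matrix.of_apply, cutKernel, h1, h2]
  · push Not at hq
    obtain ⟨i, hi⟩ := hq
    unfold fredholmTerm
    rw [Matrix.det_eq_zero_of_row_eq_zero i, mul_zero]
    intro j
    have h1 : cutoff a' (q.2 i) = 0 := if_neg (not_lt.2 hi)
    simp [cutKernel, h1]

/-- The Fredholm determinant tends to one as the time bounds tend to infinity. -/
theorem tendsto_fredholmDet_cutKernel (hp0 : 0 < p) (hp1 : p < 1) {r R : ℝ} (hr0 : 0 < r)
    (hr1 : r < 1) (hR1 : 1 < R) (hR : R < 1 / (1 - p)) (x : ℤ) (hn : StrictMono n) :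
    Tendsto (fun A : ℕ => fredholmDet (cutKernel p N x r R n fun _ => (A : ℝ))) atTop (𝓝 1) := by
  have hsum : ∀ a, FredholmSummable (cutKernel p N x r R n a) := fun a =>
    (cutKernel_traceClass_and_summable hp0 hp1 hr0 hr1 hR1 hR N x hn a).2
  have hlim : Tendsto (fun A : ℕ => ∑' q, fredholmTerm (cutKernel p N x r R n fun _ => (A : ℝ)) q)
      atTop (𝓝 (∑' q : Σ k : ℕ, (Fin k → LevelTime m x), if q.1 = 0 then 1 else 0)) := by
    refine tendsto_tsum_of_dominated_convergence (fredholmSummable_iff.1 (hsum fun _ => 0))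
      (fun q => ?_) (Eventually.of_forall fun A q => ?_)
    · obtain ⟨k, s⟩ := q
      rcases Nat.eq_zero_or_pos k with rfl | hk
      · refine tendsto_const_nhds.congr fun A => ?_
        simp [fredholmTerm]
      · rw [if_neg hk.ne']
        refine tendsto_const_nhds.congr' ?_
        filter_upwards [eventually_ge_atTop (s ⟨0, hk⟩).2.1.toNat] with A hA
        rw [fredholmTerm_cutKernel_eq x r R (a := fun _ => (A : ℝ)) le_rfl, if_neg]
        push Not
        refine ⟨⟨0, hk⟩, ?_⟩
        have : (s ⟨0, hk⟩).2.1 ≤ (A : ℤ) := by omega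
        exact_mod_cast this
    · rw [fredholmTerm_cutKernel_eq x r R (a := fun _ => 0) (fun _ => Nat.cast_nonneg A)]
      split_ifs
      · exact le_rfl
      · rw [norm_zero]; exact norm_nonneg _
  have hone : (∑' q : Σ k : ℕ, (Fin k → LevelTime m x), if q.1 = 0 then (1 : ℂ) else 0) = 1 := by
    -- Only the term of order zero, the empty minor, survives in the limit.
    rw [tsum_eq_single ⟨0, Fin.elim0⟩]
    · simp
    · rintro ⟨k, s⟩ hq
      refine if_neg fun hk => hq ?_
      have hk : k = 0 := hk
      subst hk
      congr 1
      exact Subsingleton.elim _ _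
  rw [hone] at hlim
  exact hlim.congr fun A => (fredholmDet_eq_tsum (hsum _)).symm

variable {Ω : Type*} [MeasurableSpace Ω] {μ : Measure Ω} [IsProbabilityMeasure μ]
  {X : ℕ → Ω → Config N}

theorem IsStepTASEP.ae_jumpOffTime_ne_top (hX : IsStepTASEP μ N p X) (hp0 : 0 < p) (hp1 : p < 1)
    {x : ℤ} (hx : 1 - (N : ℤ) ≤ x) (hn : StrictMono n) {r R : ℝ} (hr0 : 0 < r)
    (hr1 : r < 1) (hR1 : 1 < R) (hR : R < 1 / (1 - p)) :
    ∀ᵐ ω ∂μ, ∀ i, jumpOffTime X (n i) (exitSite N x (n i)) ω ≠ ⊤ := by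
  let M : ℕ → Set Ω := fun A => {ω | ∀ i, x + N - ((n i : ℕ) : ℤ) ≤ (X (A + 1) ω).1 (n i)}
  have hM : ∀ A, MeasurableSet (M A) := fun A => hX.measurable (A + 1)
    (Set.to_countable {d : Config N | ∀ i, x + N - ((n i : ℕ) : ℤ) ≤ d.1 (n i)}).measurableSet
  have hprob : ∀ A : ℕ, (μ.real (M A) : ℂ) =
      fredholmDet (cutKernel p N x r R n fun _ => (A : ℝ)) := by
    intro A
    rw [← hX.real_jumpOffTime_eq hp0 hp1 hx hn _ hr0 hr1 hR1 hR]
    congr 1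
    refine measureReal_congr ?_
    filter_upwards [hX.ae_start, hX.ae_stepProb_ne_zero] with ω h0 hstep
    refine propext (forall_congr' fun i => ?_)
    rw [exists_eq_coe_and_le_iff (Nat.cast_nonneg A), Nat.floor_natCast,
      jumpOffTime_le_iff h0 hstep hx]
  -- The distribution formula with equal bounds A gives total mass one for the exits, without a
  -- separate argument that the particles move on.
  have hlim : Tendsto (fun A => μ.real (M A)) atTop (𝓝 1) := by
    have := tendsto_fredholmDet_cutKernel (N := N) hp0 hp1 hr0 hr1 hR1 hR x hn
    simp_rw [← hprob] at this
    have hre := (Complex.continuous_re.tendsto 1).comp this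
    exact hre
  have hU : 1 ≤ μ.real (⋃ A, M A) :=
    le_of_tendsto hlim (Eventually.of_forall fun A => measureReal_mono (Set.subset_iUnion M A))
  have hU' : μ (⋃ A, M A) = 1 := by
    have h1 : μ.real (⋃ A, M A) = 1 := le_antisymm measureReal_le_one hU
    rwa [Measure.real, ENNReal.toReal_eq_one_iff] at h1
  have hae : ∀ᵐ ω ∂μ, ω ∈ ⋃ A, M A :=
    (prob_compl_eq_zero_iff (MeasurableSet.iUnion hM)).2 hU'
  filter_upwards [hX.ae_start, hX.ae_stepProb_ne_zero, hae] with ω h0 hstep hω i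
  obtain ⟨A, hA⟩ := Set.mem_iUnion.1 hω
  exact ne_top_of_le_ne_top (ENat.natCast_ne_top A)
    ((jumpOffTime_le_iff h0 hstep hx (n i) A).2 (hA i))

end Finiteness

end

theorem mainTheorem1 {Ω : Type*} [MeasurableSpace Ω] (μ : Measure Ω) [IsProbabilityMeasure μ]
    (N : ℕ) (p : ℝ) (hp0 : 0 < p) (hp1 : p < 1)
    (X : ℕ → Ω → Config N) (hX : IsStepTASEP μ N p X)
    (x : ℤ) (hx : 1 - (N : ℤ) ≤ x)
    (m : ℕ) (n : Fin m → Fin N) (hn : StrictMono n) (a : Fin m → ℝ)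
    (r R : ℝ) (hr0 : 0 < r) (hr1 : r < 1) (hR1 : 1 < R) (hR : R < 1 / (1 - p)) :
    (∀ᵐ ω ∂μ, (∀ i, jumpOffTime X (n i) (exitSite N x (n i)) ω ≠ ⊤) ∧
      Monotone fun i => jumpOffTime X (n i) (exitSite N x (n i)) ω) ∧
    TraceClassUpToConjugation (cutKernel p N x r R n a) ∧
    FredholmSummable (cutKernel p N x r R n a) ∧
    (μ.real {ω | ∀ i, ∃ t : ℕ,
        jumpOffTime X (n i) (exitSite N x (n i)) ω = t ∧ (t : ℝ) ≤ a i} : ℂ) =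
      fredholmDet (cutKernel p N x r R n a) := by
  have hker := cutKernel_traceClass_and_summable hp0 hp1 hr0 hr1 hR1 hR N x hn a
  refine ⟨?_, hker.1, hker.2, hX.real_jumpOffTime_eq hp0 hp1 hx hn a hr0 hr1 hR1 hR⟩
  filter_upwards [hX.ae_start, hX.ae_stepProb_ne_zero,
    hX.ae_jumpOffTime_ne_top hp0 hp1 hx hn hr0 hr1 hR1 hR] with ω h0 hstep htop
  exact ⟨htop, fun i j hij => jumpOffTime_mono h0 hstep hx (hn.monotone hij)⟩
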